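/- For an integer $k>1$ and $\lambda\in\mathbb{R}$, consider on $(0,\infty)$ the functions \[ \begin{aligned} u_{18}(x)&=x^{1/k}\big((2k+1)x^2+1\big)^3, & u_{19}(x)&=-x^{1/k}\big((2k+1)x^3+x\big)^2,\\ u_{20}(x)&=-x^{\frac1k+3}\big((2k+1)x^2+1\big)^2, & u_{21}(x)&=x^{\frac{3}{2k}+1}\big((2k+1)x^2+1\big)^3,\\ u_{22}(x)&=x^{\frac1k+1}\big((2k+1)x^2+1\big)^3, & u_{23}(x)&=(x^2+1)\,x^{\frac{3}{2k}}\big((2k+1)x^2+1\big)^3, \end{aligned} \] \[ \begin{aligned} u_{24}^{\lambda}(x)={}&\lambda^3(2k+1)^3x^5+\big(3(8k^2+6k+1)\lambda^2+1\big)x^2+\lambda x\big(-4k^2\lambda^2-2k(\lambda^2-3)+3\big)+1\\ &+(2k+1)\Big(\lambda x^3\big((4k^2+1)\lambda^2+k(4\lambda^2-6)+3\big)+x^4\big(3\lambda^2+k(6\lambda^2+2)\big)\Big), \end{aligned} \] and let $\mathcal F_7^{k,\lambda}=[u_{18},u_{19},u_{20},u_{21},u_{22},u_{23},u_{24}^{\lambda}]$.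 For $0<a<b$ let $\mathcal Z(\mathcal F_7^{k,\lambda})$ on $[a,b]$ be the maximum number of zeros in $[a,b]$, counting multiplicity, of a function in the real linear span $\operatorname{Span}(\mathcal F_7^{k,\lambda})$ that is not identically zero on $[a,b]$. Then for every integer $k>1$, every $\lambda\in\mathbb{R}$ and all $0<a<b$, $\mathcal Z(\mathcal F_7^{k,\lambda})\le 14$ on $[a,b]$. In addition, for every integer $k>1$, in the case $\lambda=1$, there exists a function in $\operatorname{Span}(\mathcal F_7^{k,1})$ having at least $9$ simple zeros in $(0,\infty)$. -/

import Mathlib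

/-- The multiplicity of `x` as a zero of `f` (for `f` smooth near `x`): the supremum in `ℕ∞` of the
`m` such that `f` and its derivatives of order less than `m` all vanish at `x`.
It is `0` when `f x ≠ 0`, and `⊤` when all derivatives vanish at `x`. -/
noncomputable def zeroMultiplicity (f : ℝ → ℝ) (x : ℝ) : ℕ∞ :=
  ⨆ (m : ℕ) (_ : ∀ j < m, iteratedDeriv j f x = 0), (m : ℕ∞)

/-- The number of zeros of `f` in `[a, b]`, counting multiplicity: the supremum over the
finite subsets of `[a, b]` of the sum of the multiplicities. -/
noncomputable def zeroCount (f : ℝ → ℝ) (a b : ℝ) : ℕ∞ :=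
  ⨆ (s : Finset ℝ) (_ : (s : Set ℝ) ⊆ Set.Icc a b), ∑ x ∈ s, zeroMultiplicity f x

/-- The set of all real linear combinations of a finite ordered set of functions. -/
noncomputable def familySpan {n : ℕ} (F : Fin n → ℝ → ℝ) : Submodule ℝ (ℝ → ℝ) :=
  Submodule.span ℝ (Set.range F)

/-- `𝒵(F)` on `[a, b]`, for functions that are smooth in a neighbourhood of `[a, b]`: the maximum
number of zeros in `[a, b]`, counting multiplicity, of an element of the span of `F` that is
nontrivial, that is, not identically zero on `[a, b]`. -/
noncomputable def maxZeros {n : ℕ} (F : Fin n → ℝ → ℝ) (a b : ℝ) : ℕ∞ :=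
  ⨆ (f : ℝ → ℝ) (_ : f ∈ familySpan F) (_ : ∃ x ∈ Set.Icc a b, f x ≠ 0), zeroCount f a b

/-- `x` is a simple zero of `f`. -/
def IsSimpleZero (f : ℝ → ℝ) (x : ℝ) : Prop := f x = 0 ∧ deriv f x ≠ 0

/-! The seven functions of the family. They are meant on `(0, ∞)`; only positive arguments are
used. -/

noncomputable def u18 (k : ℕ) (x : ℝ) : ℝ :=
  x ^ (1 / (k : ℝ)) * ((2 * (k : ℝ) + 1) * x ^ 2 + 1) ^ 3

noncomputable def u19 (k : ℕ) (x : ℝ) : ℝ :=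
  -(x ^ (1 / (k : ℝ)) * ((2 * (k : ℝ) + 1) * x ^ 3 + x) ^ 2)

noncomputable def u20 (k : ℕ) (x : ℝ) : ℝ :=
  -(x ^ (1 / (k : ℝ) + 3) * ((2 * (k : ℝ) + 1) * x ^ 2 + 1) ^ 2)

noncomputable def u21 (k : ℕ) (x : ℝ) : ℝ :=
  x ^ (3 / (2 * (k : ℝ)) + 1) * ((2 * (k : ℝ) + 1) * x ^ 2 + 1) ^ 3

noncomputable def u22 (k : ℕ) (x : ℝ) : ℝ :=
  x ^ (1 / (k : ℝ) + 1) * ((2 * (k : ℝ) + 1) * x ^ 2 + 1) ^ 3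

noncomputable def u23 (k : ℕ) (x : ℝ) : ℝ :=
  (x ^ 2 + 1) * x ^ (3 / (2 * (k : ℝ))) * ((2 * (k : ℝ) + 1) * x ^ 2 + 1) ^ 3

noncomputable def u24 (k : ℕ) (lam : ℝ) (x : ℝ) : ℝ :=
  x ^ 5 * lam ^ 3 * (2 * (k : ℝ) + 1) ^ 3
    + x ^ 2 * (3 * (8 * (k : ℝ) ^ 2 + 6 * (k : ℝ) + 1) * lam ^ 2 + 1)
    + lam * x * (-4 * (k : ℝ) ^ 2 * lam ^ 2 - 2 * (k : ℝ) * (lam ^ 2 - 3) + 3)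
    + 1
    + (2 * (k : ℝ) + 1) *
        (lam * x ^ 3 * ((4 * (k : ℝ) ^ 2 + 1) * lam ^ 2 + (k : ℝ) * (4 * lam ^ 2 - 6) + 3)
          + x ^ 4 * (3 * lam ^ 2 + (k : ℝ) * (6 * lam ^ 2 + 2)))

/-- The ordered set `[u₁₈, u₁₉, u₂₀, u₂₁, u₂₂, u₂₃, u₂₄]` with parameters `k` and `λ`. -/
noncomputable def family7 (k : ℕ) (lam : ℝ) : Fin 7 → ℝ → ℝ :=
  ![u18 k, u19 k, u20 k, u21 k, u22 k, u23 k, u24 k lam]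

/-! Put m = 2k and z = (m+1)x². On (0,∞) the function `u24` is a polynomial of degree at most 5, and
the other six functions lie in the span of the six terms of `Chain.start`. The upper bound is proved
for every polynomial of degree at most 5 plus a combination of these terms, so λ plays no role.

The tool is Rolle's theorem with multiplicities. Passing from f to the Wronskian W(T,f) = T²(f/T)'
loses at most one zero if T has no zero, and at most two if T has at most one zero, that one simple
(`AtMost.of_wron`, `AtMost.of_wron_of_simple`). Six derivatives kill the polynomial and cost 6. The
pivots `qU0`, `rU1`, `sU3` are negative for m ≥ 4 and cost 3. The pivot `tU2` has at most one zero,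
because x^(-7) `tU2` is increasing in x, and costs 2. What remains is the plane spanned by x·`yO`
and `yE`, up to a power of x, where 3 zeros are possible: 6 + 3 + 2 + 3 = 14.

Division by `yO` alone does not give 3 in this plane (`Chain.zeroBound_pair`): `yO` changes sign at
a point τ, and the Wronskian `tU2`·`wOE` may vanish on both sides of τ. But K x `yO` − `yE` is
positive for z < 1/4 with a suitable K. An element of the plane is a multiple of (K + b/c) x `yO` −
(K x `yO` − `yE`), so according to the sign of K + b/c it has no zero on (0, τ], or none from τ up
to z = 1/4. Rolle on the remaining intervals gives 3 in both cases.

The facts about the chain are identities and inequalities between integer polynomials in m and z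
with very large coefficients. Identities are checked by Kronecker substitution: a polynomial
vanishing at a point that is large compared to its coefficients is zero. For inequalities, the
region is parametrized by a quadrant v, w ≥ 0 on which the polynomial has nonnegative coefficients;
these are read off as the digits of one integer value.

For the lower bound, `baseFun` has four sign changes. Adding small multiples of five functions, each
of larger growth at infinity than the previous ones, creates five more. A last small multiple of
`u18`, chosen by Sard's theorem, makes all zeros simple. -/

/-! ### Integer polynomials in one and two variables as coefficient lists -/

section CoefficientLists

variable {R : Type*} [CommSemiring R]

/-- Value at `m` of the polynomial with coefficient list `c`, coefficients being read through `ι`. -/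
def evU (ι : ℤ → R) (m : R) : List ℤ → R
  | [] => 0
  | a :: s => ι a + m * evU ι m s

/-- Value at `(m, z)` of the polynomial in `z` whose coefficients are polynomials in `m`. -/
def evB (ι : ℤ → R) (m z : R) : List (List ℤ) → R
  | [] => 0
  | c :: s => evU ι m c + z * evB ι m z s

/-- The homogenization of `evB` in its second variable, of degree `p.length - 1`. -/
def hev (ι : ℤ → R) (m N D : R) : List (List ℤ) → R
  | [] => 0
  | c :: s => evU ι m c * D ^ s.length + N * hev ι m N D s

def uadd : List ℤ → List ℤ → List ℤ
  | [], b => b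
  | a :: s, [] => a :: s
  | a :: s, b :: t => (a + b) :: uadd s t

def usmul (c : ℤ) : List ℤ → List ℤ
  | [] => []
  | a :: s => (c * a) :: usmul c s

def umul : List ℤ → List ℤ → List ℤ
  | [], _ => []
  | a :: s, b => uadd (usmul a b) (0 :: umul s b)

def badd : List (List ℤ) → List (List ℤ) → List (List ℤ)
  | [], b => b
  | a :: s, [] => a :: s
  | a :: s, b :: t => uadd a b :: badd s t

def bsmul (c : List ℤ) : List (List ℤ) → List (List ℤ)
  | [] => []
  | a :: s => umul c a :: bsmul c s

def bmul : List (List ℤ) → List (List ℤ) → List (List ℤ)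
  | [], _ => []
  | a :: s, b => badd (bsmul a b) ([] :: bmul s b)

/-- The operator multiplying the coefficient of `z ^ l` by `i + l`. -/
def theta (i : ℤ) : List (List ℤ) → List (List ℤ)
  | [] => []
  | c :: s => usmul i c :: theta (i + 1) s

end CoefficientLists

section Hom

variable {R : Type*} [CommRing R]

/-- The coercion of integer coefficients. -/
abbrev ic : ℤ → R := fun a => (a : R)

theorem evU_uadd (m : R) (p q : List ℤ) : evU ic m (uadd p q) = evU ic m p + evU ic m q := by
  induction p generalizing q with
  | nil => simp [uadd, evU]
  | cons a s ih =>
    cases q with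
    | nil => simp [uadd, evU]
    | cons b t => simp only [uadd, evU, ih]; push_cast; ring

theorem evU_usmul (m : R) (c : ℤ) (q : List ℤ) : evU ic m (usmul c q) = c * evU ic m q := by
  induction q with
  | nil => simp [usmul, evU]
  | cons a s ih => simp only [usmul, evU, ih]; push_cast; ring

theorem evU_umul (m : R) (p q : List ℤ) : evU ic m (umul p q) = evU ic m p * evU ic m q := by
  induction p with
  | nil => simp [umul, evU]
  | cons a s ih => simp only [umul, evU, evU_uadd, evU_usmul, ih]; push_cast; ring

theorem evB_badd (m z : R) (p q : List (List ℤ)) :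
    evB ic m z (badd p q) = evB ic m z p + evB ic m z q := by
  induction p generalizing q with
  | nil => simp [badd, evB]
  | cons a s ih =>
    cases q with
    | nil => simp [badd, evB]
    | cons b t => simp only [badd, evB, ih, evU_uadd]; ring

theorem evB_bsmul (m z : R) (c : List ℤ) (q : List (List ℤ)) :
    evB ic m z (bsmul c q) = evU ic m c * evB ic m z q := by
  induction q with
  | nil => simp [bsmul, evB]
  | cons a s ih => simp only [bsmul, evB, ih, evU_umul]; ring

theorem evB_bmul (m z : R) (p q : List (List ℤ)) :
    evB ic m z (bmul p q) = evB ic m z p * evB ic m z q := by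
  induction p with
  | nil => simp [bmul, evB]
  | cons a s ih => simp only [bmul, evB, evB_badd, evB_bsmul, ih, evU]; ring

/-- The weights i + l are affine in i, so a shift of the starting index only adds a multiple of the
polynomial itself. -/
theorem evB_theta_add (m z : R) (i : ℤ) (p : List (List ℤ)) :
    evB ic m z (theta i p) = i * evB ic m z p + evB ic m z (theta 0 p) := by
  induction p generalizing i with
  | nil => simp [theta, evB]
  | cons c s ih =>
    simp only [theta, evB, evU_usmul]
    rw [ih (i + 1), ih (0 + 1)]
    push_cast
    ring

/-- The additional factor D on the left avoids the truncated exponent `p.length - 1`, so that the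
empty list needs no exception. -/
theorem hev_mul (m N D y : R) (h : N = D * y) (p : List (List ℤ)) :
    D * hev ic m N D p = D ^ p.length * evB ic m y p := by
  induction p with
  | nil => simp [hev, evB]
  | cons c s ih =>
    simp only [hev, evB, List.length_cons]
    rw [mul_add, mul_left_comm D N, ih, h]
    ring

end Hom

/-! ### Kronecker substitution: absolute coefficient sums and vanishing at a large point -/

section Majorant

/-- The absolute values of integer coefficients. -/
abbrev na : ℤ → ℕ := Int.natAbs

theorem evU_uadd_le (m : ℕ) (p q : List ℤ) :
    evU na m (uadd p q) ≤ evU na m p + evU na m q := by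
  induction p generalizing q with
  | nil => simp [uadd, evU]
  | cons a s ih =>
    cases q with
    | nil => simp [uadd, evU]
    | cons b t =>
      simp only [uadd, evU]
      have h := Nat.mul_le_mul_left m (ih t)
      have h2 : na (a + b) ≤ na a + na b := Int.natAbs_add_le a b
      rw [mul_add] at h
      omega

theorem evU_usmul_na (m : ℕ) (c : ℤ) (q : List ℤ) :
    evU na m (usmul c q) = c.natAbs * evU na m q := by
  induction q with
  | nil => simp [usmul, evU]
  | cons a s ih => simp only [usmul, evU, ih, na, Int.natAbs_mul]; ring

theorem evU_umul_le (m : ℕ) (p q : List ℤ) :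
    evU na m (umul p q) ≤ evU na m p * evU na m q := by
  induction p with
  | nil => simp [umul, evU]
  | cons a s ih =>
    simp only [umul, evU]
    refine (evU_uadd_le _ _ _).trans ?_
    rw [evU_usmul_na]
    simp only [evU, na, Int.natAbs_zero, zero_add]
    have h := Nat.mul_le_mul_left m ih
    calc _ ≤ a.natAbs * evU Int.natAbs m q + m * (evU na m s * evU na m q) := by
          exact Nat.add_le_add_left h _
      _ = _ := by simp only [na]; ring

theorem evB_badd_le (m z : ℕ) (p q : List (List ℤ)) :
    evB na m z (badd p q) ≤ evB na m z p + evB na m z q := by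
  induction p generalizing q with
  | nil => simp [badd, evB]
  | cons a s ih =>
    cases q with
    | nil => simp [badd, evB]
    | cons b t =>
      simp only [badd, evB]
      have h := Nat.mul_le_mul_left z (ih t)
      have h2 := evU_uadd_le m a b
      rw [mul_add] at h
      omega

theorem evB_bsmul_le (m z : ℕ) (c : List ℤ) (q : List (List ℤ)) :
    evB na m z (bsmul c q) ≤ evU na m c * evB na m z q := by
  induction q with
  | nil => simp [bsmul, evB]
  | cons a s ih =>
    simp only [bsmul, evB]
    have h := Nat.mul_le_mul_left z ih
    have h2 := evU_umul_le m c a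
    calc _ ≤ evU na m c * evU na m a + z * (evU na m c * evB na m z s) := Nat.add_le_add h2 h
      _ = _ := by ring

theorem evB_bmul_le (m z : ℕ) (p q : List (List ℤ)) :
    evB na m z (bmul p q) ≤ evB na m z p * evB na m z q := by
  induction p with
  | nil => simp [bmul, evB]
  | cons a s ih =>
    simp only [bmul, evB]
    refine (evB_badd_le _ _ _ _).trans ?_
    simp only [evB, evU, zero_add]
    have h := Nat.mul_le_mul_left z ih
    have h2 := evB_bsmul_le m z a q
    calc _ ≤ evU na m a * evB na m z q + z * (evB na m z s * evB na m z q) := Nat.add_le_add h2 h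
      _ = _ := by ring

/-- The constant coefficient is divisible by b and smaller than b in absolute value, hence zero;
after division by b the argument repeats. -/
theorem evU_eq_zero_of_small {b : ℕ} {p : List ℤ} (h0 : evU ic (b : ℤ) p = 0)
    (h1 : evU na 1 p < b) : ∀ a ∈ p, a = 0 := by
  induction p with
  | nil => simp
  | cons a s ih =>
    simp only [evU, na, one_mul, Int.cast_id] at h0 h1
    have ha : a = 0 := by
      apply Int.eq_zero_of_abs_lt_dvd (m := (b : ℤ))
      · exact ⟨-evU ic (b : ℤ) s, by linarith⟩
      · rw [Int.abs_eq_natAbs]; exact_mod_cast (by omega : a.natAbs < b)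
    subst ha
    have hb : (b : ℤ) ≠ 0 := by
      have : 0 < b := by omega
      exact_mod_cast this.ne'
    have h2 : evU ic (b : ℤ) s = 0 := by
      rw [zero_add] at h0
      exact (mul_eq_zero.mp h0).resolve_left hb
    intro x hx
    rcases List.mem_cons.mp hx with rfl | hx
    · rfl
    · exact ih h2 (by simpa using h1) x hx

theorem evU_zero {R : Type*} [CommRing R] (m : R) {p : List ℤ} (h : ∀ a ∈ p, a = 0) :
    evU ic m p = 0 := by
  induction p with
  | nil => rfl
  | cons a s ih =>
    simp only [evU]
    rw [ih (fun x hx => h x (List.mem_cons_of_mem _ hx)), h a (by simp)]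
    simp

theorem natAbs_evU_le (b : ℕ) (p : List ℤ) : (evU ic (b : ℤ) p).natAbs ≤ evU na b p := by
  induction p with
  | nil => simp [evU]
  | cons a s ih =>
    simp only [evU, Int.cast_id]
    refine (Int.natAbs_add_le _ _).trans ?_
    rw [Int.natAbs_mul, Int.natAbs_natCast]
    exact Nat.add_le_add_left (Nat.mul_le_mul_left _ ih) _

/-- An integer polynomial in two variables vanishing at a point with coordinates large compared to
its coefficients is zero. -/
theorem evB_eq_zero_of_small {b₁ b₂ : ℕ} {p : List (List ℤ)}
    (h0 : evB ic (b₁ : ℤ) (b₂ : ℤ) p = 0) (h1 : evB na 1 1 p < b₁) (h2 : evB na b₁ 1 p < b₂)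
    {R : Type*} [CommRing R] (m z : R) : evB ic m z p = 0 := by
  induction p with
  | nil => rfl
  | cons c s ih =>
    simp only [evB, one_mul] at h0 h1 h2 ⊢
    have hc : evU ic (b₁ : ℤ) c = 0 := by
      apply Int.eq_zero_of_abs_lt_dvd (m := (b₂ : ℤ))
      · exact ⟨-evB ic (b₁ : ℤ) (b₂ : ℤ) s, by linarith⟩
      · rw [Int.abs_eq_natAbs]
        have := natAbs_evU_le b₁ c
        exact_mod_cast (by omega : (evU ic (b₁ : ℤ) c).natAbs < b₂)
    have hb : (b₂ : ℤ) ≠ 0 := by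
      have : 0 < b₂ := by omega
      exact_mod_cast this.ne'
    rw [hc, zero_add] at h0
    rw [ih ((mul_eq_zero.mp h0).resolve_left hb) (by omega) (by omega),
      evU_zero m (evU_eq_zero_of_small hc (by omega))]
    simp

end Majorant

/-- `F` is the function of an integer polynomial in two variables with value `n` at `(b₁, b₂)`,
the sum of whose absolute coefficients, weighted by the powers of `1` resp. `b₁` in the first
variable, is at most `s` resp. `t`. -/
def Packed (b₁ b₂ : ℕ) (F : ℝ → ℝ → ℝ) (n : ℤ) (s t : ℕ) : Prop :=
  ∃ p : List (List ℤ), (∀ m z, F m z = evB ic m z p) ∧ evB ic (b₁ : ℤ) (b₂ : ℤ) p = n ∧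
    evB na 1 1 p ≤ s ∧ evB na b₁ 1 p ≤ t

namespace Packed

variable {b₁ b₂ : ℕ} {F G : ℝ → ℝ → ℝ} {n n' : ℤ} {s t s' t' : ℕ}

theorem lit (p : List (List ℤ)) : Packed b₁ b₂ (fun m z => evB ic m z p)
    (evB ic (b₁ : ℤ) (b₂ : ℤ) p) (evB na 1 1 p) (evB na b₁ 1 p) :=
  ⟨p, fun _ _ => rfl, rfl, le_rfl, le_rfl⟩

theorem add (hF : Packed b₁ b₂ F n s t) (hG : Packed b₁ b₂ G n' s' t') :
    Packed b₁ b₂ (fun m z => F m z + G m z) (n + n') (s + s') (t + t') := by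
  obtain ⟨p, h1, h2, h3, h4⟩ := hF
  obtain ⟨q, g1, g2, g3, g4⟩ := hG
  exact ⟨badd p q, fun m z => by simp only [evB_badd, h1, g1], by rw [evB_badd, h2, g2],
    (evB_badd_le _ _ _ _).trans (Nat.add_le_add h3 g3),
    (evB_badd_le _ _ _ _).trans (Nat.add_le_add h4 g4)⟩

theorem mul (hF : Packed b₁ b₂ F n s t) (hG : Packed b₁ b₂ G n' s' t') :
    Packed b₁ b₂ (fun m z => F m z * G m z) (n * n') (s * s') (t * t') := by
  obtain ⟨p, h1, h2, h3, h4⟩ := hF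
  obtain ⟨q, g1, g2, g3, g4⟩ := hG
  exact ⟨bmul p q, fun m z => by simp only [evB_bmul, h1, g1], by rw [evB_bmul, h2, g2],
    (evB_bmul_le _ _ _ _).trans (Nat.mul_le_mul h3 g3),
    (evB_bmul_le _ _ _ _).trans (Nat.mul_le_mul h4 g4)⟩

theorem const (a : ℤ) : Packed b₁ b₂ (fun _ _ => (a : ℝ)) a a.natAbs a.natAbs := by
  refine ⟨[[a]], ?_, ?_, ?_, ?_⟩ <;> simp [evB, evU]

theorem pow (hF : Packed b₁ b₂ F n s t) (k : ℕ) :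
    Packed b₁ b₂ (fun m z => F m z ^ k) (n ^ k) (s ^ k) (t ^ k) := by
  induction k with
  | zero => simpa using const (b₁ := b₁) (b₂ := b₂) 1
  | succ k ih => simpa only [pow_succ] using ih.mul hF

/-- By Horner's scheme a packed function can be substituted into a polynomial. The product lists
exist only in the proof; what the kernel computes are the three integers. -/
theorem evU (hF : Packed b₁ b₂ F n s t) (c : List ℤ) :
    Packed b₁ b₂ (fun m z => evU ic (F m z) c) (evU ic n c) (evU na s c) (evU na t c) := by
  induction c with
  | nil => simpa [_root_.evU] using const (b₁ := b₁) (b₂ := b₂) 0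
  | cons a c ih => exact (const a).add (hF.mul ih)

theorem hev (hF : Packed b₁ b₂ F n s t) {N D : ℝ → ℝ → ℝ} {nN nD : ℤ} {sN tN sD tD : ℕ}
    (hN : Packed b₁ b₂ N nN sN tN) (hD : Packed b₁ b₂ D nD sD tD) (p : List (List ℤ)) :
    Packed b₁ b₂ (fun m z => hev ic (F m z) (N m z) (D m z) p) (hev ic n nN nD p)
      (hev na s sN sD p) (hev na t tN tD p) := by
  induction p with
  | nil => simpa [_root_.hev] using const (b₁ := b₁) (b₂ := b₂) 0
  | cons c p ih => exact ((hF.evU c).mul (hD.pow _)).add (hN.mul ih)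

theorem eq_zero (hF : Packed b₁ b₂ F 0 s t) (h1 : s < b₁) (h2 : t < b₂) (m z : ℝ) :
    F m z = 0 := by
  obtain ⟨p, e1, e2, e3, e4⟩ := hF
  rw [e1]
  exact evB_eq_zero_of_small e2 (e3.trans_lt h1) (e4.trans_lt h2) m z

end Packed

/-! ### Positivity on the quadrant by reading coefficients as digits -/

/-- The value of `f` at `n`, in a form that makes the kernel evaluate `n` first. -/
def force {α : Type*} (n : ℕ) (f : ℕ → α) : α :=
  match n with
  | 0 => f 0
  | k + 1 => f (k + 1)

theorem force_eq {α : Type*} (n : ℕ) (f : ℕ → α) : force n f = f n := by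
  cases n <;> rfl

/-- The first `k` digits of `n` in base `b`. -/
def lowDigits (b : ℕ) : ℕ → ℕ → List ℕ
  | 0, _ => []
  | k + 1, n => (n % b) :: force (n / b) (lowDigits b k)

/-- The rows of digits in base `b₁` of the digits in base `b₂` of `n`. -/
def digitRows (b₁ b₂ k₁ k₂ n : ℕ) : List (List ℤ) :=
  (lowDigits b₂ k₂ n).map fun r => (force r (lowDigits b₁ k₁)).map Int.ofNat

theorem evU_nonneg {m : ℝ} (hm : 0 ≤ m) {p : List ℤ} (hp : ∀ a ∈ p, 0 ≤ a) :
    0 ≤ evU ic m p := by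
  induction p with
  | nil => exact le_rfl
  | cons a s ih =>
    have ha : (0 : ℝ) ≤ a := by exact_mod_cast hp a (by simp)
    have := ih fun x hx => hp x (List.mem_cons_of_mem _ hx)
    simp only [evU]
    positivity

theorem evB_nonneg {m z : ℝ} (hm : 0 ≤ m) (hz : 0 ≤ z) {p : List (List ℤ)}
    (hp : ∀ c ∈ p, ∀ a ∈ c, 0 ≤ a) : 0 ≤ evB ic m z p := by
  induction p with
  | nil => exact le_rfl
  | cons c s ih =>
    have hc := evU_nonneg hm (hp c (by simp))
    have := ih fun x hx => hp x (List.mem_cons_of_mem _ hx)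
    simp only [evB]
    positivity

/-- A positive constant coefficient makes a polynomial with nonnegative coefficients strictly
positive on the closed quadrant. -/
def headPos : List (List ℤ) → Bool
  | (a :: _) :: _ => decide (0 < a)
  | _ => false

theorem evB_pos {m z : ℝ} (hm : 0 ≤ m) (hz : 0 ≤ z) {p : List (List ℤ)}
    (hp : ∀ c ∈ p, ∀ a ∈ c, 0 ≤ a) (h : headPos p = true) : 0 < evB ic m z p := by
  match p, h with
  | (a :: c) :: s, h =>
    have ha : (0 : ℝ) < a := by exact_mod_cast (by simpa [headPos] using h : 0 < a)
    have hc := evU_nonneg (m := m) hm (p := c) fun x hx =>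
      hp (a :: c) (by simp) x (List.mem_cons_of_mem _ hx)
    have := evB_nonneg (m := m) (z := z) hm hz (p := s) fun x hx =>
      hp x (List.mem_cons_of_mem _ hx)
    simp only [evB, evU]
    positivity

theorem digitRows_nonneg (b₁ b₂ k₁ k₂ n : ℕ) :
    ∀ c ∈ digitRows b₁ b₂ k₁ k₂ n, ∀ a ∈ c, 0 ≤ a := by
  intro c hc a ha
  simp only [digitRows, List.mem_map] at hc
  obtain ⟨r, _, rfl⟩ := hc
  simp only [List.mem_map] at ha
  obtain ⟨x, _, rfl⟩ := ha
  exact Int.natCast_nonneg x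

/-- A test for the positivity of a polynomial function on the quadrant through its value at a
point with large coordinates. -/
def posTest (b₁ b₂ k₁ k₂ : ℕ) (n : ℤ) (s t : ℕ) : Bool :=
  force n.toNat fun N =>
    let L := digitRows b₁ b₂ k₁ k₂ N
    headPos L && decide (evB ic (b₁ : ℤ) (b₂ : ℤ) L = n) && decide (s + evB na 1 1 L < b₁) &&
      decide (t + evB na b₁ 1 L < b₂)

/-- The digits of n give a candidate with nonnegative coefficients. Its difference from F vanishes
at the large point and has small coefficients, so F equals the candidate. Nothing about the digit
extraction has to be proved beyond nonnegativity: the test checks the value. -/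
theorem Packed.pos {b₁ b₂ : ℕ} {F : ℝ → ℝ → ℝ} {n : ℤ} {s t : ℕ} (hF : Packed b₁ b₂ F n s t)
    {k₁ k₂ : ℕ} (h : posTest b₁ b₂ k₁ k₂ n s t = true) {m z : ℝ} (hm : 0 ≤ m) (hz : 0 ≤ z) :
    0 < F m z := by
  simp only [posTest, force_eq, Bool.and_eq_true, decide_eq_true_eq] at h
  obtain ⟨⟨⟨h1, h2⟩, h3⟩, h4⟩ := h
  set L := digitRows b₁ b₂ k₁ k₂ n.toNat with hL
  have hG := (Packed.const (b₁ := b₁) (b₂ := b₂) (-1)).mul (Packed.lit L)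
  have h0 := hF.add hG
  rw [h2] at h0
  have e : n + -1 * n = 0 := by ring
  rw [e] at h0
  have := h0.eq_zero (by simpa using h3) (by simpa using h4) m z
  have hp := evB_pos hm hz (digitRows_nonneg b₁ b₂ k₁ k₂ n.toNat) h1
  rw [← hL] at hp
  push_cast at this
  linarith

/-! ### Sign certificates after a rational substitution -/

section Certificates

variable {R : Type*} [CommSemiring R]

/-- The combination `A p + B q` of two polynomials, homogenized in the second variable, after the
substitution of the polynomials `M` and `N / D` in two new variables. -/
def certVal (ι : ℤ → R) (v w : R) (A B p q M N D : List (List ℤ)) : R :=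
  evB ι v w A * hev ι (evB ι v w M) (evB ι v w N) (evB ι v w D) p +
    evB ι v w B * hev ι (evB ι v w M) (evB ι v w N) (evB ι v w D) q

end Certificates

def certTest (k₁ k₂ d₁ d₂ : ℕ) (A B p q M N D : List (List ℤ)) : Bool :=
  posTest (2 ^ k₁) (2 ^ k₂) d₁ d₂
    (certVal ic ((2 ^ k₁ : ℕ) : ℤ) ((2 ^ k₂ : ℕ) : ℤ) A B p q M N D)
    (certVal na 1 1 A B p q M N D) (certVal na (2 ^ k₁) 1 A B p q M N D)

theorem certVal_pos {k₁ k₂ d₁ d₂ : ℕ} {A B p q M N D : List (List ℤ)}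
    (h : certTest k₁ k₂ d₁ d₂ A B p q M N D = true) {v w : ℝ} (hv : 0 ≤ v) (hw : 0 ≤ w) :
    0 < certVal ic v w A B p q M N D := by
  have hF := ((Packed.lit (b₁ := 2 ^ k₁) (b₂ := 2 ^ k₂) A).mul
    ((Packed.lit M).hev (Packed.lit N) (Packed.lit D) p)).add
    ((Packed.lit (b₁ := 2 ^ k₁) (b₂ := 2 ^ k₂) B).mul
    ((Packed.lit M).hev (Packed.lit N) (Packed.lit D) q))
  exact hF.pos h hv hw

/-- The data of a function `x ^ (e / m + j) * p ((m + 1) x ^ 2)`, the coefficients of `p` being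
polynomials in `m`. -/
structure Term where
  e : ℤ
  j : ℤ
  p : List (List ℤ)

/-! The polynomials `p` of the terms in a chain of Wronskians, with trivial factors removed.
The first letter gives the level: the terms of `Chain.start` after six derivatives (`q`), and
their successive Wronskians with `qU0`, `rU1`, `sU3` and `tU2` (`r`, `s`, `t`, `y`); `wOE` comes
from the Wronskian of `yO` and `yE`. -/

namespace Chain

def qU0 : List (List ℤ) :=
  [[-4, 28, -71, 77, -30], [-8, 8, 14, -8, -6], [-4, -20, -35, -25, -6]]

def qU1 : List (List ℤ) :=
  [[4, -20, 35, -25, 6], [8, 8, -14, -8, 6], [4, 28, 71, 77, 30]]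

def qU2 : List (List ℤ) :=
  [[4, -12, 11, -3], [8, 24, 10, -12], [4, 36, 119, 171, 90]]

def qU3 : List (List ℤ) :=
  [[4, -4, -1, 1], [8, 40, 58, 20], [4, 44, 179, 319, 210]]

def qO : List (List ℤ) :=
  [[81, -243, 225, -45, -26, 8], [243, 243, -135, -135, 12, 12], [243, 1215, 2295, 2025, 822,
  120], [81, 729, 2655, 4995, 5104, 2676, 560]]

def qE : List (List ℤ) :=
  [[81, -324, 360, 90, -401, 234, -40], [324, -81, -423, 45, 151, -4, -12], [486, 1701, 2079,
  945, -21, -126, -24], [324, 2349, 6867, 10395, 8701, 3976, 908, 80], [81, 891, 4005, 9405,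
  12154, 8184, 2240]]

def rU1 : List (List ℤ) :=
  [[-16, 192, -984, 2808, -4869, 5238, -3401, 1212, -180], [-64, 384, -480, -1104, 2988, -1284,
  -1940, 2004, -504], [-96, 0, 1008, 0, -4446, 0, 7962, 0, -4428], [-64, -384, -480, 1104, 2988,
  1284, -1940, -2004, -504], [-16, -192, -984, -2808, -4869, -5238, -3401, -1212, -180]]

def rU3 : List (List ℤ) :=
  [[-16, 128, -392, 560, -329, -28, 107, -30], [-64, 128, 544, -1168, -1196, 3092, -334, -1002],
  [-96, -384, 528, 2928, -2574, -10476, 9492, 15282, -14700], [-64, -640, -2144, -1840, 3844,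
  6620, -1426, -6030, -2100], [-16, -256, -1736, -6496, -14609, -20104, -16399, -7164, -1260]]

def rU2 : List (List ℤ) :=
  [[-16, 160, -664, 1480, -1909, 1420, -561, 90], [-64, 256, 128, -1520, 1124, 1804, -2448, 720],
  [-96, -192, 912, 1536, -4254, -4908, 9648, 5454, -8100], [-64, -512, -1216, 112, 4004, 3892,
  -1644, -3492, -1080], [-16, -224, -1336, -4424, -8869, -10976, -8139, -3276, -540]]

def rO : List (List ℤ) :=
  [[-324, 3240, -13455, 29970, -38272, 27050, -8145, -1220, 1396, -240], [-1620, 7776, -5391,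
  -25398, 43576, -5554, -24789, 10208, 2224, -1032], [-3240, -1296, 28098, 5112, -98122, -6186,
  140112, 16378, -62928, -17928], [-3240, -18144, -17910, 58032, 81914, -122738, -136480, 239218,
  198356, -161408, -117600], [-1620, -17496, -74403, -150714, -123662, 28896, 74273, -73126,
  -160188, -89960, -16800], [-324, -5184, -36459, -148266, -385546, -668668, -781611, -606434,
  -297980, -83448, -10080]]

def rE : List (List ℤ) :=
  [[-324, 3564, -16263, 38961, -48814, 18886, 31313, -51311, 32888, -10100, 1200], [-1944, 11340,
  -15606, -22833, 69204, -26532, -49604, 39193, 5190, -9808, 1160, 240], [-4860, 3240, 42795,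
  -24228, -140604, 46548, 197899, -7832, -105606, -19648, 10376, 1920], [-6480, -29160, 1980,
  156294, 78700, -405350, -291250, 560992, 581330, -154040, -349880, -128736, -14400], [-4860,
  -46980, -162945, -198495, 96726, 269628, -220451, -156253, 844114, 467732, -777464, -562432,
  -1920], [-1944, -28836, -180198, -614853, -1243968, -1542126, -1293098, -1125601, -1294088,
  -1128568, -521744, -96016, -960], [-324, -6480, -57411, -297630, -1003372, -2309070, -3699033,
  -4120260, -3122004, -1528800, -433856, -53760]]

def sU3 : List (List ℤ) :=
  [[-64, 832, -4688, 14960, -29532, 36636, -26879, 8345, 3071, -3893, 1392, -180], [-384, 2688,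
  -2976, -20928, 66648, -30936, -147078, 266616, -151164, -16452, 45954, -11988], [-960, 960,
  19728, -26256, -144420, 286020, 341979, -1279923, 568755, 1636095, -2504982, 1367604, -264600],
  [-1280, -6400, 14912, 102400, -60720, -649680, 86876, 1902280, -198200, -2559820, 649812,
  1211220, -491400], [-960, -10560, -33072, 31056, 342300, 314340, -1266201, -2468637, 1098045,
  5418045, 2022048, -3284244, -2162160], [-384, -6528, -45216, -155712, -221352, 225576, 1406922,
  2145504, 920916, -1250448, -1887006, -958392, -173880], [-64, -1472, -15248, -94000, -383772,
  -1092036, -2218019, -3234985, -3356239, -2409767, -1133058, -311940, -37800]]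

def sU2 : List (List ℤ) :=
  [[-64, 960, -6416, 25200, -64572, 113220, -138443, 117885, -68389, 25695, -5616, 540], [-384,
  3456, -9120, -7488, 84312, -155304, 43386, 231768, -372588, 256428, -85806, 11340], [-960,
  2880, 14928, -53136, -63108, 377244, -137073, -1012167, 1291863, 389691, -1713150, 1145988,
  -243000], [-1280, -3840, 22592, 65280, -161328, -423216, 565244, 1235976, -1063112, -1611084,
  1042884, 736884, -405000], [-960, -8640, -16752, 61776, 254844, -10692, -1200765, -1312065,
  1630641, 3527577, 518832, -2257956, -1185840], [-384, -5760, -34464, -96192, -67752, 342360,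
  1080618, 1263744, 248916, -986400, -1139454, -517752, -87480], [-64, -1344, -12752, -72240,
  -271932, -715932, -1350311, -1835925, -1782979, -1203699, -534762, -139860, -16200]]

def sO : List (List ℤ) :=
  [[-1296, 19440, -129960, 510480, -1306357, 2278405, -2743080, 2241390, -1160973, 294345, 35290,
  -50620, 14376, -1440], [-9072, 84240, -261720, 109440, 1185341, -2783625, 1757120, 1968370,
  -3926491, 2230555, -96330, -359060, 95472, 10080, -4320], [-27216, 97200, 267192, -1228176,
  -620409, 6116673, -2542656, -12564858, 11823591, 8362149, -13019574, 612084, 3348384, -336672,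
  -287712], [-45360, -97200, 713160, 1567584, -4472687, -9728933, 14782216, 28512642, -31796751,
  -39656649, 47772398, 18560924, -40129552, 7343232, 10908576, -4233600], [-45360, -356400,
  -505080, 2874096, 9048193, -4832449, -46200440, -28664582, 89061749, 107573983, -56282030,
  -112429864, 6406168, 43697616, -1483200, -7862400], [-27216, -369360, -1925640, -3986496,
  2562999, 27235221, 35390304, -43447818, -147283965, -46271187, 244625502, 311132424, 19688832,
  -209698224, -153030816, -34594560], [-9072, -174960, -1479960, -7100784, -20550739, -33181893,
  -12236768, 67584018, 154461729, 136756611, -5849894, -141215904, -154243168, -83389008,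
  -23596128, -2782080], [-1296, -32400, -373608, -2634912, -12704965, -44341927, -115652584,
  -229387626, -348562857, -405418671, -357633458, -234698912, -110769632, -35440752, -6861600,
  -604800]]

def sE : List (List ℤ) :=
  [[-1296, 23328, -191736, 953352, -3202021, 7680164, -13556143, 17872326, -17667255, 13015008,
  -7022921, 2686822, -687428, 105000, -7200], [-10368, 125712, -609840, 1367352, -581336,
  -4414383, 11654475, -12897484, 3985626, 7226025, -10880905, 7255242, -2743572, 580096, -58080,
  1440], [-36288, 226800, -134064, -1833048, 3712724, 3447127, -16733307, 10375716, 19119306,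
  -31474569, 9601801, 13027142, -13914492, 5444592, -859680, 30240], [-72576, 27216, 1265040,
  -392040, -8941736, 3445989, 32006799, -17128732, -60159150, 41770029, 55282907, -44910846,
  -21065988, 17221216, 3880704, -1796832, -432000], [-90720, -498960, 413280, 6658200, 4852514,
  -34843493, -45514005, 84006544, 123209072, -109388829, -104796245, 94206482, -42144216,
  -28204168, 80666320, -27811776, -720000], [-72576, -825552, -3071376, -577368, 24115480,
  45587923, -53066447, -230740500, -81635922, 391615215, 381154817, -125593366, -204967672,
  -10157136, -60348144, -69309216, -2108160], [-36288, -625968, -4470480, -16085448, -24428332,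
  20831077, 133537063, 123292364, -189743442, -342609375, 312839239, 1046825366, 528114032,
  -591626384, -755656272, -240001632, -155520], [-10368, -239760, -2468304, -14788728, -56354840,
  -138680777, -206246859, -126475204, 124562054, 267980619, 694685, -481654918, -664269696,
  -438006032, -148437872, -20695200, -28800], [-1296, -37584, -501480, -4083840, -22697317,
  -91176123, -273385640, -622788870, -1086156753, -1449169227, -1465768130, -1102447140,
  -595969384, -218178816, -48240000, -4838400]]

def tU2 : List (List ℤ) :=
  [[256, -4096, 29440, -125440, 351712, -679552, 916880, -847520, 493433, -120008, -61030, 69460,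
  -29151, 6156, -540], [2048, -20480, 57344, 103936, -989440, 2179456, -664448, -5952352,
  13068616, -12693352, 5349544, 715016, -1759824, 698976, -95040], [7168, -28672, -152576,
  842240, 420736, -8366464, 11376128, 22700320, -80025076, 62279944, 81007772, -229808060,
  237777672, -132091308, 38758176, -4698000], [14336, 28672, -471040, -627200, 6570752, 3474304,
  -49422080, 10301600, 198489688, -164383624, -355662320, 534432800, 69187224, -515159352,
  328609440, -65383200], [17920, 143360, -120320, -3351040, -3032000, 31894400, 43484960,
  -171890720, -236732410, 602917720, 659459240, -1380987740, -870649410, 1872068220, 228967020,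
  -1129399200, 357210000], [14336, 200704, 819200, -949760, -15094528, -23679872, 82599040,
  275882720, -46282952, -1052525368, -791949080, 1586315240, 2103048144, -717592464, -1727786160,
  -67651200, 394632000], [7168, 143360, 1137664, 4046336, 1678720, -37369984, -118930048,
  -38375072, 550936556, 1237180888, 438007604, -2140363364, -3384421944, -1007785764, 1933244280,
  1982523600, 578340000], [2048, 53248, 610304, 3996160, 15923456, 35614336, 15635968,
  -171819040, -616058456, -1077395416, -987810848, -126720400, 850217352, 1112801832, 691542576,
  223469280, 29937600], [256, 8192, 121600, 1111040, 6991072, 32109824, 111300560, 296825920,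
  615106313, 992991376, 1243480430, 1193865640, 860346609, 449113608, 159815160, 34538400,
  3402000]]

def tO : List (List ℤ) :=
  [[-5184, 93312, -762192, 3733632, -12199996, 27934504, -45666319, 52891324, -41294203,
  18012736, 692539, -6531244, 4116955, -1015432, -104528, 134288, -33072, 2880], [-46656, 559872,
  -2417040, 2427840, 16479684, -69782448, 102396445, 22460580, -325814691, 549045512, -434205645,
  111140820, 89132579, -83244168, 20443740, 3780760, -2728416, 371232], [-186624, 1119744,
  1270080, -21829824, 32187024, 121637952, -428899444, 150832356, 1414234008, -2810329376,
  1046828028, 3868939380, -7476980912, 6411928440, -2728719264, 236687888, 279076704, -110496960,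
  12700800], [-435456, 0, 12543552, -6071616, -145708464, 153232544, 824327324, -1420309732,
  -2008014272, 5986727188, -193430384, -10882581788, 8666870560, 4883351692, -9341431612,
  3133607936, 855585632, -553079424, 26349120, 8467200], [-653184, -3919104, 9271584, 87518016,
  -24798600, -807062448, -169785562, 4211516332, 1162394154, -13845327392, -2211180538,
  28790027988, -856597922, -35199701056, 7830852276, 21314174864, -7664056448, -4207632000,
  1303122240, 281836800], [-653184, -7838208, -24185952, 65109312, 497402424, 344881344,
  -3204292754, -6059786476, 8506291362, 28870150436, -6528471446, -71737464324, -16267337410,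
  103845595828, 43929381312, -85025475272, -36519898192, 36216285600, 9135483840, -6035178240],
  [-435456, -7838208, -54371520, -149797440, 144542544, 2003156992, 3904743820, -4725535540,
  -29616441136, -29764117888, 53566122820, 143125853900, 47827437464, -175677642968,
  -195993122120, 18463617280, 130786371584, 54403587072, -10564848000, -7671283200], [-186624,
  -4478976, -46526400, -265788864, -837849456, -914982048, 3359246236, 15297118516, 20127038088,
  -22644497476, -117936303232, -147105284340, 35083315688, 320504274500, 367653928356,
  81092781088, -207166517696, -229074336000, -100236144960, -16884806400], [-46656, -1399680,
  -19145808, -157139136, -853646364, -3166337976, -7785553711, -10399906072, 4378370793,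
  56383212928, 138895815871, 193099288152, 147858215455, 9526349992, -120987461052,
  -154399967344, -103896383728, -41918283264, -9581140800, -956793600], [-5184, -186624,
  -3152016, -33191424, -244239580, -1334020368, -5606838467, -18549684488, -49002236871,
  -104223804412, -179123402093, -248607562752, -277312975657, -246249726076, -171386582724,
  -91270508336, -35822060208, -9739667520, -1633867200, -127008000]]

def tE : List (List ℤ) :=
  [[-5184, 114048, -1154448, 7132608, -30073612, 91602936, -207940811, 357201256, -465417090,
  454066634, -318513884, 141993114, -17929198, -26162818, 22545543, -9539978, 2403084, -343800,
  21600], [-51840, 813888, -5240736, 15926256, -8633416, -107347076, 405685418, -631226943,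
  90714103, 1580145985, -3438471073, 3864940203, -2505504623, 701991231, 250501811, -325606576,
  137354276, -28387528, 2398080, -1440], [-233280, 2192832, -4464720, -23151312, 125983188,
  -104916828, -692555991, 2121467161, -999454499, -6406531383, 15318597623, -11012496901,
  -13515369021, 42326697047, -51876078868, 38499247992, -18448091888, 5587656832, -972332544,
  73834560], [-622080, 1928448, 14414976, -58288320, -94867104, 682525232, -276814728,
  -3503719956, 5935092072, 5240171736, -23966201292, 15745362608, 26816728788, -50845970760,
  22314592164, 17884344132, -26402885676, 13515909344, -3365925120, 376105536, -11880000],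
  [-1088640, -3483648, 28129248, 80176320, -327091800, -709866208, 2339690458, 3008729340,
  -11006933060, -4920750188, 32888897388, -7461711740, -56031909720, 43731541092, 40473287258,
  -61456367920, 5804057220, 25048784952, -13753038352, 2428932000, -159984000], [-1306368,
  -12410496, -14551488, 199348128, 593977104, -1037796408, -5484107076, 1243615526, 25493468046,
  7782793330, -72394967054, -39022277406, 131019706898, 81293406718, -146118944382, -85913081608,
  93580026320, 43622366856, -29580590000, -8896844640, 3013128000, 635040000], [-1088640,
  -17200512, -95540256, -116542944, 964738824, 3929224024, 716817738, -24521754858, -41804912062,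
  46324892330, 183031139442, 33061365218, -353527211138, -228564761634, 374591127076,
  321962849464, -246534498984, -200980052208, 110250116000, 48220413120, -27590688000,
  701568000], [-622080, -13747968, -126921600, -594401472, -1130871072, 2143317232, 16377058424,
  27185677356, -34754395824, -200300658288, -224676255132, 248956640944, 852513054284,
  515697398352, -693577350108, -1109097176268, -199070545308, 524191504672, 315907320416,
  -9196714560, -31460472000, 1028160000], [-233280, -6625152, -83966544, -616550400, -2812127004,
  -7591289208, -7565688783, 24215350324, 106961995742, 147544372186, -86990745112, -608718655022,
  -746250852202, 281798231510, 1852176550999, 2078297629922, 422315420344, -1267831476736,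
  -1422646920560, -647144209824, -115103433600, 53222400], [-51840, -1798848, -28796832,
  -280953360, -1856221960, -8700707428, -29269925462, -68628220415, -97553286205, -17265176603,
  293318622103, 788731449555, 1112666017725, 840266048507, 6610146883, -787738196800,
  -995886957420, -680154456128, -281171974192, -66234036480, -6827572800, 6048000], [-5184,
  -212544, -4098960, -49433040, -418046044, -2634763164, -12838426035, -49514867655,
  -153473686839, -385958773419, -791552997985, -1325703756045, -1809216493329, -1999980925869,
  -1772302269960, -1238787347160, -666424517104, -265672647504, -73746034560, -12689913600,
  -1016064000]]

def yO : List (List ℤ) :=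
  [[20736, -456192, 4660992, -29348352, 127390432, -403762112, 964774672, -1766720832,
  2489446377, -2672390622, 2112677782, -1113880142, 239164792, 175808958, -204033798, 98376438,
  -21881873, -2046392, 3000352, -932112, 139536, -8640], [228096, -3608064, 22862592, -60572160,
  -59938912, 992734144, -3402466576, 5479676768, -705161885, -17312089918, 43207660296,
  -58001321664, 47712727062, -20955121940, -899005432, 7424698864, -4505686001, 1043190578,
  133942120, -143849808, 33974640, -2872800], [1140480, -10990080, 16895232, 195807744,
  -983395040, 597721536, 8049817648, -26710875712, 18387331231, 89528740550, -279647259046,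
  311127301382, 109784345912, -895167887606, 1492732722470, -1444870359854, 888862635993,
  -320560601432, 33005247696, 27339859440, -14461866576, 3032500032, -248832000], [3421440,
  -11819520, -107695872, 514533888, 861722976, -8249324480, 6652171984, 53785427872,
  -138700703523, -49364715066, 692965978800, -908747905664, -691086676142, 3129896012308,
  -2866194909264, -1000767649440, 4438174407849, -4180176941498, 1802856734152, -178838094656,
  -163283127600, 68602748256, -8910604800, 127008000], [6842880, 18662400, -264411648,
  -516510720, 4628914368, 4518898304, -47413906016, 1504577408, 294149678810, -289825757708,
  -991020088804, 2111743505556, 902724401652, -6612244767540, 4759108291528, 7720303945244,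
  -14770485671006, 4043709259888, 10563699249260, -11668557776288, 4103182267296, 316620190656,
  -542192080320, 96602284800], [9580032, 85349376, -63963648, -2413458432, -2889475008,
  28202651008, 50330912352, -192862440512, -368635080898, 897568098868, 1492287764912,
  -3048417585472, -3448245996328, 7453868717288, 4031575733332, -11845717167592, -828872238278,
  10079992501908, -2421655458068, -2725158789192, 740646960480, -462207368448, 911186781120,
  -372908188800, 34292160000], [9580032, 144571392, 617089536, -1197149184, -16338775488,
  -26248942720, 124998755168, 442217976704, -256434535266, -2875080649812, -1759339892940,
  9887265024812, 13916417247236, -16916937300844, -42280852929168, 6554077473300, 66027665574318,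
  21889010655344, -53435554090996, -33912178883632, 20090862939168, 18138354776640,
  -2774840241600, -3196573632000, 379935360000], [6842880, 145566720, 1194988032, 3827856384,
  -5942118720, -85073078144, -207938012512, 262011051328, 2301974047546, 3084063908780,
  -6905499245696, -25116127007808, -9497159208048, 68364829555704, 104045915359460,
  -43948969062104, -228657331168762, -121145561999572, 180243211457356, 219572506430600,
  -12652709620896, -119063692303488, -37217970296640, 18072039081600, 8552246976000], [3421440,
  93934080, 1108470528, 7031490048, 22467356256, 1666760000, -286781505456, -1079276911168,
  -958381645523, 5259313233674, 19995638994670, 21519237208666, -36551926742492,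
  -145412249679722, -156380401939954, 77583713678830, 393849754060079, 394192399219272,
  10424887395332, -322253820188976, -282874888139760, -62445291842304, 46612058834880,
  32627183097600, 6146461440000], [1140480, 38361600, 584439552, 5264709120, 30389613088,
  110425529024, 196321621424, -274523147552, -2830449647505, -8021485244118, -7835138321144,
  20742044039936, 95388987742562, 171225515556460, 119550409934868, -148632529386696,
  -492247329784361, -585979285034662, -279929348792260, 175543835983192, 408119523242736,
  335280517881696, 155045051242560, 40000180752000, 4510997568000], [228096, 9082368, 168802560,
  1938055680, 15306964640, 87381432000, 366256579440, 1102944076480, 2123929132755, 960536604270,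
  -10036272920110, -43294141071570, -105233619092940, -176860174412990, -207951600023910,
  -149804449930470, -9414187503175, 137835309487080, 208254672296340, 182524272770080,
  109101678048624, 45326080582272, 12610589215680, 2120293324800, 163078272000], [20736, 953856,
  20876544, 289276416, 2848651744, 21213595456, 124110288784, 585021554976, 2260655954649,
  7248329821806, 19443647674384, 43870787824576, 83501640443854, 134170091034036,
  181746590142204, 206817695891256, 196524816752689, 154550225175406, 99311362357084,
  51210303766776, 20646736781328, 6259546369440, 1339841736000, 180197136000, 11430720000]]

def yE : List (List ℤ) :=
  [[20736, -559872, 7080192, -55740672, 306234592, -1247070752, 3901640272, -9588359952,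
  18754136937, -29374790187, 36822662632, -36609217112, 28203733402, -15910938582, 5474994552,
  104580768, -1536001163, 1103951593, -464843048, 129781968, -23769504, 2602800, -129600],
  [248832, -5080320, 44983296, -212726016, 458334336, 639377184, -8011207744, 27716320464,
  -50575017364, 29901732139, 102835425416, -356596267346, 611595751306, -689651306996,
  529760293306, -255837318886, 43481124226, 38884311689, -36941967114, 16050481784, -4088256336,
  587756304, -36992160], [1368576, -18931968, 87160320, 28396800, -1853443392, 6962188704,
  -2855481376, -56919894192, 193806188930, -187404742913, -507228486664, 2069305949656,
  -3117974776628, 986470458550, 5435715310768, -13236851346736, 17388828721954, -15562862082637,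
  10020397871160, -4670073568528, 1541217748560, -341538122736, 45507033792, -2747520000],
  [4561920, -33073920, -44835840, 1051833600, -2384533376, -9051301408, 52238372672,
  -39774110096, -325711834020, 956024299701, -136667643752, -4046325999382, 7686466419686,
  -567806267300, -18292001686506, 28973148984702, -12088560082058, -21032528067121,
  40107290263130, -33931517169224, 17140859386848, -5302929359952, 928769275296, -70525209600,
  7776000], [10264320, -6842880, -408188160, 680486400, 6309709344, -18721268928, -38999466768,
  234206400224, -71287686345, -1461906765274, 2526340080688, 3691634473808, -15070961839334,
  5527513629520, 36825989165764, -54146913301988, -13991316601273, 101842598910394,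
  -86201321910220, -19248458690844, 88872267434288, -74235668276832, 31107625917696,
  -6749743521600, 600537888000], [16422912, 97168896, -429152256, -2961529344, 5195135232,
  36939528000, -51848579712, -244484913376, 475164567384, 823670957198, -3157505057840,
  -114386526868, 13108874297476, -11659663761644, -30687094604708, 51097928104960,
  29585906880908, -101525653561586, 20657934607364, 89928718707108, -64901634393112,
  -14816352096864, 32781511873152, -13098792588480, 1777899715200, -19051200000], [19160064,
  239500800, 595510272, -4168668672, -22593906048, 8088913728, 240811889472, 247583407008,
  -1250365592868, -2357955192642, 3349933919472, 10053335713008, -3203051571048, -23666728939392,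
  -5701989291768, 31594430325948, 20796122002572, -22640597058702, -27790164481128,
  6650607871908, 19991124425328, 382979546208, -7240856656320, -96354619200, 773260992000,
  -114307200000], [16422912, 313403904, 2165667840, 4045109760, -27146748672, -163724429376,
  -160617818496, 1189373399008, 3790956744600, -991558777238, -22695349912144, -26494314941324,
  59407053718892, 154320053428100, -24515795014012, -389120702469256, -228309291882956,
  489363129739298, 543584575506940, -282692222263548, -531251713481576, 38733016161312,
  241805562319872, 16674133815360, -41639941123200, -812016576000], [10264320, 263450880,
  2835336960, 15427756800, 31761041184, -110812660128, -893329495248, -1884040256336,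
  2494626292455, 20885949406321, 32897438040008, -41664945412472, -217086872103394,
  -188397820476370, 402823881166664, 969191449799732, 173097425093587, -1549941253705111,
  -1511209917955160, 760133907236796, 1880647620002848, 406339713423408, -871170717268224,
  -463697408099520, 108365239584000, 89129569536000], [4561920, 147121920, 2117514240,
  17537760000, 87781561984, 230416549792, -70642787648, -2977690615536, -10473919706820,
  -10285500756009, 42927353146408, 180697320071878, 245743836225106, -166710202628400,
  -1139028005204886, -1599057342303018, -53802838979438, 2827993587488809, 3781498610277190,
  1147146018587796, -2180933309963352, -2696233312256112, -990973125470304, 249038490098880,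
  305022138825600, 70140530880000], [1368576, 53146368, 952100352, 10349238528, 75204177600,
  375800300832, 1243810371296, 2145946846736, -2216257922878, -26054559419565, -77169157293672,
  -94425624970056, 114172751593724, 728499651391898, 1445591212451720, 1201309685583972,
  -949583394825294, -4121583100123269, -5505775472564368, -3234964668449860, 1019161615621472,
  3722733568646736, 3455820354684672, 1759961599375680, 498678380236800, 61991298432000],
  [248832, 11301120, 241560576, 3221823744, 29949373056, 204994695264, 1061378678336,
  4181311761584, 12265160931596, 24480610299729, 19827393460536, -69677249711166,
  -360590189942194, -930105895270096, -1638445945764634, -2040289341001446, -1632777995753034,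
  -365437556884401, 1129569149390186, 1997024475080084, 1900254999356744, 1216744098918384,
  539942856300000, 160494273547200, 28863002160000, 2377045440000], [20736, 1078272, 26737920,
  420802560, 4719309280, 40144016000, 269157199760, 1459263698560, 6511800269145, 24218399259780,
  75733910496160, 200321350088960, 449824901075150, 858919496738440, 1394285030611260,
  1920085914128160, 2233882474792465, 2181516109838420, 1771566835662860, 1180777230909760,
  634185139762224, 267357605249088, 85063606367040, 19171899072000, 2723124096000, 182891520000]]

def wOE : List (List ℤ) :=
  [[-1679616, 55427328, -868734720, 8605792512, -60483259872, 320901095520, -1335048793488,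
  4465048679856, -12208086946105, 27593844345585, -51913802143190, 81536738263570,
  -106802108579715, 115964200551275, -102924912428860, 72501979021320, -37767248339615,
  11285781146695, 2019539968650, -5017905178870, 3444847405451, -1420104917523, 330172967800,
  2435115148, -35901406128, 15594577520, -3800136192, 577606464, -51494400, 2073600], [-21835008,
  591224832, -7195288320, 50771432448, -216287146080, 443841949440, 779826848688, -9811995359616,
  40083175784411, -99524213358960, 147949475098650, -47023599139780, -409202672905335,
  1311778881328740, -2414874616328180, 3161261295628920, -3074070545606115, 2184580830783320,
  -1023107365751190, 163421185066860, 188526614840863, -191402384655372, 91876908208800,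
  -23071435487968, -73431862560, 2422287740160, -968526888448, 200114459136, -22620370176,
  1111587840], [-129330432, 2752890624, -23289742080, 81467161344, 109923456672, -2253684557664,
  8933959891440, -8992666276848, -61128632281877, 311679076641623, -642834448039754,
  182627121134934, 2781198643947021, -8851834178706591, 13781532536346116, -7438839507075236,
  -19277415730336459, 62787195410769449, -103516574707670474, 118953232052694374,
  -102161687631247437, 66372698192351775, -31806426777463104, 10227472375713400,
  -1366462785511456, -595072284612032, 441286840217856, -143111459011968, 27487606963968,
  -3028725437184, 148677120000], [-458535168, 7205552640, -30934607616, -101432010240,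
  1331788078368, -3233277207360, -10193341055184, 76462900153056, -126460883440857,
  -320438156800542, 1859812524181966, -2893658919824236, -2886417292359099, 20691592741944254,
  -36280377166791704, 8465877530517984, 88964475866759761, -197631508011902146,
  185375400287215446, 15485272055939204, -295048373669434061, 454328778751460994,
  -406596741134824028, 239545785309560744, -89338009854814512, 14734498605465824,
  4129532936653120, -3381481533136512, 1003696055405568, -156895474673664, 11609733888000,
  -212751360000], [-1069915392, 11288699136, 12122535168, -514160877312, 1182971083680,
  7975779382368, -38021398832592, -23812285089744, 456135959065163, -678882640815215,
  -2094769550412390, 8163789304497650, -3768261479183315, -30879257821812465, 70649458378462840,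
  -16982732258112940, -188584637384323755, 369073643732275295, -163630287373594430,
  -508656290179114110, 1086547965363926707, -828636055164673471, -241776258586629348,
  1228292651874045032, -1383640962285727040, 864105084338216832, -298882484059906048,
  25889709940503424, 24828704041373952, -11859133051572480, 2289432825676800, -173397169152000],
  [-1681295616, 10568143872, 107838998784, -640657797120, -2611381708512, 17269941446784,
  29018160002160, -266287132188864, -82544873374913, 2528266863133540, -1639430240004070,
  -14714776998912580, 21988332487528785, 47180665421183760, -126252374428859200,
  -41376718473951160, 380586406761443185, -232319642413936860, -530208505575767470,
  798376134966004300, 45962257251684031, -834234127841809752, 543030653940060996,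
  92351671030605040, -174750497200591808, 12732305871513536, -84097643172090880,
  224536410365731584, -202203793808785152, 94050056408325120, -24331602070840320,
  3289034850508800, -177404774400000], [-1681295616, 7926107904, 201252522240, -119376094464,
  -7067271759840, -1723685274720, 131926792046256, 59702602080528, -1581415967485553,
  -653670342968225, 13238032600430550, 3397333440972710, -80297489394869115, -4118840201362275,
  356026233775115920, -58892176000397640, -1143390515670405975, 432234220389346985,
  2601652766087700750, -1521852732613037010, -4046487511802394269, 3227767779639953211,
  4059351788768451900, -4294616232678944956, -2329988349377532960, 3583208782725687840,
  420641998116242304, -1804814028051491968, 376862446376963328, 413753300646209280,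
  -247916602227409920, 49532540372812800, -3242414085120000, 1828915200000], [-720555264,
  15852215808, 314611672320, 887416155648, -8366127801696, -44535567054528, 77793928089840,
  794731292960544, -69555388826229, -8239033750025634, -5126841243595618, 58162395292187028,
  58716057323021157, -297811062023761222, -367504183332906828, 1133699915649335688,
  1531292877805690597, -3239961749814699342, -4478582343455371458, 6955954710226821908,
  9301019099077706091, -11170449379653352650, -13566227009921985248, 13342003506150946800,
  13475404057109453568, -11723169811980479104, -8545720893242683008, 7311961596943497984,
  2940752154195819776, -2917724162099363328, -242693829077760000, 555830457324134400,
  -102385608450048000, 47795650560000], [720555264, 39630539520, 573112412928, 2928502874880,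
  -3193703347104, -89011915584480, -234168832556208, 736735587234192, 4412391345695301,
  52681203500571, -37555109831455058, -44130597476077882, 192080066348951887, 400890820359155073,
  -612024494233052748, -2025890083025055792, 998067308554731107, 6576616777247694973,
  334408316052303902, -13967409848844394402, -4998604776438988487, 19301978069564003063,
  9749901622701912144, -17138500837124325732, -8518218088689048624, 9422573158289608048,
  2668075523180455040, -2694245110402480064, 736869621760582656, -58377850323936768,
  -512103647900160000, 223703472732364800, -5095841974272000, 2112553820160000], [1681295616,
  63408863232, 940107015936, 6746294117376, 18015677894880, -69276676253184, -669678072951024,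
  -1431430834180608, 3866648636230241, 24501344883817800, 20390506495853790, -140296355425189740,
  -358571929715129245, 234981271395044340, 1963474770109524780, 1288546738097573800,
  -5504100244421156745, -8852189119839096720, 7092021279343399070, 25183589138132953380,
  3641540198190068709, -38766653181896701292, -27673406701290784536, 28654287248189676384,
  39392067926670812000, -2879218598860667136, -23485773614914831616, -8160684759217467392,
  4351040282311052544, 3816357452001192960, 746415429496473600, -451738312613683200,
  -188314744762368000, 50011947417600000], [1681295616, 66050899200, 1118065690368,
  10431281481984, 54463123572192, 108639999668448, -489143815692336, -4100666869524816,
  -10210204410731311, 8911423775378925, 120297305348178130, 252491114060295890,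
  -207613677580451025, -1935452238362909885, -2777488227868785020, 3614373620360520300,
  17131230260154301055, 15119615634852153635, -27914582067378130110, -77494302286428274190,
  -40810917520108296671, 92937066385204184685, 168026295622975803512, 54156382388035872896,
  -129189544842852817632, -160545126921342040448, -34044468447765245824, 68129292346526891136,
  58446897389579243776, 9427486815739165440, -9037543808364318720, -3971056018419763200,
  268081779216384000, 304299265536000000], [1069915392, 46595907072, 914031164160,
  10546693682688, 77528109299040, 355389901151040, 770405358714768, -1654838407493856,
  -19043431702829339, -62959863178047490, -50444034294178950, 373361469016101340,
  1565976100508889095, 2107287504906096210, -3273268456563528400, -18451452621833237360,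
  -27628035918151940685, 12297504190196996290, 118448474359942289090, 189099811719470890380,
  39704893299935875793, -333017221371744945842, -569692940594390209500, -288527134586099934488,
  337021515023800686800, 662778806446865299680, 380792854601619372352, -105241351095370175104,
  -286809195525581124096, -156199386200345256960, -4828243643366123520, 32648737680280166400,
  14766609369673728000, 2195285583052800000], [458535168, 22337213184, 503618860800,
  6933262811904, 64512644324832, 421011580866336, 1899383333878800, 5228034965250192,
  2409964386672873, -52259180049238557, -262218921329996914, -590394722957948106,
  -64437192001572089, 4163408624756420869, 14530353547710856656, 22583512622648896724,
  -3914196899126151769, -105719002072493606691, -259750298126752544234, -304322113862545529066,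
  -17156253157749190647, 602228755340077197275, 1136388406885221339356, 1035883623006937618800,
  232817751794249835424, -672895703965714645472, -1007502501539478286464, -698305168618444181248,
  -206077207932745473792, 69295937053105933056, 99994600576363392000, 46625868281445580800,
  10991626601195520000, 1097881491087360000], [129330432, 7020794880, 179668710144,
  2874509752320, 32110360223328, 264372855281280, 1644510708896976, 7733181540073536,
  26516467957326533, 57146210657453188, 11345290320057326, -485741836398745996,
  -2208757431389100989, -5321133083560967656, -5445845400949068344, 12634370495806424024,
  74554986530417712571, 192137940957303589844, 313392048844758656806, 294721912496016929444,
  -22929828502948614851, -629627969992324004656, -1222760382535674070028,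
  -1360029039650289161776, -842707000394931379712, 50218529209627202624, 776011060004753803520,
  989985184087919611648, 767580775423397842688, 414245823594573290496, 157946756833695513600,
  40971393362855116800, 6526648069724160000, 483583711887360000], [21835008, 1311780096,
  37643367168, 686204690688, 8911202882400, 87587241716448, 675234339681168, 4170211323583536,
  20848274091329653, 84329498988595165, 271329225607892130, 656621119576271410,
  960598129043583295, -575360857443335745, -9372468765619519960, -36642956828504997760,
  -97687593781185262365, -201483790426664805365, -332352348488996946950, -437485420915348639110,
  -441926581021822781623, -296699081705645456071, -28994074185390119988, 256007794799048826052,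
  437870067075636449440, 460411459942636336032, 358804860366816792832, 216736391068692813184,
  102145404793536744192, 37062844820066269440, 10030857657571353600, 1910004343949952000,
  228416537502720000, 12906654566400000], [1679616, 110854656, 3529246464, 72192508416,
  1066268113632, 12115197998784, 110172761076816, 823670341972704, 5160601764448297,
  27484180749267970, 125767761557040410, 498581986840934140, 1723180462221882575,
  5217243713547131830, 13887281237938888820, 32579790959247899080, 67470746504491405655,
  123430894182315560590, 199442181724444256810, 284365485265190306140, 357115005580339554449,
  393917635080007755514, 380189934544795145816, 319434788782530915904, 232101178607979393248,
  144602967446509164736, 76396655536170494464, 33732923967767087616, 12207513921852342528,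
  3523465317650065920, 779310416661350400, 123915186533376000, 12598299463680000,
  614515507200000]]

end Chain

/-! ### Verification of the Wronskian identities -/

section Wronskian

variable {R : Type*} [CommSemiring R]

/-- The numerator `d p₀ p + 2 m (p₀ θp - θp₀ p) - D κ q` of a Wronskian of two terms, less the
product `D κ q`. -/
def wronVal (ι : ℤ → R) (m z : R) (d : List ℤ) (p₀ p D : List (List ℤ)) (κ : List ℤ)
    (q : List (List ℤ)) : R :=
  evB ι m z [d] * (evB ι m z p₀ * evB ι m z p) +
    evB ι m z [[0, 2]] * (evB ι m z p₀ * evB ι m z (theta 0 p) +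
      ι (-1) * (evB ι m z (theta 0 p₀) * evB ι m z p)) +
    ι (-1) * (evB ι m z D * (evB ι m z [κ] * evB ι m z q))

end Wronskian

def wronTest (k₁ k₂ : ℕ) (d : List ℤ) (p₀ p D : List (List ℤ)) (κ : List ℤ)
    (q : List (List ℤ)) : Bool :=
  decide (wronVal ic ((2 ^ k₁ : ℕ) : ℤ) ((2 ^ k₂ : ℕ) : ℤ) d p₀ p D κ q = 0) &&
    decide (wronVal na 1 1 d p₀ p D κ q < 2 ^ k₁) &&
    decide (wronVal na (2 ^ k₁) 1 d p₀ p D κ q < 2 ^ k₂)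

theorem wronVal_eq_zero {k₁ k₂ : ℕ} {d : List ℤ} {p₀ p D : List (List ℤ)} {κ : List ℤ}
    {q : List (List ℤ)} (h : wronTest k₁ k₂ d p₀ p D κ q = true) (m z : ℝ) :
    wronVal ic m z d p₀ p D κ q = 0 := by
  simp only [wronTest, Bool.and_eq_true, decide_eq_true_eq] at h
  obtain ⟨⟨h0, h1⟩, h2⟩ := h
  have L := fun p => Packed.lit (b₁ := 2 ^ k₁) (b₂ := 2 ^ k₂) p
  have c := Packed.const (b₁ := 2 ^ k₁) (b₂ := 2 ^ k₂) (-1)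
  have hF := (((L [d]).mul ((L p₀).mul (L p))).add
    ((L [[0, 2]]).mul (((L p₀).mul (L (theta 0 p))).add
      (c.mul ((L (theta 0 p₀)).mul (L p)))))).add
    (c.mul ((L D).mul ((L [κ]).mul (L q))))
  have e : wronVal ic ((2 ^ k₁ : ℕ) : ℤ) ((2 ^ k₂ : ℕ) : ℤ) d p₀ p D κ q = 0 := h0
  unfold wronVal at e
  simp only [ic, Int.cast_id] at e hF
  rw [e] at hF
  exact hF.eq_zero h1 h2 m z

/-- The Wronskians with `t₀` of the terms in the first list are, up to a common power and
the common factor `D`, the multiples of the terms in the second list. -/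
def stepTest (k₁ k₂ : ℕ) (t₀ : Term) (D : List (List ℤ)) :
    List Term → List (List ℤ × Term) → Bool
  | [], [] => true
  | t :: L, (κ, t') :: L' =>
    decide (t'.e = t.e) && decide (t'.j = t.j) &&
      wronTest k₁ k₂ [t.e - t₀.e, t.j - t₀.j] t₀.p t.p D κ t'.p && stepTest k₁ k₂ t₀ D L L'
  | _, _ => false

/-- The derivative of a term, multiplied by `m`, with the exponent `j` in place of `j - 1`. -/
def Term.dop (t : Term) : Term :=
  ⟨t.e, t.j - 1, badd (bsmul [t.e, t.j] t.p) (bsmul [0, 2] (theta 0 t.p))⟩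

/-! ### The chain of Wronskians and its sign certificates -/

namespace Chain

set_option maxRecDepth 100000

/-- The functions `x ^ (2 / m + j) * (1 + z) ^ 2` for `j = 0, 1, 3, 2`, `x ^ (3 / m + 1) * (1 + z) ^ 3`
and `x ^ (3 / m) * (1 + z) ^ 3 * (m + 1 + z)`, where `z = (m + 1) x ^ 2`. -/
def start : List Term :=
  [⟨2, 0, [[1], [2], [1]]⟩,
    ⟨2, 1, [[1], [2], [1]]⟩,
    ⟨2, 3, [[1], [2], [1]]⟩,
    ⟨2, 2, [[1], [2], [1]]⟩,
    ⟨3, 1, [[1], [3], [3], [1]]⟩,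
    ⟨3, 0, [[1, 1], [4, 3], [6, 3], [4, 1], [1]]⟩]

/-- The Wronskian with the constant 1 is a derivative, so this is the sixth differentiation, the one
that removes the last constant of the polynomial part. -/
theorem stepTest_const : stepTest 64 512 ⟨0, 0, [[1]]⟩ [[1]] (start.map Term.dop^[5])
    [([-16, 8], ⟨2, -5, qU0⟩),
      ([16, 8], ⟨2, -4, qU1⟩),
      ([16, 40, 24], ⟨2, -2, qU3⟩),
      ([16, 24, 8], ⟨2, -3, qU2⟩),
      ([9], ⟨3, -4, qO⟩),
      ([9], ⟨3, -5, qE⟩)] = true := by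
  decide +kernel

theorem stepTest_qU0 : stepTest 29 364 ⟨2, -5, qU0⟩ [[1]]
    [⟨2, -4, qU1⟩, ⟨2, -2, qU3⟩, ⟨2, -3, qU2⟩, ⟨3, -4, qO⟩, ⟨3, -5, qE⟩]
    [([0, 1], ⟨2, -4, rU1⟩),
      ([0, 3], ⟨2, -2, rU3⟩),
      ([0, 2], ⟨2, -3, rU2⟩),
      ([1, 1], ⟨3, -4, rO⟩),
      ([1], ⟨3, -5, rE⟩)] = true := by
  decide +kernel

/-- From here on Sylvester's identity W(W(f,g), W(f,h)) = f·W(f,g,h) makes the pivot of the previous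
level a common factor, here `qU0`. Removing it keeps the degrees low. -/
theorem stepTest_rU1 : stepTest 46 997 ⟨2, -4, rU1⟩ qU0
    [⟨2, -2, rU3⟩, ⟨2, -3, rU2⟩, ⟨3, -4, rO⟩, ⟨3, -5, rE⟩]
    [([0, 2], ⟨2, -2, sU3⟩),
      ([0, 1], ⟨2, -3, sU2⟩),
      ([1], ⟨3, -4, sO⟩),
      ([1, 1], ⟨3, -5, sE⟩)] = true := by
  decide +kernel

theorem stepTest_sU3 : stepTest 65 1933 ⟨2, -2, sU3⟩ rU1
    [⟨2, -3, sU2⟩, ⟨3, -4, sO⟩, ⟨3, -5, sE⟩]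
    [([0, 1], ⟨2, -3, tU2⟩),
      ([1], ⟨3, -4, tO⟩),
      ([1], ⟨3, -5, tE⟩)] = true := by
  decide +kernel

theorem stepTest_tU2 : stepTest 86 3335 ⟨2, -3, tU2⟩ sU3
    [⟨3, -4, tO⟩, ⟨3, -5, tE⟩]
    [([1], ⟨3, -4, yO⟩),
      ([1], ⟨3, -5, yE⟩)] = true := by
  decide +kernel

/-- The factor `tU2` from Sylvester's identity is removed here too, but it can vanish and stays in
the zero count of the last Wronskian. -/
theorem wronTest_yO_yE : wronTest 115 5847 [0, -1] yO yE tU2 [0, 1] wOE = true := by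
  decide +kernel

/-- The substitution m = 4 + v, z = w covers m ≥ 4, z ≥ 0. -/
theorem certTest_qU0_neg : certTest 17 75 5 3 [[-1]] []
    qU0 [] [[4, 1]] [[0], [1]] [[1]] = true := by
  decide +kernel

theorem certTest_rU1_neg : certTest 33 278 9 5 [[-1]] []
    rU1 [] [[4, 1]] [[0], [1]] [[1]] = true := by
  decide +kernel

theorem certTest_sU3_neg : certTest 52 647 13 7 [[-1]] []
    sU3 [] [[4, 1]] [[0], [1]] [[1]] = true := by
  decide +kernel

theorem certTest_tU2_theta : certTest 74 1220 17 9 [[2]] [[-7]]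
    (theta 0 tU2) tU2 [[4, 1]] [[0], [1]] [[1]] = true := by
  decide +kernel

/-- The substitution z = (1 + w)/4 covers z ≥ 1/4. -/
theorem certTest_tU2_pos : certTest 81 1339 17 9 [[1]] []
    tU2 [] [[4, 1]] [[1], [1]] [[4]] = true := by
  decide +kernel

theorem certTest_wOE_pos : certTest 161 5395 34 16 [[1]] []
    wOE [] [[4, 1]] [[1], [1]] [[4]] = true := by
  decide +kernel

/-- Here m = 4(1+v)³ and z = 1/((24+20v+10v²)(1+w)), which covers 0 < z ≤ 1/(24+20v+10v²). The sign
regions are separated at z of order m^(-2/3), and the cube root of m/4 makes such bounds rational in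
v. -/
theorem certTest_tU2_neg : certTest 140 8193 59 9 [[-1]] []
    tU2 [] [[4, 12, 12, 4]] [[1]] [[24, 20, 10], [24, 20, 10]] = true := by
  decide +kernel

theorem certTest_wOE_theta_left : certTest 283 33267 118 16 [[-2]] [[5]]
    (theta 0 wOE) wOE [[4, 12, 12, 4]] [[1]] [[24, 20, 10], [24, 20, 10]] = true := by
  decide +kernel

theorem certTest_yO_theta : certTest 205 17537 86 12 [[2]] [[-5]]
    (theta 0 yO) yO [[4, 12, 12, 4]] [[1]] [[24, 20, 10], [24, 20, 10]] = true := by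
  decide +kernel

theorem certTest_yO_pos : certTest 199 17019 86 12 [[1]] []
    yO [] [[4, 12, 12, 4]] [[1], [1]] [[24, 20, 10]] = true := by
  decide +kernel

/-- The variable w is absent: the sign is taken on the curve z = 1/(93+16v+63v²) only. -/
theorem certTest_yO_neg : certTest 208 17803 86 1 [[-1]] []
    yO [] [[4, 12, 12, 4]] [[1]] [[93, 16, 63]] = true := by
  decide +kernel

theorem certTest_wOE_neg : certTest 288 33869 118 1 [[-1]] []
    wOE [] [[4, 12, 12, 4]] [[1]] [[93, 16, 63]] = true := by
  decide +kernel

/-- Both multipliers carry a factor (1+w)², which cancels later and serves to make all coefficients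
nonnegative. The remaining factors are 6000 + 10(1+v)³ and 42000 + 54(1+v)³: their ratio moves from
about 7 at m = 4 towards 27/5 for large m. -/
theorem certTest_wOE_theta_right : certTest 292 35194 121 18 [[6010, 30, 30, 10], [12020, 60, 60, 20], [6010, 30, 30, 10]] [[-42054, -162, -162, -54], [-84108, -324, -324, -108], [-42054, -162, -162, -54]]
    (theta 0 wOE) wOE [[4, 12, 12, 4]] [[1], [1]] [[24, 20, 10]] = true := by
  decide +kernel

/-- With t = √z = n/d the first multiplier is c·n·d, where c is the quartic in v of `gap`; it also
makes up for the degree in z by which `yO` falls short of `yE`. -/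
theorem certTest_gap_left : certTest 217 19628 91 25 [[240, 1276, 2416, 2256, 944, 128], [240, 1276, 2416, 2256, 944, 128]] [[-1]]
    yO yE [[4, 12, 12, 4]] [[1]] [[16, 8, 1], [32, 16, 2], [16, 8, 1]] = true := by
  decide +kernel

theorem certTest_gap_right : certTest 257 25819 101 25 [[960, 5104, 9664, 9024, 3776, 512], [2880, 15792, 31544, 31904, 15840, 3424, 256], [1920, 10688, 21880, 22880, 12064, 2912, 256]] [[-1]]
    yO yE [[4, 12, 12, 4]] [[4], [16, 4], [16, 8, 1]] [[64, 32, 4], [128, 64, 8], [64, 32, 4]] = true := by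
  decide +kernel

end Chain

section ZeroBounds

open Set Filter Topology Asymptotics

/-! ### Counting zeros of analytic functions with multiplicity -/

/-- The zeros of `f` in `I`, counted with multiplicity, number at most `N`. -/
def AtMost (f : ℝ → ℝ) (I : Set ℝ) (N : ℕ∞) : Prop :=
  ∀ s : Finset ℝ, (s : Set ℝ) ⊆ I → ∑ x ∈ s, analyticOrderAt f x ≤ N

/-- The Wronskian of two functions. -/
noncomputable def wron (T f : ℝ → ℝ) : ℝ → ℝ := fun x => T x * deriv f x - deriv T x * f x

namespace AtMost

variable {f g T : ℝ → ℝ} {I J : Set ℝ} {N M : ℕ∞}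

theorem mono (h : AtMost f J N) (hIJ : I ⊆ J) (hN : N ≤ M) : AtMost f I M :=
  fun s hs => (h s (hs.trans hIJ)).trans hN

theorem union (h : AtMost f I N) (h' : AtMost f J M) : AtMost f (I ∪ J) (N + M) := by
  classical
  intro s hs
  rw [← Finset.sum_filter_add_sum_filter_not s (· ∈ I)]
  refine add_le_add (h _ ?_) (h' _ ?_)
  · intro x hx
    simp only [Finset.coe_filter, mem_ofPred_eq] at hx
    exact hx.2
  · intro x hx
    simp only [Finset.coe_filter, mem_ofPred_eq] at hx
    exact (hs hx.1).resolve_left hx.2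

theorem of_ne_zero (h : ∀ x ∈ I, f x ≠ 0) : AtMost f I 0 := by
  intro s hs
  rw [Finset.sum_eq_zero]
  intro x hx
  exact analyticOrderAt_eq_zero.mpr (Or.inr (h x (hs hx)))

theorem congr_order (h : AtMost g I N) (hfg : ∀ x ∈ I, analyticOrderAt f x ≤ analyticOrderAt g x) :
    AtMost f I N := fun s hs => (Finset.sum_le_sum fun x hx => hfg x (hs hx)).trans (h s hs)

theorem mul (hf : AnalyticOnNhd ℝ f I) (hg : AnalyticOnNhd ℝ g I) (h : AtMost f I N)
    (h' : AtMost g I M) : AtMost (f * g) I (N + M) := by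
  intro s hs
  rw [Finset.sum_congr rfl fun x hx => analyticOrderAt_mul (hf x (hs hx)) (hg x (hs hx)),
    Finset.sum_add_distrib]
  exact add_le_add (h s hs) (h' s hs)

end AtMost

/-- Rolle's theorem with multiplicities: each zero loses one order under differentiation, and each
gap between consecutive zeros supplies a new zero of the derivative. -/
theorem exists_sum_order_le_deriv {f : ℝ → ℝ} {I : Set ℝ} (hI : I.OrdConnected)
    (hf : AnalyticOnNhd ℝ f I) (s : Finset ℝ) (hs : (s : Set ℝ) ⊆ I) :
    ∃ s' : Finset ℝ, (s' : Set ℝ) ⊆ I ∧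
      ∑ x ∈ s, analyticOrderAt f x ≤ ∑ x ∈ s', analyticOrderAt (deriv f) x + 1 := by
  classical
  -- The zeros are added in increasing order. The bound y ≤ x on the points found so far shows that
  -- each new Rolle point is distinct from them.
  have key : ∀ s : Finset ℝ, (s : Set ℝ) ⊆ I → (∀ x ∈ s, f x = 0) → ∃ s' : Finset ℝ,
      (s' : Set ℝ) ⊆ I ∧ (∀ y ∈ s', ∃ x ∈ s, y ≤ x) ∧
      ∑ x ∈ s, analyticOrderAt f x ≤ ∑ x ∈ s', analyticOrderAt (deriv f) x + 1 := by
    intro s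
    induction s using Finset.induction_on_max with
    | empty => intro _ _; exact ⟨∅, by simp, by simp, by simp⟩
    | insert a s hmax ih =>
      intro hs h0
      have ha : a ∈ I := hs (by simp)
      have ha0 : f a = 0 := h0 a (by simp)
      have has : a ∉ s := fun h => lt_irrefl _ (hmax a h)
      have hord : analyticOrderAt f a = analyticOrderAt (deriv f) a + 1 := by
        simpa [ha0] using (hf a ha).analyticOrderAt_deriv_add_one.symm
      obtain ⟨s', h1, h2, h3⟩ := ih (fun x hx => hs (by simp [Finset.mem_coe.mp hx]))
        (fun x hx => h0 x (by simp [hx]))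
      rcases s.eq_empty_or_nonempty with rfl | hne
      · refine ⟨{a}, by simpa using ha, by simp, by simp [hord]⟩
      · set b := s.max' hne with hb
        have hbs : b ∈ s := s.max'_mem hne
        have hbI : b ∈ I := hs (by simp [hbs])
        have hba : b < a := hmax b hbs
        have hsub : Icc b a ⊆ I := hI.out hbI ha
        obtain ⟨ξ, hξ, hξ0⟩ := exists_deriv_eq_zero hba
          (fun x hx => ((hf x (hsub hx)).continuousAt).continuousWithinAt)
          ((h0 b (by simp [hbs])).trans ha0.symm)
        have hξI : ξ ∈ I := hsub (Ioo_subset_Icc_self hξ)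
        have hle : ∀ y ∈ s', y ≤ b := by
          intro y hy
          obtain ⟨x, hx, hyx⟩ := h2 y hy
          exact hyx.trans (s.le_max' x hx)
        have hξs : ξ ∉ s' := fun h => absurd (hle ξ h) (not_le.mpr hξ.1)
        have has' : a ∉ insert ξ s' := by
          intro h
          rcases Finset.mem_insert.mp h with h | h
          · exact hξ.2.ne' h
          · exact absurd (hle a h) (not_le.mpr hba)
        refine ⟨insert a (insert ξ s'), ?_, ?_, ?_⟩
        · simp only [Finset.coe_insert]
          exact insert_subset ha (insert_subset hξI h1)
        · intro y hy
          refine ⟨a, by simp, ?_⟩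
          rcases Finset.mem_insert.mp hy with rfl | hy
          · exact le_rfl
          · rcases Finset.mem_insert.mp hy with rfl | hy
            · exact hξ.2.le
            · exact (hle y hy).trans hba.le
        · rw [Finset.sum_insert has, Finset.sum_insert has', Finset.sum_insert hξs, hord]
          have hξ1 : 1 ≤ analyticOrderAt (deriv f) ξ := by
            rw [Order.one_le_iff_ne_zero]
            exact (hf ξ hξI).deriv.analyticOrderAt_ne_zero.mpr hξ0
          calc analyticOrderAt (deriv f) a + 1 + ∑ x ∈ s, analyticOrderAt f x
              ≤ analyticOrderAt (deriv f) a + analyticOrderAt (deriv f) ξ +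
                (∑ x ∈ s', analyticOrderAt (deriv f) x + 1) := by gcongr
            _ = _ := by ring
  obtain ⟨s', h1, -, h3⟩ := key (s.filter (f · = 0))
    (fun x hx => hs (by simp at hx; exact_mod_cast hx.1)) (by simp)
  refine ⟨s', h1, ?_⟩
  rwa [Finset.sum_filter_of_ne] at h3
  intro x _ hx
  exact apply_eq_zero_of_analyticOrderAt_ne_zero hx

theorem analyticOrderAt_mul_of_ne_zero {h g : ℝ → ℝ} {x : ℝ} (hh : AnalyticAt ℝ h x)
    (hg : AnalyticAt ℝ g x) (h0 : h x ≠ 0) :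
    analyticOrderAt (h * g) x = analyticOrderAt g x := by
  rw [analyticOrderAt_mul hh hg, hh.analyticOrderAt_eq_zero.mpr h0, zero_add]

theorem AnalyticAt.wron {T f : ℝ → ℝ} {x : ℝ} (hT : AnalyticAt ℝ T x) (hf : AnalyticAt ℝ f x) :
    AnalyticAt ℝ (wron T f) x :=
  (hT.mul hf.deriv).sub (hT.deriv.mul hf)

/-- Rolle for f/T, whose derivative is W(T,f)/T²; factors without zeros do not change orders. -/
theorem exists_sum_order_le_wron {f T : ℝ → ℝ} {I : Set ℝ} (hI : I.OrdConnected)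
    (hf : AnalyticOnNhd ℝ f I) (hT : AnalyticOnNhd ℝ T I) (hT0 : ∀ x ∈ I, T x ≠ 0)
    (s : Finset ℝ) (hs : (s : Set ℝ) ⊆ I) :
    ∃ s' : Finset ℝ, (s' : Set ℝ) ⊆ I ∧
      ∑ x ∈ s, analyticOrderAt f x ≤ ∑ x ∈ s', analyticOrderAt (wron T f) x + 1 := by
  have hg : AnalyticOnNhd ℝ (f / T) I := fun x hx => (hf x hx).div (hT x hx) (hT0 x hx)
  obtain ⟨s', h1, h2⟩ := exists_sum_order_le_deriv hI hg s hs
  refine ⟨s', h1, ?_⟩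
  have e1 : ∀ x ∈ I, analyticOrderAt (f / T) x = analyticOrderAt f x := by
    intro x hx
    rw [← analyticOrderAt_mul_of_ne_zero (hT x hx) (hg x hx) (hT0 x hx)]
    refine analyticOrderAt_congr ?_
    filter_upwards [(hT x hx).continuousAt.eventually_ne (hT0 x hx)] with y hy
    simp [mul_div_cancel₀ _ hy]
  have e2 : ∀ x ∈ I, analyticOrderAt (deriv (f / T)) x = analyticOrderAt (wron T f) x := by
    intro x hx
    have hT2 : AnalyticAt ℝ (T * T) x := (hT x hx).mul (hT x hx)
    rw [← analyticOrderAt_mul_of_ne_zero hT2 (hg x hx).deriv (by simp [hT0 x hx])]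
    refine analyticOrderAt_congr ?_
    filter_upwards [(hT x hx).continuousAt.eventually_ne (hT0 x hx),
      (hT x hx).eventually_analyticAt, (hf x hx).eventually_analyticAt] with y hy hTy hfy
    rw [Pi.mul_apply, Pi.mul_apply, deriv_div hfy.differentiableAt hTy.differentiableAt hy, wron]
    field_simp
  rw [← Finset.sum_congr rfl fun x hx => e1 x (hs hx),
    ← Finset.sum_congr rfl fun x hx => e2 x (h1 hx)]
  exact h2

namespace AtMost

variable {f g T : ℝ → ℝ} {I J : Set ℝ} {N M : ℕ∞}

theorem of_wron (hI : I.OrdConnected) (hf : AnalyticOnNhd ℝ f I) (hT : AnalyticOnNhd ℝ T I)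
    (hT0 : ∀ x ∈ I, T x ≠ 0) (h : AtMost (wron T f) I N) : AtMost f I (N + 1) := by
  intro s hs
  obtain ⟨s', h1, h2⟩ := exists_sum_order_le_wron hI hf hT hT0 s hs
  exact h2.trans (add_le_add_left (h s' h1) 1)

theorem unique_zero (hT : AnalyticOnNhd ℝ T I) (h : AtMost T I 1) {x y : ℝ} (hx : x ∈ I)
    (hy : y ∈ I) (hx0 : T x = 0) (hy0 : T y = 0) : x = y := by
  classical
  by_contra hne
  have h2 := h {x, y} (by simp [insert_subset_iff, hx, hy])
  rw [Finset.sum_pair hne] at h2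
  have hx1 : 1 ≤ analyticOrderAt T x := by
    rw [Order.one_le_iff_ne_zero]; exact (hT x hx).analyticOrderAt_ne_zero.mpr hx0
  have hy1 : 1 ≤ analyticOrderAt T y := by
    rw [Order.one_le_iff_ne_zero]; exact (hT y hy).analyticOrderAt_ne_zero.mpr hy0
  have := (add_le_add hx1 hy1).trans h2
  norm_num at this

/-- If f vanishes at x, the factor T of T·f' gives back the order lost in f', and T'·f has at least
the order of f. So a zero of f at a zero of T survives in the Wronskian with its full order. -/
theorem order_le_wron {x : ℝ} (hf : AnalyticAt ℝ f x) (hT : AnalyticAt ℝ T x) (h0 : T x = 0) :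
    analyticOrderAt f x ≤ analyticOrderAt (wron T f) x := by
  have e : wron T f = T * deriv f - deriv T * f := rfl
  rw [e]
  refine le_trans (le_min ?_ ?_) le_analyticOrderAt_sub
  · rw [analyticOrderAt_mul hT hf.deriv]
    by_cases hfx : f x = 0
    · have h1 : 1 ≤ analyticOrderAt T x := by
        rw [Order.one_le_iff_ne_zero]; exact hT.analyticOrderAt_ne_zero.mpr h0
      have h2 := hf.analyticOrderAt_deriv_add_one
      simp only [hfx, sub_zero] at h2
      rw [← h2, add_comm]
      exact add_le_add_left h1 _
    · rw [hf.analyticOrderAt_eq_zero.mpr hfx]; exact zero_le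
  · rw [analyticOrderAt_mul hT.deriv hf]
    exact le_add_self

/-- At a zero σ of T the interval is cut in three: Rolle costs one zero on each side of σ, and σ
itself costs nothing by `order_le_wron`. -/
theorem of_wron_of_simple (hI : I.OrdConnected) (hf : AnalyticOnNhd ℝ f I)
    (hT : AnalyticOnNhd ℝ T I) (hT1 : AtMost T I 1) (h : AtMost (wron T f) I N) :
    AtMost f I (N + 2) := by
  classical
  by_cases hσ : ∃ σ ∈ I, T σ = 0
  · obtain ⟨σ, hσI, hσ0⟩ := hσ
    intro s hs
    have hne : ∀ x ∈ I, x ≠ σ → T x ≠ 0 := fun x hx hxσ hx0 =>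
      hxσ (unique_zero hT hT1 hx hσI hx0 hσ0)
    have hL : (I ∩ Iio σ).OrdConnected := hI.inter ordConnected_Iio
    have hR : (I ∩ Ioi σ).OrdConnected := hI.inter ordConnected_Ioi
    obtain ⟨s₁, a1, a2⟩ := exists_sum_order_le_wron hL (hf.mono inter_subset_left)
      (hT.mono inter_subset_left) (fun x hx => hne x hx.1 (ne_of_lt hx.2)) (s.filter (· < σ))
      (fun x hx => by
        simp only [Finset.coe_filter, mem_ofPred_eq] at hx
        exact ⟨hs hx.1, hx.2⟩)
    obtain ⟨s₂, b1, b2⟩ := exists_sum_order_le_wron hR (hf.mono inter_subset_left)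
      (hT.mono inter_subset_left) (fun x hx => hne x hx.1 (ne_of_gt hx.2)) (s.filter (σ < ·))
      (fun x hx => by
        simp only [Finset.coe_filter, mem_ofPred_eq] at hx
        exact ⟨hs hx.1, hx.2⟩)
    have hsub : s ⊆ s.filter (· < σ) ∪ {σ} ∪ s.filter (σ < ·) := by
      intro x hx
      rcases lt_trichotomy x σ with h | h | h <;> simp [hx, h]
    have hσ' := order_le_wron (hf σ hσI) (hT σ hσI) hσ0
    have d1 : Disjoint s₁ {σ} := by
      rw [Finset.disjoint_singleton_right]
      exact fun h => lt_irrefl σ (a1 h).2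
    have d2 : Disjoint (s₁ ∪ {σ}) s₂ := by
      rw [Finset.disjoint_left]
      intro x hx hx2
      have h2 : σ < x := (b1 hx2).2
      rcases Finset.mem_union.mp hx with hx | hx
      · exact lt_asymm h2 (a1 hx).2
      · rw [Finset.mem_singleton] at hx; exact h2.ne' hx
    have htot := h (s₁ ∪ {σ} ∪ s₂) (by
      intro x hx
      simp only [Finset.coe_union, Finset.coe_singleton, mem_union, mem_singleton_iff,
        Finset.mem_coe] at hx
      rcases hx with (hx | rfl) | hx
      · exact (a1 hx).1
      · exact hσI
      · exact (b1 hx).1)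
    rw [Finset.sum_union d2, Finset.sum_union d1, Finset.sum_singleton] at htot
    calc ∑ x ∈ s, analyticOrderAt f x
        ≤ ∑ x ∈ s.filter (· < σ) ∪ {σ} ∪ s.filter (σ < ·), analyticOrderAt f x :=
          Finset.sum_le_sum_of_subset hsub
      _ ≤ ∑ x ∈ s.filter (· < σ) ∪ {σ}, analyticOrderAt f x +
            ∑ x ∈ s.filter (σ < ·), analyticOrderAt f x := by
          rw [← Finset.sum_union_inter]; exact le_self_add
      _ ≤ ∑ x ∈ s.filter (· < σ), analyticOrderAt f x + analyticOrderAt f σ +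
            ∑ x ∈ s.filter (σ < ·), analyticOrderAt f x := by
          refine add_le_add_left ?_ _
          rw [← Finset.sum_singleton (analyticOrderAt f) σ, ← Finset.sum_union_inter (s₂ := {σ})]
          exact le_self_add
      _ ≤ (∑ x ∈ s₁, analyticOrderAt (wron T f) x + 1) + analyticOrderAt (wron T f) σ +
            (∑ x ∈ s₂, analyticOrderAt (wron T f) x + 1) := by gcongr
      _ = (∑ x ∈ s₁, analyticOrderAt (wron T f) x + analyticOrderAt (wron T f) σ +
            ∑ x ∈ s₂, analyticOrderAt (wron T f) x) + 2 := by ring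
      _ ≤ N + 2 := add_le_add_left htot 2
  · push Not at hσ
    exact (of_wron hI hf hT hσ h).mono le_rfl (add_le_add_right (by norm_num) N)

end AtMost

theorem analyticAt_rpow_const {x : ℝ} (hx : 0 < x) (a : ℝ) :
    AnalyticAt ℝ (fun y : ℝ => y ^ a) x := by
  have h : AnalyticAt ℝ (fun y : ℝ => Real.exp (Real.log y * a)) x :=
    ((analyticAt_log hx).mul analyticAt_const).rexp
  refine h.congr ?_
  filter_upwards [lt_mem_nhds hx] with y hy
  rw [Real.rpow_def_of_pos hy]

theorem wron_rpow {f : ℝ → ℝ} {x : ℝ} (hx : 0 < x) (κ : ℝ) :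
    wron (fun y => y ^ κ) f x = x ^ (κ - 1) * (x * deriv f x - κ * f x) := by
  have h : deriv (fun y : ℝ => y ^ κ) x = κ * x ^ (κ - 1) :=
    (Real.hasDerivAt_rpow_const (Or.inl hx.ne')).deriv
  rw [wron, h]
  have : x ^ κ = x ^ (κ - 1) * x := by
    rw [← Real.rpow_add_one hx.ne', sub_add_cancel]
  rw [this]; ring

/-- If `x f' - κ f` has no zero in an interval, then `f` has at most one. -/
theorem AtMost.of_euler_ne_zero {f : ℝ → ℝ} {I : Set ℝ} (hI : I.OrdConnected) (hpos : I ⊆ Ioi 0)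
    (hf : AnalyticOnNhd ℝ f I) (κ : ℝ) (h : ∀ x ∈ I, x * deriv f x - κ * f x ≠ 0) :
    AtMost f I 1 := by
  have := AtMost.of_wron (N := 0) hI hf (T := fun y => y ^ κ)
    (fun x hx => analyticAt_rpow_const (hpos hx) κ)
    (fun x hx => (Real.rpow_pos_of_pos (hpos hx) κ).ne')
    (AtMost.of_ne_zero fun x hx => by
      rw [wron_rpow (hpos hx)]
      exact mul_ne_zero (Real.rpow_pos_of_pos (hpos hx) _).ne' (h x hx))
  simpa using this

/-- If `x f' > κ f` on an interval, then `f` is positive to the right of its zeros. -/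
theorem pos_of_euler_pos {f : ℝ → ℝ} {I : Set ℝ} (hI : I.OrdConnected) (hpos : I ⊆ Ioi 0)
    (hf : AnalyticOnNhd ℝ f I) (κ : ℝ) (h : ∀ x ∈ I, 0 < x * deriv f x - κ * f x) {x y : ℝ}
    (hx : x ∈ I) (hy : y ∈ I) (hxy : x < y) (h0 : 0 ≤ f x) : 0 < f y := by
  have hsub : Icc x y ⊆ I := hI.out hx hy
  -- The derivative of x^(-κ) f is x^(-κ-1) (x f' − κ f), so x^(-κ) f increases.
  set g : ℝ → ℝ := fun z => z ^ (-κ) * f z with hg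
  have hd : ∀ z ∈ I, HasDerivAt g (z ^ (-κ - 1) * (z * deriv f z - κ * f z)) z := by
    intro z hz
    have hz0 : 0 < z := hpos hz
    have h1 := (Real.hasDerivAt_rpow_const (x := z) (p := -κ) (Or.inl hz0.ne')).mul
      (hf z hz).differentiableAt.hasDerivAt
    refine h1.congr_deriv ?_
    have : z ^ (-κ) = z ^ (-κ - 1) * z := by
      rw [← Real.rpow_add_one hz0.ne', sub_add_cancel]
    rw [this]; ring
  have hmono : StrictMonoOn g (Icc x y) := by
    refine strictMonoOn_of_deriv_pos (convex_Icc x y)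
      (fun z hz => (hd z (hsub hz)).continuousAt.continuousWithinAt) ?_
    intro z hz
    rw [interior_Icc] at hz
    have hzI := hsub (Ioo_subset_Icc_self hz)
    rw [(hd z hzI).deriv]
    exact mul_pos (Real.rpow_pos_of_pos (hpos hzI) _) (h z hzI)
  have h2 := hmono (left_mem_Icc.mpr hxy.le) (right_mem_Icc.mpr hxy.le) hxy
  have h3 : 0 ≤ g x := mul_nonneg (Real.rpow_pos_of_pos (hpos hx) _).le h0
  exact (mul_pos_iff_of_pos_left (Real.rpow_pos_of_pos (hpos hy) (-κ))).mp (h3.trans_lt h2)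

/-! ### Chains of Wronskians of terms `x ^ (e / m + j) * p ((m + 1) x ^ 2)` -/

/-- The quotient f/T is constant near a point with T ≠ 0, and the identity theorem spreads f = cT to
(0,∞). -/
theorem exists_eq_mul_of_wron_eq_zero {f T : ℝ → ℝ} (hf : AnalyticOnNhd ℝ f (Ioi 0))
    (hT : AnalyticOnNhd ℝ T (Ioi 0)) {x₁ : ℝ} (hx₁ : 0 < x₁) (hT1 : T x₁ ≠ 0)
    (h : ∀ x > 0, wron T f x = 0) : ∃ c : ℝ, ∀ x > 0, f x = c * T x := by
  have hev : ∀ᶠ x in 𝓝 x₁, T x ≠ 0 ∧ 0 < x :=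
    ((hT x₁ hx₁).continuousAt.eventually_ne hT1).and (lt_mem_nhds hx₁)
  obtain ⟨ε, hε, hball⟩ := Metric.eventually_nhds_iff_ball.mp hev
  have hdiff : ∀ x ∈ Metric.ball x₁ ε, DifferentiableAt ℝ (f / T) x := fun x hx =>
    (hf x (hball x hx).2).differentiableAt.div (hT x (hball x hx).2).differentiableAt (hball x hx).1
  have hconst := fun x hx => Metric.isOpen_ball.is_const_of_deriv_eq_zero (f := f / T)
    (convex_ball x₁ ε).isPreconnected (fun x hx => (hdiff x hx).differentiableWithinAt)
    (fun x hx => by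
      have h1 := h x (hball x hx).2
      rw [wron] at h1
      rw [deriv_div (hf x (hball x hx).2).differentiableAt (hT x (hball x hx).2).differentiableAt
        (hball x hx).1]
      simp only [Pi.zero_apply, div_eq_zero_iff]
      left
      linarith) (x := x) (y := x₁) hx (Metric.mem_ball_self hε)
  refine ⟨(f / T) x₁, ?_⟩
  have hg : AnalyticOnNhd ℝ (fun x => (f / T) x₁ * T x) (Ioi 0) := fun x hx =>
    analyticAt_const.mul (hT x hx)
  refine hf.eqOn_of_preconnected_of_eventuallyEq hg (convex_Ioi 0).isPreconnected hx₁ ?_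
  filter_upwards [Metric.ball_mem_nhds x₁ hε] with y hy
  rw [← hconst y hy, Pi.div_apply, div_mul_cancel₀ _ (hball y hy).1]

/-- If the Wronskian vanishes identically, f is a nonzero multiple of T and has no zero. Because of
this case distinction no linear independence is needed in the chain. -/
theorem AtMost.of_wron_on_pos {f T : ℝ → ℝ} {N : ℕ∞} (hf : AnalyticOnNhd ℝ f (Ioi 0))
    (hT : AnalyticOnNhd ℝ T (Ioi 0)) (hT0 : ∀ x > 0, T x ≠ 0)
    (h : (∃ x > 0, wron T f x ≠ 0) → AtMost (wron T f) (Ioi 0) N) (h0 : ∃ x > 0, f x ≠ 0) :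
    AtMost f (Ioi 0) (N + 1) := by
  by_cases hw : ∃ x > 0, wron T f x ≠ 0
  · exact AtMost.of_wron ordConnected_Ioi hf hT hT0 (h hw)
  · push Not at hw
    obtain ⟨c, hc⟩ := exists_eq_mul_of_wron_eq_zero hf hT one_pos (hT0 1 one_pos) hw
    obtain ⟨x₀, hx₀, hne⟩ := h0
    have hc0 : c ≠ 0 := by rintro rfl; exact hne (by rw [hc x₀ hx₀, zero_mul])
    refine (AtMost.of_ne_zero fun x hx => ?_).mono le_rfl zero_le
    rw [hc x hx]
    exact mul_ne_zero hc0 (hT0 x hx)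

theorem AtMost.of_wron_of_simple_on_pos {f T : ℝ → ℝ} {N : ℕ∞}
    (hf : AnalyticOnNhd ℝ f (Ioi 0)) (hT : AnalyticOnNhd ℝ T (Ioi 0))
    (hT1 : AtMost T (Ioi 0) 1)
    (h : (∃ x > 0, wron T f x ≠ 0) → AtMost (wron T f) (Ioi 0) N) (h0 : ∃ x > 0, f x ≠ 0) :
    AtMost f (Ioi 0) (N + 2) := by
  by_cases hw : ∃ x > 0, wron T f x ≠ 0
  · exact AtMost.of_wron_of_simple ordConnected_Ioi hf hT hT1 (h hw)
  · push Not at hw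
    -- A function with at most one zero cannot vanish both at 1 and at 2.
    obtain ⟨x₁, hx₁, hTx₁⟩ : ∃ x₁ > 0, T x₁ ≠ 0 := by
      by_contra! hcon
      have := AtMost.unique_zero hT hT1 (x := 1) (y := 2) (by simp) (by simp) (hcon 1 one_pos)
        (hcon 2 two_pos)
      norm_num at this
    obtain ⟨c, hc⟩ := exists_eq_mul_of_wron_eq_zero hf hT hx₁ hTx₁ hw
    obtain ⟨x₀, hx₀, hne⟩ := h0
    have hc0 : c ≠ 0 := by rintro rfl; exact hne (by rw [hc x₀ hx₀, zero_mul])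
    refine (hT1.congr_order fun x hx => ?_).mono le_rfl
      ((by norm_num : (1 : ℕ∞) ≤ 2).trans le_add_self)
    rw [← analyticOrderAt_mul_of_ne_zero (h := fun _ => c) analyticAt_const (hT x hx) hc0]
    refine (analyticOrderAt_congr ?_).le
    filter_upwards [lt_mem_nhds hx] with y hy
    simp [hc y hy]

theorem hasDerivAt_evB (m z : ℝ) (p : List (List ℤ)) :
    ∃ d, HasDerivAt (fun z => evB ic m z p) d z ∧ z * d = evB ic m z (theta 0 p) := by
  induction p with
  | nil => exact ⟨0, hasDerivAt_const _ _, by simp [evB, theta]⟩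
  | cons c s ih =>
    obtain ⟨d, hd, hzd⟩ := ih
    refine ⟨0 + (1 * evB ic m z s + z * d), (hasDerivAt_const _ _).add ((hasDerivAt_id z).mul hd), ?_⟩
    simp only [theta, evB, evU_usmul]
    rw [evB_theta_add, hzd]
    push_cast
    ring

theorem analyticAt_evB (m z : ℝ) (p : List (List ℤ)) :
    AnalyticAt ℝ (fun z => evB ic m z p) z := by
  induction p with
  | nil => exact analyticAt_const
  | cons c s ih => exact analyticAt_const.add (analyticAt_id.mul ih)

namespace Term

noncomputable def fn (m : ℝ) (t : Term) (x : ℝ) : ℝ :=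
  x ^ ((t.e : ℝ) / m + t.j) * evB ic m ((m + 1) * x ^ 2) t.p

theorem analyticOnNhd_fn (m : ℝ) (t : Term) : AnalyticOnNhd ℝ (t.fn m) (Ioi 0) := by
  intro x hx
  refine (analyticAt_rpow_const hx _).mul ?_
  exact (analyticAt_evB m _ t.p).fun_comp (f := fun x : ℝ => (m + 1) * x ^ 2)
    (analyticAt_const.mul (analyticAt_id.pow 2))

theorem hasDerivAt_fn_aux (m : ℝ) (t : Term) {x : ℝ} (hx : 0 < x) :
    HasDerivAt (t.fn m) (x ^ ((t.e : ℝ) / m + t.j - 1) *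
      (((t.e : ℝ) / m + t.j) * evB ic m ((m + 1) * x ^ 2) t.p +
        2 * evB ic m ((m + 1) * x ^ 2) (theta 0 t.p))) x := by
  obtain ⟨d, hd, hzd⟩ := hasDerivAt_evB m ((m + 1) * x ^ 2) t.p
  have h1 : HasDerivAt (fun x : ℝ => (m + 1) * x ^ 2) ((m + 1) * (2 * x)) x := by
    simpa using (hasDerivAt_pow 2 x).const_mul (m + 1)
  have h2 := (Real.hasDerivAt_rpow_const (x := x) (p := (t.e : ℝ) / m + t.j)
    (Or.inl hx.ne')).mul (hd.comp x h1)
  refine h2.congr_deriv ?_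
  have h3 : x ^ ((t.e : ℝ) / m + t.j) = x ^ ((t.e : ℝ) / m + t.j - 1) * x := by
    rw [← Real.rpow_add_one hx.ne', sub_add_cancel]
  simp only [Function.comp_apply]
  rw [h3, ← hzd]
  ring

theorem hasDerivAt_fn {m : ℝ} (hm : m ≠ 0) (t : Term) {x : ℝ} (hx : 0 < x) :
    HasDerivAt (t.fn m) (m⁻¹ * t.dop.fn m x) x := by
  refine (hasDerivAt_fn_aux m t hx).congr_deriv ?_
  simp only [fn, dop, evB_badd, evB_bsmul, evU]
  push_cast
  rw [show (t.e : ℝ) / m + ((t.j : ℝ) - 1) = (t.e : ℝ) / m + t.j - 1 by ring]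
  field_simp
  ring

theorem wron_fn {m : ℝ} (hm : m ≠ 0) (t₀ t : Term) {x : ℝ} (hx : 0 < x) :
    wron (t₀.fn m) (t.fn m) x = m⁻¹ * x ^ ((t₀.e : ℝ) / m + t₀.j - 1) *
      (x ^ ((t.e : ℝ) / m + t.j) *
        (evU ic m [t.e - t₀.e, t.j - t₀.j] * (evB ic m ((m + 1) * x ^ 2) t₀.p *
            evB ic m ((m + 1) * x ^ 2) t.p) +
          2 * m * (evB ic m ((m + 1) * x ^ 2) t₀.p * evB ic m ((m + 1) * x ^ 2) (theta 0 t.p) -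
            evB ic m ((m + 1) * x ^ 2) (theta 0 t₀.p) * evB ic m ((m + 1) * x ^ 2) t.p))) := by
  rw [wron, (hasDerivAt_fn_aux m t hx).deriv, (hasDerivAt_fn_aux m t₀ hx).deriv]
  have h3 : ∀ t : Term, x ^ ((t.e : ℝ) / m + t.j) = x ^ ((t.e : ℝ) / m + t.j - 1) * x := by
    intro t
    rw [← Real.rpow_add_one hx.ne', sub_add_cancel]
  simp only [fn, h3, evU]
  push_cast
  field_simp
  ring

theorem wron_fn_of_test {m : ℝ} (hm : m ≠ 0) {t₀ t t' : Term} {D : List (List ℤ)} {κ : List ℤ}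
    {k₁ k₂ : ℕ} (he : t'.e = t.e) (hj : t'.j = t.j)
    (h : wronTest k₁ k₂ [t.e - t₀.e, t.j - t₀.j] t₀.p t.p D κ t'.p = true) {x : ℝ} (hx : 0 < x) :
    wron (t₀.fn m) (t.fn m) x = m⁻¹ * x ^ ((t₀.e : ℝ) / m + t₀.j - 1) *
      evB ic m ((m + 1) * x ^ 2) D * (evU ic m κ * t'.fn m x) := by
  have h0 := wronVal_eq_zero h m ((m + 1) * x ^ 2)
  rw [wron_fn hm t₀ t hx]
  simp only [fn, he, hj]
  simp only [wronVal, evB, mul_zero, add_zero] at h0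
  have h1 : evU ic m [0, 2] = 2 * m := by simp [evU]; ring
  have h2 : (ic (-1) : ℝ) = -1 := by simp
  rw [h1, h2] at h0
  linear_combination (m⁻¹ * x ^ ((t₀.e : ℝ) / m + t₀.j - 1) * x ^ ((t.e : ℝ) / m + t.j)) * h0

end Term

/-- The linear combination of the functions of a list of terms. -/
noncomputable def lin (m : ℝ) : List ℝ → List Term → ℝ → ℝ
  | a :: as, t :: ts => fun x => a * t.fn m x + lin m as ts x
  | _, _ => fun _ => 0

theorem analyticOnNhd_lin (m : ℝ) (a : List ℝ) (L : List Term) :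
    AnalyticOnNhd ℝ (lin m a L) (Ioi 0) := by
  induction L generalizing a with
  | nil => cases a <;> exact fun _ _ => analyticAt_const
  | cons t L ih =>
    cases a with
    | nil => exact fun _ _ => analyticAt_const
    | cons a as =>
      exact fun x hx => (analyticAt_const.mul (t.analyticOnNhd_fn m x hx)).add (ih as x hx)

/-- Nontrivial combinations of the terms have at most `N` positive zeros. -/
def ZeroBound (m : ℝ) (L : List Term) (N : ℕ∞) : Prop :=
  ∀ a : List ℝ, (∃ x > 0, lin m a L x ≠ 0) → AtMost (lin m a L) (Ioi 0) N

theorem wron_add {T f g : ℝ → ℝ} {x : ℝ} (hf : DifferentiableAt ℝ f x)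
    (hg : DifferentiableAt ℝ g x) (a : ℝ) :
    wron T (fun y => a * f y + g y) x = a * wron T f x + wron T g x := by
  have : deriv (fun y => a * f y + g y) x = a * deriv f x + deriv g x :=
    ((hf.hasDerivAt.const_mul a).add hg.hasDerivAt).deriv
  simp only [wron, this]
  ring

theorem wron_self (T : ℝ → ℝ) (x : ℝ) : wron T T x = 0 := by
  simp only [wron]; ring

/-- The factors κ are absorbed in the new coefficients; they need not be nonzero. -/
theorem exists_wron_lin {m : ℝ} (hm : m ≠ 0) {t₀ : Term} {D : List (List ℤ)} {k₁ k₂ : ℕ}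
    {L : List Term} {L' : List (List ℤ × Term)} (h : stepTest k₁ k₂ t₀ D L L' = true)
    (a : List ℝ) : ∃ a' : List ℝ, ∀ x > 0, wron (t₀.fn m) (lin m a L) x =
      m⁻¹ * x ^ ((t₀.e : ℝ) / m + t₀.j - 1) * evB ic m ((m + 1) * x ^ 2) D *
        lin m a' (L'.map Prod.snd) x := by
  have hz : ∀ x, wron (t₀.fn m) (fun _ => 0) x = 0 := fun x => by simp [wron]
  induction L generalizing a L' with
  | nil => exact ⟨[], fun x _ => by cases a <;> simp [lin, hz]⟩
  | cons t L ih =>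
    match L', h with
    | (κ, t') :: L', h =>
      cases a with
      | nil => exact ⟨[], fun x _ => by simp [lin, hz]⟩
      | cons a as =>
        simp only [stepTest, Bool.and_eq_true, decide_eq_true_eq] at h
        obtain ⟨⟨⟨he, hj⟩, hw⟩, hL⟩ := h
        obtain ⟨a', ha'⟩ := ih hL as
        refine ⟨a * evU ic m κ :: a', fun x hx => ?_⟩
        have h1 := wron_add (T := t₀.fn m) (t.analyticOnNhd_fn m x hx).differentiableAt
          (analyticOnNhd_lin m as L x hx).differentiableAt a
        simp only [lin, List.map_cons]
        rw [h1, ha' x hx, Term.wron_fn_of_test hm he hj hw hx]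
        ring

theorem AtMost.of_eq_mul {f g h : ℝ → ℝ} {N : ℕ∞} (hh : AnalyticOnNhd ℝ h (Ioi 0))
    (hg : AnalyticOnNhd ℝ g (Ioi 0)) (h0 : ∀ x > 0, h x ≠ 0) (e : ∀ x > 0, f x = h x * g x)
    {I : Set ℝ} (hI : I ⊆ Ioi 0) (hb : AtMost g I N) : AtMost f I N := by
  refine hb.congr_order fun x hx => ?_
  rw [← analyticOrderAt_mul_of_ne_zero (hh x (hI hx)) (hg x (hI hx)) (h0 x (hI hx))]
  refine (analyticOrderAt_congr ?_).le
  filter_upwards [lt_mem_nhds (hI hx)] with y hy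
  exact e y hy

theorem analyticOnNhd_wronFactor (m a : ℝ) (D : List (List ℤ)) :
    AnalyticOnNhd ℝ (fun x => m⁻¹ * x ^ a * evB ic m ((m + 1) * x ^ 2) D) (Ioi 0) := by
  intro x hx
  refine (analyticAt_const.mul (analyticAt_rpow_const hx _)).mul ?_
  exact (analyticAt_evB m _ D).fun_comp (f := fun x : ℝ => (m + 1) * x ^ 2)
    (analyticAt_const.mul (analyticAt_id.pow 2))

theorem wron_lin_atMost {m : ℝ} (hm : 0 < m) {t₀ : Term} {D : List (List ℤ)} {k₁ k₂ : ℕ}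
    {L : List Term} {L' : List (List ℤ × Term)} (h : stepTest k₁ k₂ t₀ D L L' = true)
    (hD : ∀ z > 0, evB ic m z D ≠ 0) {N : ℕ∞} (hN : ZeroBound m (L'.map Prod.snd) N)
    (a₀ : ℝ) (a : List ℝ) (hne : ∃ x > 0, wron (t₀.fn m) (lin m (a₀ :: a) (t₀ :: L)) x ≠ 0) :
    AtMost (wron (t₀.fn m) (lin m (a₀ :: a) (t₀ :: L))) (Ioi 0) N := by
  obtain ⟨a', ha'⟩ := exists_wron_lin hm.ne' h a
  have e : ∀ x > 0, wron (t₀.fn m) (lin m (a₀ :: a) (t₀ :: L)) x =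
      (m⁻¹ * x ^ ((t₀.e : ℝ) / m + t₀.j - 1) * evB ic m ((m + 1) * x ^ 2) D) *
        lin m a' (L'.map Prod.snd) x := by
    intro x hx
    have h1 := wron_add (T := t₀.fn m) (t₀.analyticOnNhd_fn m x hx).differentiableAt
          (analyticOnNhd_lin m a L x hx).differentiableAt a₀
    simp only [lin]
    rw [h1, wron_self, mul_zero, zero_add, ha' x hx]
  refine AtMost.of_eq_mul (analyticOnNhd_wronFactor m _ D) (analyticOnNhd_lin m a' _) ?_ e le_rfl
    (hN a' ?_)
  · intro x hx
    have := hD ((m + 1) * x ^ 2) (by positivity)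
    have : x ^ ((t₀.e : ℝ) / m + t₀.j - 1) ≠ 0 := (Real.rpow_pos_of_pos hx _).ne'
    positivity
  · obtain ⟨x, hx, hx0⟩ := hne
    refine ⟨x, hx, fun h0 => hx0 ?_⟩
    rw [e x hx, h0, mul_zero]

theorem Term.fn_ne_zero {m : ℝ} (hm : 0 < m) {t : Term} (h : ∀ z > 0, evB ic m z t.p ≠ 0) :
    ∀ x > 0, t.fn m x ≠ 0 := by
  intro x hx
  exact mul_ne_zero (Real.rpow_pos_of_pos hx _).ne' (h _ (by positivity))

theorem ZeroBound.cons {m : ℝ} (hm : 0 < m) {t₀ : Term} {D : List (List ℤ)} {k₁ k₂ : ℕ}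
    {L : List Term} {L' : List (List ℤ × Term)} (h : stepTest k₁ k₂ t₀ D L L' = true)
    (hD : ∀ z > 0, evB ic m z D ≠ 0) (h₀ : ∀ z > 0, evB ic m z t₀.p ≠ 0) {N : ℕ∞}
    (hN : ZeroBound m (L'.map Prod.snd) N) : ZeroBound m (t₀ :: L) (N + 1) := by
  intro a hne
  cases a with
  | nil => obtain ⟨x, _, hx⟩ := hne; exact absurd rfl hx
  | cons a₀ a =>
    exact AtMost.of_wron_on_pos (analyticOnNhd_lin m _ _) (t₀.analyticOnNhd_fn m)
      (Term.fn_ne_zero hm h₀) (wron_lin_atMost hm h hD hN a₀ a) hne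

theorem ZeroBound.cons_of_simple {m : ℝ} (hm : 0 < m) {t₀ : Term} {D : List (List ℤ)} {k₁ k₂ : ℕ}
    {L : List Term} {L' : List (List ℤ × Term)} (h : stepTest k₁ k₂ t₀ D L L' = true)
    (hD : ∀ z > 0, evB ic m z D ≠ 0) (h₀ : AtMost (t₀.fn m) (Ioi 0) 1) {N : ℕ∞}
    (hN : ZeroBound m (L'.map Prod.snd) N) : ZeroBound m (t₀ :: L) (N + 2) := by
  intro a hne
  cases a with
  | nil => obtain ⟨x, _, hx⟩ := hne; exact absurd rfl hx
  | cons a₀ a =>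
    exact AtMost.of_wron_of_simple_on_pos (analyticOnNhd_lin m _ _) (t₀.analyticOnNhd_fn m)
      h₀ (wron_lin_atMost hm h hD hN a₀ a) hne

theorem hasDerivAt_lin {m : ℝ} (hm : m ≠ 0) (a : List ℝ) (L : List Term) {x : ℝ} (hx : 0 < x) :
    HasDerivAt (lin m a L) (lin m (a.map (· * m⁻¹)) (L.map Term.dop) x) x := by
  induction L generalizing a with
  | nil => cases a <;> exact hasDerivAt_const _ _
  | cons t L ih =>
    cases a with
    | nil => exact hasDerivAt_const _ _
    | cons a as =>
      simp only [List.map_cons, lin]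
      rw [mul_assoc]
      exact ((t.hasDerivAt_fn hm hx).const_mul a).add (ih as)

/-- Each derivative costs one zero and lowers the degree of Q. After k of them the polynomial is a
constant, which becomes the first term of the list. -/
theorem AtMost.polynomial_add_lin {m : ℝ} (hm : m ≠ 0) {N : ℕ∞} (k : ℕ) (Q : Polynomial ℝ)
    (hQ : Q.natDegree ≤ k) (a : List ℝ) (L : List Term)
    (hN : ZeroBound m (⟨0, 0, [[1]]⟩ :: L.map Term.dop^[k]) N)
    (hne : ∃ x > 0, Q.eval x + lin m a L x ≠ 0) :
    AtMost (fun x => Q.eval x + lin m a L x) (Ioi 0) (N + k) := by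
  induction k generalizing Q a L with
  | zero =>
    obtain ⟨c, rfl⟩ : ∃ c, Q = Polynomial.C c :=
      ⟨_, Polynomial.eq_C_of_natDegree_eq_zero (Nat.le_zero.mp hQ)⟩
    have e : (fun x => (Polynomial.C c).eval x + lin m a L x) =
        lin m (c :: a) (⟨0, 0, [[1]]⟩ :: L) := by
      funext x
      simp [lin, Term.fn, evB, evU]
    simp only [Function.iterate_zero, List.map_id_fun, id] at hN
    have hne' : ∃ x > 0, lin m (c :: a) (⟨0, 0, [[1]]⟩ :: L) x ≠ 0 := by
      obtain ⟨x, hx, h⟩ := hne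
      exact ⟨x, hx, by rw [← e]; exact h⟩
    rw [e]
    simpa using hN _ hne'
  | succ k ih =>
    have han : AnalyticOnNhd ℝ (fun x => Q.eval x + lin m a L x) (Ioi 0) := fun x hx => by
      refine AnalyticAt.add ?_ (analyticOnNhd_lin m a L x hx)
      simpa using AnalyticAt.aeval_polynomial (analyticAt_id (𝕜 := ℝ) (z := x)) Q
    have hd : ∀ x > 0, deriv (fun x => Q.eval x + lin m a L x) x =
        (Polynomial.derivative Q).eval x + lin m (a.map (· * m⁻¹)) (L.map Term.dop) x :=
      fun x hx => ((Q.hasDerivAt x).add (hasDerivAt_lin hm a L hx)).deriv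
    have hw : ∀ g : ℝ → ℝ, wron (fun _ => 1) g = deriv g := fun g => by
      funext x; simp [wron]
    have := AtMost.of_wron_on_pos (N := N + k) han (T := fun _ => 1)
      (fun _ _ => analyticAt_const) (fun _ _ => one_ne_zero) ?_ hne
    · simpa [add_assoc] using this
    · rw [hw]
      rintro ⟨x, hx, hx0⟩
      refine AtMost.congr_order (ih (Polynomial.derivative Q) ?_ (a.map (· * m⁻¹))
        (L.map Term.dop) ?_ ⟨x, hx, by rwa [← hd x hx]⟩) fun y hy => ?_
      · exact (Polynomial.natDegree_derivative_le Q).trans (by omega)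
      · simpa [Function.iterate_succ] using hN
      · refine (analyticOrderAt_congr ?_).le
        filter_upwards [lt_mem_nhds hy] with z hz
        exact hd z hz

theorem certVal_mul {v w m z d : ℝ} {A B p q M N D : List (List ℤ)} (hM : evB ic v w M = m)
    (hD : evB ic v w D = d) (hN : evB ic v w N = d * z) :
    d * certVal ic v w A B p q M N D = d ^ p.length * (evB ic v w A * evB ic m z p) +
      d ^ q.length * (evB ic v w B * evB ic m z q) := by
  have hp := hev_mul m (d * z) d z rfl p
  have hq := hev_mul m (d * z) d z rfl q
  rw [certVal, hM, hD, hN]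
  linear_combination evB ic v w A * hp + evB ic v w B * hq

/-- The sign of a combination of two polynomials of the same degree, from a certificate. -/
theorem pos_of_certTest {k₁ k₂ d₁ d₂ : ℕ} {A B p q M N D : List (List ℤ)}
    (h : certTest k₁ k₂ d₁ d₂ A B p q M N D = true) {v w m z d : ℝ} (hv : 0 ≤ v) (hw : 0 ≤ w)
    (hM : evB ic v w M = m) (hD : evB ic v w D = d) (hN : evB ic v w N = d * z) (hd : 0 < d)
    (hpq : q = [] ∨ p.length = q.length) :
    0 < evB ic v w A * evB ic m z p + evB ic v w B * evB ic m z q := by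
  have h1 := mul_pos hd (certVal_pos h hv hw)
  rw [certVal_mul hM hD hN] at h1
  have h2 : d ^ p.length * (evB ic v w A * evB ic m z p) +
      d ^ q.length * (evB ic v w B * evB ic m z q) =
      d ^ p.length * (evB ic v w A * evB ic m z p + evB ic v w B * evB ic m z q) := by
    rcases hpq with rfl | hpq
    · simp [evB]
    · rw [hpq]; ring
  rw [h2] at h1
  exact pos_of_mul_pos_right h1 (by positivity)

/-! ### The two-dimensional end of the chain -/

namespace Chain

theorem evB_pos_of_quarter {m z : ℝ} (hm : 4 ≤ m) (hz : 1 / 4 ≤ z) :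
    0 < evB ic m z tU2 ∧ 0 < evB ic m z wOE := by
  have hw : 0 ≤ 4 * z - 1 := by linarith
  have hv : 0 ≤ m - 4 := by linarith
  constructor
  · simpa [evB, evU] using pos_of_certTest certTest_tU2_pos hv hw (m := m) (z := z) (d := 4)
      (by simp [evB, evU]) (by simp [evB, evU]) (by simp [evB, evU]) (by norm_num) (Or.inl rfl)
  · simpa [evB, evU] using pos_of_certTest certTest_wOE_pos hv hw (m := m) (z := z) (d := 4)
      (by simp [evB, evU]) (by simp [evB, evU]) (by simp [evB, evU]) (by norm_num) (Or.inl rfl)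

theorem evB_qU0_ne_zero {m z : ℝ} (hm : 4 ≤ m) (hz : 0 < z) : evB ic m z qU0 ≠ 0 := by
  have := pos_of_certTest certTest_qU0_neg (sub_nonneg.mpr hm) hz.le (m := m) (z := z) (d := 1)
      (by simp [evB, evU]) (by simp [evB, evU]) (by simp [evB, evU]) (by norm_num) (Or.inl rfl)
  intro h
  simp [h, evB] at this

theorem evB_rU1_ne_zero {m z : ℝ} (hm : 4 ≤ m) (hz : 0 < z) : evB ic m z rU1 ≠ 0 := by
  have := pos_of_certTest certTest_rU1_neg (sub_nonneg.mpr hm) hz.le (m := m) (z := z) (d := 1)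
      (by simp [evB, evU]) (by simp [evB, evU]) (by simp [evB, evU]) (by norm_num) (Or.inl rfl)
  intro h
  simp [h, evB] at this

theorem evB_sU3_ne_zero {m z : ℝ} (hm : 4 ≤ m) (hz : 0 < z) : evB ic m z sU3 ≠ 0 := by
  have := pos_of_certTest certTest_sU3_neg (sub_nonneg.mpr hm) hz.le (m := m) (z := z) (d := 1)
      (by simp [evB, evU]) (by simp [evB, evU]) (by simp [evB, evU]) (by norm_num) (Or.inl rfl)
  intro h
  simp [h, evB] at this

theorem tU2_euler_pos {m z : ℝ} (hm : 4 ≤ m) (hz : 0 < z) :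
    0 < 2 * evB ic m z (theta 0 tU2) - 7 * evB ic m z tU2 := by
  have := pos_of_certTest certTest_tU2_theta (sub_nonneg.mpr hm) hz.le (m := m) (z := z) (d := 1)
      (by simp [evB, evU]) (by simp [evB, evU]) (by simp [evB, evU]) (by norm_num)
      (Or.inr (by decide))
  -- The unfolding equations are restricted to singleton and empty lists, so that the large
  -- polynomials stay folded.
  simp [evB.eq_2 _ _ _ _ [], evB.eq_1, evU.eq_2 _ _ _ [], evU.eq_1] at this
  linarith

section Small

variable {m v z : ℝ}

/-- Since x d/dx acts as 2θ, the last two inequalities are Euler inequalities with exponent 5 for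
−`wOE` and `yO`: each function divided by x⁵ increases on this range. -/
theorem signs_left (hv : 0 ≤ v) (hm : m = 4 * (1 + v) ^ 3) (hz : 0 < z)
    (hz1 : z * (24 + 20 * v + 10 * v ^ 2) ≤ 1) :
    evB ic m z tU2 < 0 ∧ 0 < 5 * evB ic m z wOE - 2 * evB ic m z (theta 0 wOE) ∧
      0 < 2 * evB ic m z (theta 0 yO) - 5 * evB ic m z yO := by
  set p := 24 + 20 * v + 10 * v ^ 2 with hp
  have hp0 : 0 < p := by positivity
  obtain ⟨w, hw, hwz⟩ : ∃ w : ℝ, 0 ≤ w ∧ p * (1 + w) * z = 1 := by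
    refine ⟨1 / (z * p) - 1, ?_, ?_⟩
    · rw [sub_nonneg, le_div_iff₀ (by positivity)]; linarith
    · field_simp; ring
  have hM : evB ic v w [[4, 12, 12, 4]] = m := by simp [evB, evU, hm]; ring
  have hD : evB ic v w [[24, 20, 10], [24, 20, 10]] = p * (1 + w) := by
    simp [evB, evU, hp]; ring
  have hN : evB ic v w [[1]] = p * (1 + w) * z := by simp [evB, evU, hwz]
  have hd : 0 < p * (1 + w) := by positivity
  refine ⟨?_, ?_, ?_⟩
  · have := pos_of_certTest certTest_tU2_neg hv hw hM hD hN hd (Or.inl rfl)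
    simp [evB.eq_2 _ _ _ _ [], evB.eq_1, evU.eq_2 _ _ _ [], evU.eq_1] at this
    linarith
  · have := pos_of_certTest certTest_wOE_theta_left hv hw hM hD hN hd (Or.inr (by decide))
    simp [evB.eq_2 _ _ _ _ [], evB.eq_1, evU.eq_2 _ _ _ [], evU.eq_1] at this
    linarith
  · have := pos_of_certTest certTest_yO_theta hv hw hM hD hN hd (Or.inr (by decide))
    simp [evB.eq_2 _ _ _ _ [], evB.eq_1, evU.eq_2 _ _ _ [], evU.eq_1] at this
    linarith

theorem signs_right (hv : 0 ≤ v) (hm : m = 4 * (1 + v) ^ 3)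
    (hz1 : 1 ≤ z * (24 + 20 * v + 10 * v ^ 2)) :
    0 < evB ic m z yO ∧
      0 < (6010 + 30 * v + 30 * v ^ 2 + 10 * v ^ 3) * evB ic m z (theta 0 wOE) -
        (42054 + 162 * v + 162 * v ^ 2 + 54 * v ^ 3) * evB ic m z wOE := by
  set p := 24 + 20 * v + 10 * v ^ 2 with hp
  have hp0 : 0 < p := by positivity
  have hw : 0 ≤ z * p - 1 := by linarith
  have hM : evB ic v (z * p - 1) [[4, 12, 12, 4]] = m := by simp [evB, evU, hm]; ring
  have hD : evB ic v (z * p - 1) [[24, 20, 10]] = p := by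
    simp [evB, evU, hp]; ring
  have hN : evB ic v (z * p - 1) [[1], [1]] = p * z := by simp [evB, evU]; ring
  constructor
  · simpa [evB.eq_2 _ _ _ _ [], evB.eq_1, evU.eq_2 _ _ _ [], evU.eq_1] using
      pos_of_certTest certTest_yO_pos hv hw hM hD hN hp0 (Or.inl rfl)
  · have := pos_of_certTest certTest_wOE_theta_right hv hw hM hD hN hp0 (Or.inr (by decide))
    generalize evB ic m z (theta 0 wOE) = a at this ⊢
    generalize evB ic m z wOE = b at this ⊢
    simp only [evB, evU, ic] at this
    push_cast at this
    have h2 : 0 < (z * p) ^ 2 := by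
      have : 0 < z * p := by linarith
      positivity
    -- With 1 + w = z p, this is the auxiliary factor (1+w)² of the certificate.
    refine pos_of_mul_pos_right (a := (z * p) ^ 2) ?_ h2.le
    refine lt_of_lt_of_eq this ?_
    ring

/-- One point to the left of 1/p where both signs are known. The Euler inequalities of `signs_left`
carry the sign of `wOE` to the right, and `yO` changes sign between the two points. -/
theorem signs_at (hv : 0 ≤ v) (hm : m = 4 * (1 + v) ^ 3)
    (hz1 : z * (93 + 16 * v + 63 * v ^ 2) = 1) :
    evB ic m z yO < 0 ∧ evB ic m z wOE < 0 := by
  set p := 93 + 16 * v + 63 * v ^ 2 with hp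
  have hp0 : 0 < p := by positivity
  have hM : evB ic v 0 [[4, 12, 12, 4]] = m := by simp [evB, evU, hm]; ring
  have hD : evB ic v 0 [[93, 16, 63]] = p := by
    simp [evB, evU, hp]; ring
  have hN : evB ic v 0 [[1]] = p * z := by simp [evB, evU]; linarith
  constructor
  · have := pos_of_certTest certTest_yO_neg hv le_rfl hM hD hN hp0 (Or.inl rfl)
    simp [evB.eq_2 _ _ _ _ [], evB.eq_1, evU.eq_2 _ _ _ [], evU.eq_1] at this
    linarith
  · have := pos_of_certTest certTest_wOE_neg hv le_rfl hM hD hN hp0 (Or.inl rfl)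
    simp [evB.eq_2 _ _ _ _ [], evB.eq_1, evU.eq_2 _ _ _ [], evU.eq_1] at this
    linarith

theorem gap_of_certTest {k₁ k₂ d₁ d₂ : ℕ} {A M N D : List (List ℤ)}
    (h : certTest k₁ k₂ d₁ d₂ A [[-1]] yO yE M N D = true) {w n d c : ℝ} (hv : 0 ≤ v)
    (hw : 0 ≤ w) (hM : evB ic v w M = m) (hN : evB ic v w N = n ^ 2) (hD : evB ic v w D = d ^ 2)
    (hA : evB ic v w A = c * (n * d)) (hd : 0 < d) :
    0 < c * (n / d) * evB ic m ((n / d) ^ 2) yO - evB ic m ((n / d) ^ 2) yE := by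
  have hd2 : 0 < d ^ 2 := by positivity
  have h1 := mul_pos hd2 (certVal_pos h hv hw)
  have hB : evB ic v w [[-1]] = -1 := by simp [evB, evU]
  rw [certVal_mul (z := (n / d) ^ 2) hM hD (by rw [hN]; field_simp), hA, hB,
    -- The lengths differ by one, so one factor d² is still missing at `yO`; it is supplied by c·n·d
    -- = c·(n/d)·d².
    show yO.length = 12 by decide, show yE.length = 13 by decide] at h1
  refine pos_of_mul_pos_right (a := (d ^ 2) ^ 13) ?_ (by positivity)
  convert h1 using 1
  have : n = n / d * d := by field_simp
  generalize hr : n / d = r at this ⊢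
  rw [this]
  ring

/-- The range is cut at t = 1/(4+v). The two halves are parametrized by t = 1/((4+v)(1+w)) and by
the map taking w = 0 to 1/(4+v) and w → ∞ to 1/2. -/
theorem gap {t : ℝ} (hv : 0 ≤ v) (hm : m = 4 * (1 + v) ^ 3) (ht : 0 < t) (ht2 : t < 1 / 2) :
    0 < (60 + 304 * v + 528 * v ^ 2 + 432 * v ^ 3 + 128 * v ^ 4) * t * evB ic m (t ^ 2) yO -
      evB ic m (t ^ 2) yE := by
  rcases le_total (t * (4 + v)) 1 with h | h
  · obtain ⟨w, hw, hwt⟩ : ∃ w : ℝ, 0 ≤ w ∧ t = 1 / ((4 + v) * (1 + w)) := by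
      refine ⟨1 / (t * (4 + v)) - 1, ?_, ?_⟩
      · rw [sub_nonneg, le_div_iff₀ (by positivity)]; linarith
      · field_simp; ring
    rw [hwt]
    refine gap_of_certTest certTest_gap_left hv hw ?_ ?_ ?_ ?_ (by positivity)
    all_goals simp [evB, evU]
    · rw [hm]; ring
    all_goals ring
  · obtain ⟨w, hw, hwt⟩ : ∃ w : ℝ, 0 ≤ w ∧ t = (2 + (4 + v) * w) / (2 * (4 + v) * (1 + w)) := by
      have h0 : 0 < 1 - 2 * t := by linarith
      refine ⟨(2 * (4 + v) * t - 2) / ((4 + v) * (1 - 2 * t)), ?_, ?_⟩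
      · apply div_nonneg
        · linarith
        · positivity
      · have h4 : 0 < 4 + v := by positivity
        have hd : (1 : ℝ) + (2 * (4 + v) * t - 2) / ((4 + v) * (1 - 2 * t)) =
            (2 + v) / ((4 + v) * (1 - 2 * t)) := by
          field_simp; ring
        have hn : (2 : ℝ) + (4 + v) * ((2 * (4 + v) * t - 2) / ((4 + v) * (1 - 2 * t))) =
            2 * (2 + v) * t / (1 - 2 * t) := by
          field_simp; ring
        have h2 : 0 < 2 + v := by positivity
        have h0' : 1 - t * 2 ≠ 0 := by linarith
        rw [hd, hn]
        field_simp
    rw [hwt]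
    refine gap_of_certTest certTest_gap_right hv hw ?_ ?_ ?_ ?_ (by positivity)
    all_goals simp [evB, evU]
    · rw [hm]; ring
    all_goals ring

end Small

end Chain

namespace Chain

/-- The function `x ↦ p ((m + 1) x ^ 2)`. -/
noncomputable def ev (m : ℝ) (p : List (List ℤ)) (x : ℝ) : ℝ := evB ic m ((m + 1) * x ^ 2) p

theorem analyticAt_ev (m : ℝ) (p : List (List ℤ)) (x : ℝ) : AnalyticAt ℝ (ev m p) x :=
  (analyticAt_evB m _ p).fun_comp (f := fun x : ℝ => (m + 1) * x ^ 2)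
    (analyticAt_const.mul (analyticAt_id.pow 2))

theorem euler_ev (m : ℝ) (p : List (List ℤ)) (x : ℝ) :
    x * deriv (ev m p) x = 2 * ev m (theta 0 p) x := by
  obtain ⟨d, hd, hzd⟩ := hasDerivAt_evB m ((m + 1) * x ^ 2) p
  have h1 : HasDerivAt (fun x : ℝ => (m + 1) * x ^ 2) ((m + 1) * (2 * x)) x := by
    simpa using (hasDerivAt_pow 2 x).const_mul (m + 1)
  have h2 : HasDerivAt (ev m p) (d * ((m + 1) * (2 * x))) x :=
    HasDerivAt.comp (h₂ := fun z => evB ic m z p) x hd h1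
  rw [h2.deriv, ev, ← hzd]
  ring

theorem exists_cube {m : ℝ} (hm : 4 ≤ m) : ∃ v : ℝ, 0 ≤ v ∧ m = 4 * (1 + v) ^ 3 := by
  have h1 : 1 ≤ m / 4 := by linarith
  refine ⟨(m / 4) ^ (1 / 3 : ℝ) - 1, ?_, ?_⟩
  · have := Real.one_le_rpow h1 (by norm_num : (0 : ℝ) ≤ 1 / 3)
    linarith
  · rw [add_sub_cancel, ← Real.rpow_natCast, ← Real.rpow_mul (by linarith)]
    norm_num
    ring

theorem atMost_tU2 {m : ℝ} (hm : 4 ≤ m) : AtMost (ev m tU2) (Ioi 0) 1 := by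
  refine AtMost.of_euler_ne_zero ordConnected_Ioi le_rfl (fun x _ => analyticAt_ev m _ x) 7 ?_
  intro x hx
  rw [euler_ev]
  exact (tU2_euler_pos hm (mul_pos (by linarith) (pow_pos hx 2))).ne'

/-- A point `τ` separating the sign regions of `yO`, with the zero counts of the factors of
the last Wronskian on either side. -/
theorem exists_separator {m : ℝ} (hm : 4 ≤ m) : ∃ τ > 0, (m + 1) * τ ^ 2 < 1 / 4 ∧
    (∀ x, 0 < x → x ≤ τ → ev m yO x ≤ 0) ∧ (∀ x, 0 < x → x < τ → ev m yO x < 0) ∧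
    (∀ x, τ < x → 0 < ev m yO x) ∧ AtMost (ev m yO) (Ioi 0) 1 ∧
    AtMost (ev m tU2 * ev m wOE) (Ioo 0 τ) 1 ∧ AtMost (ev m tU2 * ev m wOE) (Ioi τ) 2 := by
  obtain ⟨v, hv, hmv⟩ := exists_cube hm
  set p := 24 + 20 * v + 10 * v ^ 2 with hp
  set q := 93 + 16 * v + 63 * v ^ 2 with hq
  have hp0 : 0 < p := by positivity
  have hq0 : 0 < q := by positivity
  -- The difference q − p is 69 − 4v + 53v².
  have hpq : p < q := by nlinarith [sq_nonneg v, sq_nonneg (v - 1)]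
  have hm1 : 0 < m + 1 := by linarith
  set x₁ := √(1 / (p * (m + 1))) with hx₁
  set x₀ := √(1 / (q * (m + 1))) with hx₀
  have hx₁0 : 0 < x₁ := Real.sqrt_pos.mpr (by positivity)
  have hx₀0 : 0 < x₀ := Real.sqrt_pos.mpr (by positivity)
  have hs₁ : (m + 1) * x₁ ^ 2 * p = 1 := by
    rw [hx₁, Real.sq_sqrt (by positivity)]; field_simp
  have hs₀ : (m + 1) * x₀ ^ 2 * q = 1 := by
    rw [hx₀, Real.sq_sqrt (by positivity)]; field_simp
  have hx01 : x₀ < x₁ := by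
    refine Real.sqrt_lt_sqrt (by positivity) ?_
    rw [div_lt_div_iff_of_pos_left one_pos (by positivity) (by positivity)]
    exact mul_lt_mul_of_pos_right hpq hm1
  have hleft : ∀ x ∈ Ioc 0 x₁, _ := fun x hx => signs_left (z := (m + 1) * x ^ 2) hv hmv
    (mul_pos hm1 (pow_pos hx.1 2)) (by
      rw [← hp]
      have : x ^ 2 ≤ x₁ ^ 2 := pow_le_pow_left₀ hx.1.le hx.2 2
      refine le_trans ?_ hs₁.le
      gcongr)
  have hright : ∀ x, x₁ ≤ x → _ := fun x hx => signs_right (z := (m + 1) * x ^ 2) hv hmv (by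
      rw [← hp]
      have : x₁ ^ 2 ≤ x ^ 2 := pow_le_pow_left₀ hx₁0.le hx 2
      refine hs₁.ge.trans ?_
      gcongr)
  have hat := signs_at (z := (m + 1) * x₀ ^ 2) hv hmv hs₀
  have hIpos : Ioc 0 x₁ ⊆ Ioi 0 := fun x hx => hx.1
  have hIci : Ici x₁ ⊆ Ioi 0 := fun x hx => hx₁0.trans_le hx
  have hOe : ∀ x ∈ Ioc 0 x₁, 0 < x * deriv (ev m yO) x - 5 * ev m yO x := fun x hx => by
    rw [euler_ev]; exact (hleft x hx).2.2
  have hWd : ∀ x, deriv (-ev m wOE) x = -deriv (ev m wOE) x := fun x => deriv.neg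
  have hWe : ∀ x ∈ Ioc 0 x₁, 0 < x * deriv (-ev m wOE) x - 5 * (-ev m wOE) x := fun x hx => by
    have h1 := euler_ev m wOE x
    have h2 := (hleft x hx).2.1
    rw [hWd]
    simp only [Pi.neg_apply]
    have e : x * -deriv (ev m wOE) x - 5 * -ev m wOE x =
        5 * ev m wOE x - x * deriv (ev m wOE) x := by ring
    rw [e, h1]
    exact h2
  have hOan : AnalyticOnNhd ℝ (ev m yO) (Ioc 0 x₁) := fun x _ => analyticAt_ev m _ x
  have hWan : AnalyticOnNhd ℝ (-ev m wOE) (Ioc 0 x₁) := fun x _ => (analyticAt_ev m _ x).neg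
  have hx₀I : x₀ ∈ Ioc 0 x₁ := ⟨hx₀0, hx01.le⟩
  have hx₁I : x₁ ∈ Ioc 0 x₁ := ⟨hx₁0, le_rfl⟩
  -- The separator is the zero of `yO` between x₀, where `yO` is negative, and x₁, where it is
  -- positive.
  obtain ⟨τ, hτ, hτ0⟩ := intermediate_value_Ioo hx01.le
    (fun x _ => (analyticAt_ev m yO x).continuousAt.continuousWithinAt)
    (show (0 : ℝ) ∈ Ioo (ev m yO x₀) (ev m yO x₁) from ⟨hat.1, (hright x₁ le_rfl).1⟩)
  have hτpos : 0 < τ := hx₀0.trans hτ.1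
  have hτI : τ ∈ Ioc 0 x₁ := ⟨hτpos, hτ.2.le⟩
  have hOneg : ∀ x, 0 < x → x < τ → ev m yO x < 0 := by
    intro x hx hxτ
    by_contra! h
    have := pos_of_euler_pos ordConnected_Ioc hIpos hOan 5 hOe ⟨hx, hxτ.le.trans hτI.2⟩ hτI hxτ h
    exact this.ne' hτ0
  have hOpos : ∀ x, τ < x → 0 < ev m yO x := by
    intro x hx
    rcases le_total x x₁ with h | h
    · exact pos_of_euler_pos ordConnected_Ioc hIpos hOan 5 hOe hτI ⟨hτpos.trans hx, h⟩ hx hτ0.ge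
    · exact (hright x h).1
  have hsplit : Ioc 0 x₁ ∪ Ici x₁ = Ioi (0 : ℝ) := Ioc_union_Ici_eq_Ioi hx₁0
  -- As `wOE` is negative at x₀ < τ, it stays negative up to x₁; a zero of `wOE` to the right of τ
  -- can only lie beyond x₁.
  have hWneg : ∀ x ∈ Ioc τ x₁, ev m wOE x ≠ 0 := by
    intro x hx
    have := pos_of_euler_pos ordConnected_Ioc hIpos hWan 5 hWe hx₀I ⟨hτpos.trans hx.1, hx.2⟩
      (hτ.1.trans hx.1) (neg_nonneg.mpr hat.2.le)
    simp only [Pi.neg_apply, Left.neg_pos_iff] at this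
    exact this.ne
  have hXan : ∀ I, AnalyticOnNhd ℝ (ev m tU2) I := fun I x _ => analyticAt_ev m _ x
  have hWan' : ∀ I, AnalyticOnNhd ℝ (ev m wOE) I := fun I x _ => analyticAt_ev m _ x
  refine ⟨τ, hτpos, ?_, ?_, hOneg, hOpos, ?_, ?_, ?_⟩
  · have h1 : (m + 1) * τ ^ 2 * 24 ≤ 1 := by
      refine le_trans ?_ hs₁.le
      have : τ ^ 2 ≤ x₁ ^ 2 := pow_le_pow_left₀ hτpos.le hτ.2.le 2
      have : (24 : ℝ) ≤ p := by rw [hp]; nlinarith [sq_nonneg v]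
      gcongr
    linarith
  · intro x hx hxτ
    rcases hxτ.lt_or_eq with h | rfl
    · exact (hOneg x hx h).le
    · exact hτ0.le
  · rw [← hsplit, ← add_zero 1]
    refine (AtMost.of_euler_ne_zero ordConnected_Ioc hIpos hOan 5 fun x hx => (hOe x hx).ne').union
      (AtMost.of_ne_zero fun x hx => (hright x hx).1.ne')
  · rw [← zero_add 1]
    have hsub : Ioo 0 τ ⊆ Ioc 0 x₁ := fun x hx => ⟨hx.1, (hx.2.trans hτ.2).le⟩
    refine AtMost.mul (hXan _) (hWan' _)
      (AtMost.of_ne_zero fun x hx => (hleft x (hsub hx)).1.ne) ?_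
    refine AtMost.congr_order (g := -ev m wOE) ((AtMost.of_euler_ne_zero ordConnected_Ioc hIpos hWan
      5 fun x hx => (hWe x hx).ne').mono hsub le_rfl) fun x _ => ?_
    rw [analyticOrderAt_neg]
  · have e : (2 : ℕ∞) = 1 + (0 + 1) := by norm_num
    rw [e]
    refine AtMost.mul (hXan _) (hWan' _)
      ((atMost_tU2 hm).mono (fun x hx => hτpos.trans hx) le_rfl) ?_
    rw [← Ioc_union_Ici_eq_Ioi hτ.2]
    refine (AtMost.of_ne_zero hWneg).union ?_
    set kd := 6010 + 30 * v + 30 * v ^ 2 + 10 * v ^ 3 with hkd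
    set kn := 42054 + 162 * v + 162 * v ^ 2 + 54 * v ^ 3 with hkn
    have hkd0 : 0 < kd := by positivity
    refine AtMost.of_euler_ne_zero ordConnected_Ici hIci (hWan' _) (2 * kn / kd) fun x hx => ?_
    have h2 := (hright x hx).2
    rw [euler_ev]
    have e : 2 * ev m (theta 0 wOE) x - 2 * kn / kd * ev m wOE x =
        2 / kd * (kd * ev m (theta 0 wOE) x - kn * ev m wOE x) := by
      field_simp
    rw [e]
    exact (mul_pos (by positivity) h2).ne'

/-- Normalize the coefficient c of the `yE` term. If K + b/c ≥ 0 there is no zero on (0,τ], and at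
most 2 + 1 beyond τ. If K + b/c ≤ 0 there are at most 1 + 1 zeros on (0,τ), none on [τ,ξ), and at
most one on [ξ,∞), where z ≥ 1/4 and the Wronskian has no zero. -/
theorem zeroBound_pair {m : ℝ} (hm : 4 ≤ m) :
    ZeroBound m [⟨3, -4, yO⟩, ⟨3, -5, yE⟩] 3 := by
  intro a hne
  have hm0 : 0 < m := by linarith
  have hm1 : 0 < m + 1 := by linarith
  obtain ⟨τ, hτ, hτ4, hO1, hO2, hO3, hO4, hL, hR⟩ := exists_separator hm
  set TO : Term := ⟨3, -4, yO⟩ with hTO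
  set TE : Term := ⟨3, -5, yE⟩ with hTE
  have hfO : ∀ x > 0, TO.fn m x = x ^ ((3 : ℝ) / m - 5) * (x * ev m yO x) := by
    intro x hx
    have : x ^ ((3 : ℝ) / m - 4) = x ^ ((3 : ℝ) / m - 5) * x := by
      rw [← Real.rpow_add_one hx.ne']; ring_nf
    simp only [Term.fn, hTO, ev]
    push_cast
    rw [← sub_eq_add_neg, this, mul_assoc]
  have hfE : ∀ x > 0, TE.fn m x = x ^ ((3 : ℝ) / m - 5) * ev m yE x := by
    intro x hx
    simp only [Term.fn, hTE, ev]
    push_cast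
    rw [← sub_eq_add_neg]
  obtain ⟨b, c, hbc⟩ : ∃ b c : ℝ, lin m a [TO, TE] = fun x => c * TE.fn m x + b * TO.fn m x := by
    match a with
    | [] => exact ⟨0, 0, by funext x; simp [lin]⟩
    | [b] => exact ⟨b, 0, by funext x; simp [lin]⟩
    | b :: c :: l => exact ⟨b, c, by funext x; cases l <;> simp [lin] <;> ring⟩
  rw [hbc] at hne ⊢
  set f : ℝ → ℝ := fun x => c * TE.fn m x + b * TO.fn m x with hf
  have hTOan : AnalyticOnNhd ℝ (TO.fn m) (Ioi 0) := TO.analyticOnNhd_fn m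
  have hTEan : AnalyticOnNhd ℝ (TE.fn m) (Ioi 0) := TE.analyticOnNhd_fn m
  have hfan : AnalyticOnNhd ℝ f (Ioi 0) := fun x hx =>
    (analyticAt_const.mul (hTEan x hx)).add (analyticAt_const.mul (hTOan x hx))
  -- Without a `yE` part the function is a multiple of `yO` and has at most one zero.
  by_cases hc : c = 0
  · have hb : b ≠ 0 := by
      rintro rfl
      obtain ⟨x, _, hx⟩ := hne
      exact hx (by simp [hf, hc])
    refine (AtMost.of_eq_mul (f := f) (h := fun x => b * x ^ ((3 : ℝ) / m - 4))
      (g := ev m yO) (fun x hx => analyticAt_const.mul (analyticAt_rpow_const hx _))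
      (fun x _ => analyticAt_ev m _ x)
      (fun x hx => mul_ne_zero hb (Real.rpow_pos_of_pos hx _).ne') ?_ le_rfl hO4).mono le_rfl
      (by norm_num)
    intro x hx
    simp only [hf, hc, Term.fn, hTO, ev]
    push_cast
    rw [← sub_eq_add_neg]
    ring
  have hwr : ∀ x > 0, wron (TO.fn m) f x =
      (c * (m⁻¹ * x ^ ((3 : ℝ) / m - 5) * (m * x ^ ((3 : ℝ) / m - 5)))) *
        (ev m tU2 * ev m wOE) x := by
    intro x hx
    have h1 := wron_add (T := TO.fn m) (hTEan x hx).differentiableAt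
      (g := fun x => b * TO.fn m x) ((hTOan x hx).differentiableAt.const_mul b) c
    have h2 : wron (TO.fn m) (fun x => b * TO.fn m x) x = 0 := by
      simp only [wron]
      rw [deriv_const_mul _ (hTOan x hx).differentiableAt]
      ring
    have h3 := Term.wron_fn_of_test hm0.ne' (t₀ := TO) (t := TE) (t' := ⟨3, -5, wOE⟩) rfl rfl
      wronTest_yO_yE hx
    rw [h1, h2, add_zero, h3]
    simp only [Term.fn, hTO, ev, evU, Pi.mul_apply]
    push_cast
    rw [show (3 : ℝ) / m + -4 - 1 = 3 / m - 5 by ring, show (3 : ℝ) / m + -5 = 3 / m - 5 by ring]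
    ring
  have hwan : AnalyticOnNhd ℝ (ev m tU2 * ev m wOE) (Ioi 0) := fun x _ =>
    (analyticAt_ev m _ x).mul (analyticAt_ev m _ x)
  have hwb : ∀ {I : Set ℝ} {N : ℕ∞}, I ⊆ Ioi 0 → AtMost (ev m tU2 * ev m wOE) I N →
      AtMost (wron (TO.fn m) f) I N := fun hI h =>
    AtMost.of_eq_mul (h := fun x => c * (m⁻¹ * x ^ ((3 : ℝ) / m - 5) *
        (m * x ^ ((3 : ℝ) / m - 5))))
      (fun x hx => analyticAt_const.mul ((analyticAt_const.mul (analyticAt_rpow_const hx _)).mul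
        (analyticAt_const.mul (analyticAt_rpow_const hx _)))) hwan
      (fun x hx => by
        have := (Real.rpow_pos_of_pos hx ((3 : ℝ) / m - 5)).ne'
        positivity) hwr hI h
  have hTO0 : ∀ x > 0, ev m yO x ≠ 0 → TO.fn m x ≠ 0 := by
    intro x hx h
    rw [hfO x hx]
    exact mul_ne_zero (Real.rpow_pos_of_pos hx _).ne' (mul_ne_zero (ne_of_gt hx) h)
  have helim : ∀ {I : Set ℝ} {N : ℕ∞}, I.OrdConnected → I ⊆ Ioi 0 → (∀ x ∈ I, ev m yO x ≠ 0) →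
      AtMost (ev m tU2 * ev m wOE) I N → AtMost f I (N + 1) := fun hI hI0 h0 hb =>
    AtMost.of_wron hI (hfan.mono hI0) (hTOan.mono hI0) (fun x hx => hTO0 x (hI0 hx) (h0 x hx))
      (hwb hI0 hb)
  obtain ⟨v, hv, hmv⟩ := exists_cube hm
  set c₀ := 60 + 304 * v + 528 * v ^ 2 + 432 * v ^ 3 + 128 * v ^ 4 with hc₀
  set K := c₀ * √(m + 1) with hK
  have hsq : √(m + 1) ^ 2 = m + 1 := Real.sq_sqrt hm1.le
  have hs0 : 0 < √(m + 1) := Real.sqrt_pos.mpr hm1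
  have hgap : ∀ x > 0, (m + 1) * x ^ 2 < 1 / 4 → 0 < K * (x * ev m yO x) - ev m yE x := by
    intro x hx hx4
    have h1 : (√(m + 1) * x) ^ 2 = (m + 1) * x ^ 2 := by rw [mul_pow, hsq]
    have h2 := gap (t := √(m + 1) * x) hv hmv (by positivity) (by
      refine lt_of_pow_lt_pow_left₀ 2 (by norm_num) ?_
      rw [h1]; linarith)
    rw [h1] at h2
    refine lt_of_lt_of_eq h2 ?_
    simp only [ev, hK]
    ring
  have hfG : ∀ x > 0, f x = c * x ^ ((3 : ℝ) / m - 5) *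
      ((K + b / c) * (x * ev m yO x) - (K * (x * ev m yO x) - ev m yE x)) := by
    intro x hx
    simp only [hf, hfO x hx, hfE x hx]
    field_simp
    ring
  have hf0 : ∀ x > 0, (m + 1) * x ^ 2 < 1 / 4 → (K + b / c) * (x * ev m yO x) ≤ 0 → f x ≠ 0 := by
    intro x hx hx4 h
    rw [hfG x hx]
    have := hgap x hx hx4
    exact mul_ne_zero (mul_ne_zero hc (Real.rpow_pos_of_pos hx _).ne') (by linarith)
  have hquart : ∀ x, 0 < x → x ≤ τ → (m + 1) * x ^ 2 < 1 / 4 := by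
    intro x hx hxτ
    have : x ^ 2 ≤ τ ^ 2 := pow_le_pow_left₀ hx.le hxτ 2
    nlinarith
  have hTsub : Ioi τ ⊆ Ioi 0 := fun x hx => hτ.trans hx
  rcases le_total 0 (K + b / c) with hKb | hKb
  · have h1 : AtMost f (Ioc 0 τ) 0 := AtMost.of_ne_zero fun x hx =>
      hf0 x hx.1 (hquart x hx.1 hx.2) (mul_nonpos_of_nonneg_of_nonpos hKb
        (mul_nonpos_of_nonneg_of_nonpos hx.1.le (hO1 x hx.1 hx.2)))
    have h2 := helim ordConnected_Ioi hTsub (fun x hx => (hO3 x hx).ne') hR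
    have h3 := h1.union h2
    rw [Ioc_union_Ioi_eq_Ioi hτ.le] at h3
    exact h3.mono le_rfl (by norm_num)
  -- The point ξ is where z = 1/4, the end of the range of `gap`.
  · set ξ := 1 / (2 * √(m + 1)) with hξ
    have hξ0 : 0 < ξ := by positivity
    have hξ4 : (m + 1) * ξ ^ 2 = 1 / 4 := by
      rw [hξ, div_pow, mul_pow, hsq]; field_simp; norm_num
    have hτξ : τ < ξ := by
      refine lt_of_pow_lt_pow_left₀ 2 hξ0.le ?_
      rw [← hξ4] at hτ4
      exact lt_of_mul_lt_mul_left hτ4 hm1.le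
    have h1 := helim ordConnected_Ioo (fun x hx => hx.1) (fun x hx => (hO2 x hx.1 hx.2).ne) hL
    have h2 : AtMost f (Ico τ ξ) 0 := AtMost.of_ne_zero fun x hx => by
      have hx0 : 0 < x := hτ.trans_le hx.1
      have hO : 0 ≤ ev m yO x := by
        rcases hx.1.lt_or_eq with h | rfl
        · exact (hO3 x h).le
        -- At τ itself the inequality follows by continuity from the positivity to the right.
        · by_contra! h
          have hcont := (analyticAt_ev m yO τ).continuousAt.eventually_lt continuousAt_const h
          obtain ⟨y, hy, hyτ⟩ := ((hcont.filter_mono nhdsWithin_le_nhds).and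
            (self_mem_nhdsWithin (s := Ioi τ))).exists
          exact lt_asymm hy (hO3 y hyτ)
      refine hf0 x hx0 ?_ (mul_nonpos_of_nonpos_of_nonneg hKb (mul_nonneg hx0.le hO))
      rw [← hξ4]
      have : x ^ 2 < ξ ^ 2 := pow_lt_pow_left₀ hx.2 hx0.le (by norm_num)
      exact mul_lt_mul_of_pos_left this hm1
    have h3 : AtMost f (Ici ξ) (0 + 1) := by
      refine helim ordConnected_Ici (fun x hx => hξ0.trans_le hx)
        (fun x hx => (hO3 x (hτξ.trans_le hx)).ne') (AtMost.of_ne_zero fun x hx => ?_)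
      have hq : 1 / 4 ≤ (m + 1) * x ^ 2 := by
        rw [← hξ4]
        have : ξ ^ 2 ≤ x ^ 2 := pow_le_pow_left₀ hξ0.le hx 2
        exact mul_le_mul_of_nonneg_left this hm1.le
      have := evB_pos_of_quarter hm hq
      exact mul_ne_zero this.1.ne' this.2.ne'
    have h4 := (h1.union h2).union h3
    rw [Ioo_union_Ico_eq_Ioo hτ hτξ.le, Ioo_union_Ici_eq_Ioi hξ0] at h4
    exact h4.mono le_rfl (by norm_num)

theorem zeroBound_start {m : ℝ} (hm : 4 ≤ m) :
    ZeroBound m (⟨0, 0, [[1]]⟩ :: start.map Term.dop^[5]) 9 := by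
  have hm0 : 0 < m := by linarith
  have h1 : ∀ z > 0, evB ic m z [[1]] ≠ 0 := fun z _ => by simp [evB, evU]
  have hX : AtMost (Term.fn m ⟨2, -3, tU2⟩) (Ioi 0) 1 :=
    AtMost.of_eq_mul (fun x hx => analyticAt_rpow_const hx _) (fun x _ => analyticAt_ev m _ x)
      (fun x hx => (Real.rpow_pos_of_pos hx _).ne') (fun x _ => rfl) le_rfl (atMost_tU2 hm)
  have c1 := ZeroBound.cons_of_simple hm0 stepTest_tU2
    (fun z hz => evB_sU3_ne_zero hm hz) hX (zeroBound_pair hm)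
  have c2 := ZeroBound.cons hm0 stepTest_sU3 (fun z hz => evB_rU1_ne_zero hm hz)
    (fun z hz => evB_sU3_ne_zero hm hz) c1
  have c3 := ZeroBound.cons hm0 stepTest_rU1 (fun z hz => evB_qU0_ne_zero hm hz)
    (fun z hz => evB_rU1_ne_zero hm hz) c2
  have c4 := ZeroBound.cons hm0 stepTest_qU0 h1 (fun z hz => evB_qU0_ne_zero hm hz) c3
  have c5 := ZeroBound.cons hm0 stepTest_const h1 h1 c4
  -- 3 for the plane, 2 for `tU2` with its possible zero, and 1 each for `sU3`, `rU1`, `qU0` and the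
  -- constant.
  have e : (3 + 2 + 1 + 1 + 1 + 1 : ℕ∞) = 9 := by norm_num
  rwa [e] at c5

end Chain

/-! ### From analytic orders to the bound 14 for the family -/

theorem zeroMultiplicity_le_analyticOrderAt {f : ℝ → ℝ} {x : ℝ} (hf : AnalyticAt ℝ f x) :
    zeroMultiplicity f x ≤ analyticOrderAt f x :=
  iSup₂_le fun _ h => (natCast_le_analyticOrderAt_iff_iteratedDeriv_eq_zero hf).mpr h

theorem zeroCount_le_of_atMost {f g : ℝ → ℝ} {N : ℕ∞} {a b : ℝ} (ha : 0 < a)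
    (hg : AnalyticOnNhd ℝ g (Ioi 0)) (hfg : ∀ x > 0, f x = g x) (h : AtMost g (Ioi 0) N) :
    zeroCount f a b ≤ N := by
  refine iSup₂_le fun s hs => ?_
  have hpos : ∀ x ∈ s, 0 < x := fun x hx => ha.trans_le (hs hx).1
  refine le_trans (Finset.sum_le_sum fun x hx => ?_) (h s hpos)
  have he : f =ᶠ[𝓝 x] g := by
    filter_upwards [lt_mem_nhds (hpos x hx)] with y hy
    exact hfg y hy
  rw [← analyticOrderAt_congr he]
  exact zeroMultiplicity_le_analyticOrderAt ((hg x (hpos x hx)).congr he.symm)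

section Family

variable {k : ℕ} {lam : ℝ} {f : ℝ → ℝ}

theorem exists_coeff_of_mem_familySpan (hf : f ∈ familySpan (family7 k lam)) :
    ∃ c : Fin 7 → ℝ, ∀ x, f x = c 0 * u18 k x + c 1 * u19 k x + c 2 * u20 k x + c 3 * u21 k x +
      c 4 * u22 k x + c 5 * u23 k x + c 6 * u24 k lam x := by
  obtain ⟨c, rfl⟩ := (Submodule.mem_span_range_iff_exists_fun ℝ).mp hf
  refine ⟨c, fun x => ?_⟩
  simp [Fin.sum_univ_succ, family7, Fin.succ, Finset.sum_apply]
  ring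

theorem exists_polynomial_u24 (k : ℕ) (lam : ℝ) :
    ∃ Q : Polynomial ℝ, Q.natDegree ≤ 5 ∧ ∀ x, Q.eval x = u24 k lam x := by
  refine ⟨.C (lam ^ 3 * (2 * (k : ℝ) + 1) ^ 3) * .X ^ 5 +
    .C ((2 * (k : ℝ) + 1) * (3 * lam ^ 2 + (k : ℝ) * (6 * lam ^ 2 + 2))) * .X ^ 4 +
    .C ((2 * (k : ℝ) + 1) * (lam * ((4 * (k : ℝ) ^ 2 + 1) * lam ^ 2 +
      (k : ℝ) * (4 * lam ^ 2 - 6) + 3))) * .X ^ 3 +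
    .C (3 * (8 * (k : ℝ) ^ 2 + 6 * (k : ℝ) + 1) * lam ^ 2 + 1) * .X ^ 2 +
    .C (lam * (-4 * (k : ℝ) ^ 2 * lam ^ 2 - 2 * (k : ℝ) * (lam ^ 2 - 3) + 3)) * .X + .C 1,
    by compute_degree, fun x => ?_⟩
  simp only [Polynomial.eval_add, Polynomial.eval_mul, Polynomial.eval_C, Polynomial.eval_pow,
    Polynomial.eval_X, u24]
  ring

theorem familySpan_eq_polynomial_add_lin (hk : 1 < k) (hf : f ∈ familySpan (family7 k lam)) :
    ∃ (Q : Polynomial ℝ) (a : List ℝ), Q.natDegree ≤ 5 ∧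
      ∀ x > 0, f x = Q.eval x + lin (2 * k) a Chain.start x := by
  obtain ⟨c, hc⟩ := exists_coeff_of_mem_familySpan hf
  obtain ⟨Q, hQ, hQx⟩ := exists_polynomial_u24 k lam
  have hk0 : (k : ℝ) ≠ 0 := by positivity
  have hm1 : (2 * (k : ℝ) + 1) ≠ 0 := by positivity
  -- In `u18` and `u22` one factor 1 + z is expanded, which spreads them over the terms j = 0, 2 and
  -- j = 1, 3. In `u23`, x² + 1 = (m + 1 + z)/(m + 1).
  refine ⟨.C (c 6) * Q, [c 0, c 4, (2 * k + 1) * c 4 - c 2, (2 * k + 1) * c 0 - c 1, c 3,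
    c 5 / (2 * k + 1)], (Polynomial.natDegree_C_mul_le _ _).trans hQ, fun x hx => ?_⟩
  have e2 : ((2 : ℤ) : ℝ) / (2 * (k : ℝ)) = 1 / k := by push_cast; field_simp
  have e3 : ((3 : ℤ) : ℝ) / (2 * (k : ℝ)) = 3 / (2 * k) := by push_cast; rfl
  have hp : ∀ (a : ℝ) (n : ℕ), x ^ (a + n) = x ^ a * x ^ n := fun a n => by
    rw [Real.rpow_add hx, Real.rpow_natCast]
  have h1 : ∀ a : ℝ, x ^ (a + 1) = x ^ a * x := fun a => Real.rpow_add_one hx.ne' a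
  have h2 : ∀ a : ℝ, x ^ (a + 2) = x ^ a * x ^ 2 := fun a => by simpa using hp a 2
  have h3 : ∀ a : ℝ, x ^ (a + 3) = x ^ a * x ^ 3 := fun a => by simpa using hp a 3
  rw [hc x, Polynomial.eval_mul, Polynomial.eval_C, hQx]
  simp only [lin, Chain.start, Term.fn, e2, e3, evB, evU, u18, u19, u20, u21, u22, u23]
  push_cast
  simp only [h1, h2, h3, add_zero]
  field_simp
  ring

theorem maxZeros_family7_le (hk : 1 < k) (lam : ℝ) {a b : ℝ} (ha : 0 < a) :
    maxZeros (family7 k lam) a b ≤ 14 := by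
  refine iSup_le fun f => iSup₂_le fun hf hne => ?_
  obtain ⟨Q, c, hQ, hfx⟩ := familySpan_eq_polynomial_add_lin hk hf
  have hm : (4 : ℝ) ≤ 2 * k := by
    have : (2 : ℝ) ≤ k := by exact_mod_cast hk
    linarith
  have han : AnalyticOnNhd ℝ (fun x => Q.eval x + lin (2 * k) c Chain.start x) (Ioi 0) :=
    fun x hx => by
      refine AnalyticAt.add ?_ (analyticOnNhd_lin _ c _ x hx)
      simpa using AnalyticAt.aeval_polynomial (analyticAt_id (𝕜 := ℝ) (z := x)) Q
  refine zeroCount_le_of_atMost ha han hfx ?_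
  obtain ⟨x, hx, hx0⟩ := hne
  have hxpos : 0 < x := ha.trans_le hx.1
  have := AtMost.polynomial_add_lin (by linarith : (2 * (k : ℝ)) ≠ 0) 5 Q hQ c Chain.start
    (Chain.zeroBound_start hm) ⟨x, hxpos, by rwa [← hfx x hxpos]⟩
  exact this.mono le_rfl (by norm_num)

end Family

/-! ### Functions with many sign changes -/

/-- `f` alternates in sign, beginning with a positive value, at `n + 1` successive positive
points. -/
def Alternates (f : ℝ → ℝ) (n : ℕ) : Prop :=
  ∃ x : ℕ → ℝ, 0 < x 0 ∧ (∀ i < n, x i < x (i + 1)) ∧ ∀ i ≤ n, 0 < (-1) ^ i * f (x i)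

theorem eventually_alternates_add {f h : ℝ → ℝ} {n : ℕ} {x : ℕ → ℝ}
    (hs : ∀ i ≤ n, 0 < (-1) ^ i * f (x i)) :
    ∀ᶠ ε : ℝ in 𝓝 0, ∀ i ≤ n, 0 < (-1) ^ i * (f (x i) + ε * h (x i)) := by
  have : ∀ i ∈ Finset.range (n + 1), ∀ᶠ ε : ℝ in 𝓝 0, 0 < (-1) ^ i * (f (x i) + ε * h (x i)) := by
    intro i hi
    have hc : Continuous fun ε : ℝ => (-1) ^ i * (f (x i) + ε * h (x i)) := by fun_prop
    refine (hc.tendsto 0).eventually (lt_mem_nhds ?_)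
    simpa using hs i (by simpa [Nat.lt_succ_iff] using hi)
  filter_upwards [(Finset.eventually_all _).mpr this] with ε hε i hi
  exact hε i (by simpa [Nat.lt_succ_iff] using hi)

/-- A small multiple of a function of larger growth adds a sign change. -/
theorem Alternates.exists_add {f h : ℝ → ℝ} {n : ℕ} (hf : Alternates f n)
    (hfh : f =o[atTop] h) (hh : ∀ x > 0, 0 < h x) :
    ∃ ε : ℝ, Alternates (fun x => f x + ε * h x) (n + 1) := by
  obtain ⟨x, hx0, hx, hs⟩ := hf
  have hev := eventually_alternates_add (h := h) hs
  -- The coefficient has the sign (-1)^(n+1) required at the new far point, where h dominates; its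
  -- size δ is small enough to preserve the old signs.
  have hcont : Tendsto (fun δ : ℝ => (-1) ^ (n + 1) * δ) (𝓝[>] 0) (𝓝 0) := by
    have : Continuous fun δ : ℝ => (-1) ^ (n + 1) * δ := by fun_prop
    simpa using (this.tendsto 0).mono_left nhdsWithin_le_nhds
  obtain ⟨δ, hδ, hδ0⟩ := ((hcont.eventually hev).and self_mem_nhdsWithin).exists
  have hδ0 : 0 < δ := hδ0
  obtain ⟨y, hy1, hy2, hy3⟩ := ((isLittleO_iff.mp hfh (half_pos hδ0)).and
    ((eventually_gt_atTop (x n)).and (eventually_gt_atTop 0))).exists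
  refine ⟨(-1) ^ (n + 1) * δ, fun i => if i ≤ n then x i else y, by simpa using hx0, ?_, ?_⟩
  · intro i hi
    rcases (Nat.lt_succ_iff.mp hi).lt_or_eq with h | rfl
    · simpa [h.le, Nat.succ_le_of_lt h] using hx i h
    · simpa using hy2
  · intro i hi
    rcases hi.lt_or_eq with h | rfl
    · have h' : i ≤ n := Nat.lt_succ_iff.mp h
      simpa [h'] using hδ i h'
    · have hhy := hh y hy3
      rw [Real.norm_eq_abs, Real.norm_eq_abs, abs_of_pos hhy] at hy1
      have h2 : ((-1 : ℝ) ^ (n + 1)) * (-1) ^ (n + 1) = 1 := by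
        rw [← mul_pow]; norm_num
      have h3 : -|f y| ≤ (-1) ^ (n + 1) * f y := by
        have : |(-1) ^ (n + 1) * f y| = |f y| := by simp [abs_mul]
        rw [← this]
        exact neg_abs_le _
      have h4 : (-1) ^ (n + 1) * (f y + (-1) ^ (n + 1) * δ * h y) =
          (-1) ^ (n + 1) * f y + δ * h y := by
        linear_combination δ * h y * h2
      simp only [add_le_iff_nonpos_right, nonpos_iff_eq_zero, one_ne_zero, if_false]
      rw [h4]
      nlinarith [mul_pos hδ0 hhy]

/-- The one-dimensional Sard theorem: the critical values form a null set and cannot fill an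
interval. -/
theorem exists_small_regular {φ : ℝ → ℝ} (hφ : ∀ x > 0, DifferentiableAt ℝ φ x) {δ : ℝ}
    (hδ : 0 < δ) : ∃ η ∈ Ioo 0 δ, ∀ x > 0, φ x = -η → deriv φ x ≠ 0 := by
  set s : Set ℝ := {x | 0 < x ∧ deriv φ x = 0} with hs
  have h0 : MeasureTheory.volume (φ '' s) = 0 := by
    refine MeasureTheory.addHaar_image_eq_zero_of_det_fderivWithin_eq_zero
      (f' := fun x => fderiv ℝ φ x) _ (fun x hx => ?_) fun x hx => ?_
    · exact (hφ x hx.1).hasFDerivAt.hasFDerivWithinAt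
    · have : fderiv ℝ φ x = 0 := by
        ext
        simpa using hx.2
      rw [this]
      simp [ContinuousLinearMap.det]
  have h1 : ¬ Ioo (-δ) 0 ⊆ φ '' s := by
    intro hsub
    have := MeasureTheory.measure_mono_null hsub h0
    simp [Real.volume_Ioo] at this
    linarith
  obtain ⟨y, hy, hys⟩ := not_subset.mp h1
  refine ⟨-y, ⟨by linarith [hy.2], by linarith [hy.1]⟩, fun x hx hxy hd => hys ?_⟩
  exact ⟨x, ⟨hx, hd⟩, by simpa using hxy⟩

/-- If `f` alternates, then the sum of `f` and of some multiple of a positive function has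
simple zeros only, and alternates too. -/
theorem Alternates.exists_simple {f h : ℝ → ℝ} {n : ℕ} (hf : Alternates f n)
    (hfd : ∀ x > 0, DifferentiableAt ℝ f x) (hhd : ∀ x > 0, DifferentiableAt ℝ h x)
    (hh : ∀ x > 0, 0 < h x) :
    ∃ η : ℝ, (n : ℕ∞) ≤ {x : ℝ | 0 < x ∧ IsSimpleZero (fun x => f x + η * h x) x}.encard := by
  obtain ⟨x, hx0, hx, hs⟩ := hf
  obtain ⟨δ, hδ, hball⟩ := Metric.eventually_nhds_iff_ball.mp (eventually_alternates_add (h := h) hs)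
  -- Zeros of f + ηh are the points where f/h = −η, and there the derivative of f + ηh is h·(f/h)'.
  -- So they are simple as soon as −η is a regular value of f/h.
  obtain ⟨η, hη, hreg⟩ := exists_small_regular (φ := fun x => f x / h x)
    (fun x hx => (hfd x hx).div (hhd x hx) (hh x hx).ne') hδ
  have hs' := hball η (by simp [abs_of_pos hη.1, hη.2])
  have hxpos : ∀ i ≤ n, 0 < x i := by
    intro i
    induction i with
    | zero => exact fun _ => hx0
    | succ i ih => exact fun hi => (ih (by omega)).trans (hx i (by omega))
  set g : ℝ → ℝ := fun x => f x + η * h x with hg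
  have hgd : ∀ x > 0, DifferentiableAt ℝ g x := fun x hx => (hfd x hx).add ((hhd x hx).const_mul η)
  have hz : ∀ i : Fin n, ∃ z ∈ Ioo (x i) (x (i + 1)), g z = 0 := by
    intro i
    have h1 := hs' i i.2.le
    have h2 := hs' (i + 1) i.2
    have hcont : ContinuousOn (fun y => (-1) ^ (i : ℕ) * g y) (Icc (x i) (x (i + 1))) :=
      fun y hy => (continuousAt_const.mul (hgd y
        ((hxpos i i.2.le).trans_le hy.1)).continuousAt).continuousWithinAt
    obtain ⟨z, hz, hz0⟩ := intermediate_value_Ioo' (hx i i.2).le hcont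
      (show (0 : ℝ) ∈ Ioo ((-1) ^ (i : ℕ) * g (x (i + 1))) ((-1) ^ (i : ℕ) * g (x i)) from
        ⟨by rw [pow_succ] at h2; simp only [hg]; linarith, h1⟩)
    exact ⟨z, hz, (mul_eq_zero.mp hz0).resolve_left (by simp)⟩
  choose z hz hz0 using hz
  have hmono : ∀ i j : ℕ, i ≤ j → j ≤ n → x i ≤ x j := by
    intro i j hij
    induction j, hij using Nat.le_induction with
    | base => exact fun _ => le_rfl
    | succ j _ ih => exact fun hj => (ih (by omega)).trans (hx j (by omega)).le
  have hzm : StrictMono z := by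
    intro i j hij
    exact (hz i).2.trans_le ((hmono (i + 1) j hij j.2.le).trans (hz j).1.le)
  refine ⟨η, ?_⟩
  have hr : (range z).encard = n := by
    rw [← image_univ, hzm.injective.encard_image, encard_univ]
    simp
  rw [← hr]
  refine encard_le_encard ?_
  rintro _ ⟨i, rfl⟩
  have hzpos : 0 < z i := (hxpos i i.2.le).trans (hz i).1
  refine ⟨hzpos, hz0 i, ?_⟩
  have hhz := (hh _ hzpos).ne'
  have hr := hreg (z i) hzpos (by
    have := hz0 i
    simp only [hg] at this
    field_simp
    linarith)
  intro hd
  apply hr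
  have hd' : deriv f (z i) + η * deriv h (z i) = 0 := by
    rw [← hd]
    exact (((hfd _ hzpos).hasDerivAt.add ((hhd _ hzpos).hasDerivAt.const_mul η)).deriv).symm
  have hf0 : f (z i) = -η * h (z i) := by
    have := hz0 i
    simp only [hg] at this
    linarith
  change deriv (f / h) (z i) = 0
  rw [deriv_div (hfd _ hzpos) (hhd _ hzpos) hhz, hf0]
  field_simp
  linear_combination hd'

theorem isLittleO_of_mul_le {f h ψ : ℝ → ℝ} (hψ : Tendsto ψ atTop atTop)
    (hle : ∀ᶠ x in atTop, |f x| * ψ x ≤ h x) : f =o[atTop] h := by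
  rw [isLittleO_iff]
  intro c hc
  filter_upwards [hle, hψ.eventually_ge_atTop c⁻¹] with x hx hx2
  rw [Real.norm_eq_abs, Real.norm_eq_abs]
  have h1 : |f x| * c⁻¹ ≤ |f x| * ψ x := mul_le_mul_of_nonneg_left hx2 (abs_nonneg _)
  have h2 : |f x| ≤ c * h x := by
    have := h1.trans hx
    rw [← div_eq_mul_inv, div_le_iff₀ hc] at this
    linarith
  exact h2.trans (mul_le_mul_of_nonneg_left (le_abs_self _) hc.le)

/-! ### A function of the span with four sign changes -/

section LowerBound

variable {k : ℕ}

/-- The function `x ^ (1 / k) * ((2 k + 1) x ^ 2 + 1) ^ 2`. -/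
noncomputable def baseTerm (k : ℕ) (x : ℝ) : ℝ :=
  x ^ (1 / (k : ℝ)) * ((2 * (k : ℝ) + 1) * x ^ 2 + 1) ^ 2

/-- At x = 1 the values of `u24 k 1` and `baseTerm k` are 16(k+1)³ and 4(k+1)², so any multiple
above 4k + 4 gives a negative value there; 4k + 5 still leaves a positive value at 4/9. -/
noncomputable def baseFun (k : ℕ) (x : ℝ) : ℝ := u24 k 1 x - (4 * k + 5) * baseTerm k x

theorem baseTerm_pos {x : ℝ} (hx : 0 < x) : 0 < baseTerm k x := by
  have := Real.rpow_pos_of_pos hx (1 / (k : ℝ))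
  unfold baseTerm
  positivity

theorem baseFun_near_zero (hk : 1 < k) :
    ∃ x : ℝ, 0 < x ∧ x < 1 / (8 * k) ∧ 0 < baseFun k x := by
  have hk0 : (0 : ℝ) < k := by positivity
  have hs : (0 : ℝ) < 1 / k := by positivity
  have hc : ContinuousAt (baseFun k) 0 := by
    have h1 : ContinuousAt (fun x : ℝ => x ^ (1 / (k : ℝ))) 0 :=
      Real.continuousAt_rpow_const _ _ (Or.inr hs.le)
    have h2 : ContinuousAt (fun x : ℝ => u24 k 1 x) 0 := by
      unfold u24; fun_prop
    unfold baseFun baseTerm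
    fun_prop
  have h0 : baseFun k 0 = 1 := by
    simp [baseFun, baseTerm, u24, hk0.ne']
  have h1 : ∀ᶠ x in 𝓝[>] (0 : ℝ), 0 < baseFun k x :=
    (hc.eventually (lt_mem_nhds (by rw [h0]; exact one_pos))).filter_mono nhdsWithin_le_nhds
  have h2 : ∀ᶠ x : ℝ in 𝓝[>] 0, x < 1 / (8 * k) :=
    (gt_mem_nhds (by positivity)).filter_mono nhdsWithin_le_nhds
  obtain ⟨x, ⟨hx1, hx2⟩, hx3⟩ := ((h1.and h2).and self_mem_nhdsWithin).exists
  exact ⟨x, hx3, hx2, hx1⟩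

theorem u24_one (k : ℕ) (x : ℝ) : u24 k 1 x = (2 * k + 1) ^ 3 * x ^ 5 +
    (2 * k + 1) * (8 * k + 3) * x ^ 4 + (2 * k + 1) * (4 * k ^ 2 - 2 * k + 4) * x ^ 3 +
    (24 * k ^ 2 + 18 * k + 4) * x ^ 2 - (4 * k ^ 2 - 4 * k - 3) * x + 1 := by
  unfold u24; ring

theorem eight_mul_le_four_pow (hk : 1 < k) : 8 * k ≤ 4 ^ k := by
  induction k, hk using Nat.le_induction with
  | base => norm_num
  | succ k hk ih => rw [pow_succ]; omega

/-- The polynomial part is at most 3, while 8k ≤ 4^k gives (1/(8k))^(1/k) ≥ 1/4, so that the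
subtracted part is at least (4k+5)/4 > 3. -/
theorem baseFun_eighth_neg (hk : 1 < k) : baseFun k (1 / (8 * k)) < 0 := by
  have hk2 : (2 : ℝ) ≤ k := by exact_mod_cast hk
  have hk0 : (0 : ℝ) < k := by linarith
  have h4 : (1 / 4 : ℝ) ≤ (1 / (8 * k)) ^ (1 / (k : ℝ)) := by
    have h1 : (1 / 4 : ℝ) = ((1 / 4 : ℝ) ^ k) ^ (1 / (k : ℝ)) := by
      rw [← Real.rpow_natCast, ← Real.rpow_mul (by norm_num), mul_one_div_cancel hk0.ne',
        Real.rpow_one]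
    rw [h1]
    refine Real.rpow_le_rpow (by positivity) ?_ (by positivity)
    rw [div_pow, one_pow]
    exact one_div_le_one_div_of_le (by positivity) (by exact_mod_cast eight_mul_le_four_pow hk)
  have hb : (1 / 4 : ℝ) ≤ baseTerm k (1 / (8 * k)) := by
    unfold baseTerm
    have : (1 : ℝ) ≤ ((2 * (k : ℝ) + 1) * (1 / (8 * k)) ^ 2 + 1) ^ 2 := by
      refine one_le_pow₀ ?_
      have : 0 ≤ (2 * (k : ℝ) + 1) * (1 / (8 * k)) ^ 2 := by positivity
      linarith
    nlinarith
  have hP : u24 k 1 (1 / (8 * k)) ≤ 3 := by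
    rw [u24_one]
    obtain ⟨n, hn, hkn⟩ : ∃ n : ℝ, 0 ≤ n ∧ (k : ℝ) = 2 + n := ⟨k - 2, by linarith, by ring⟩
    rw [hkn, ← sub_nonneg]
    have : 3 - ((2 * (2 + n) + 1) ^ 3 * (1 / (8 * (2 + n))) ^ 5 +
        (2 * (2 + n) + 1) * (8 * (2 + n) + 3) * (1 / (8 * (2 + n))) ^ 4 +
        (2 * (2 + n) + 1) * (4 * (2 + n) ^ 2 - 2 * (2 + n) + 4) * (1 / (8 * (2 + n))) ^ 3 +
        (24 * (2 + n) ^ 2 + 18 * (2 + n) + 4) * (1 / (8 * (2 + n))) ^ 2 -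
        (4 * (2 + n) ^ 2 - 4 * (2 + n) - 3) * (1 / (8 * (2 + n))) + 1) =
      (32768 * (2 + n) ^ 5 * 2 - ((2 * (2 + n) + 1) ^ 3 +
        (2 * (2 + n) + 1) * (8 * (2 + n) + 3) * (8 * (2 + n)) +
        (2 * (2 + n) + 1) * (4 * (2 + n) ^ 2 - 2 * (2 + n) + 4) * (8 * (2 + n)) ^ 2 +
        (24 * (2 + n) ^ 2 + 18 * (2 + n) + 4) * (8 * (2 + n)) ^ 3 -
        (4 * (2 + n) ^ 2 - 4 * (2 + n) - 3) * (8 * (2 + n)) ^ 4)) / (32768 * (2 + n) ^ 5) := by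
      field_simp
      ring
    rw [this]
    apply div_nonneg _ (by positivity)
    ring_nf
    positivity
  unfold baseFun
  nlinarith

/-- The irrational power is replaced by a rational bound: (1 + (4/5)/k)^k ≤ e^(4/5) ≤ 9/4 gives
(4/9)^(1/k) ≤ k/(k + 4/5). -/
theorem baseFun_four_ninths_pos (hk : 1 < k) : 0 < baseFun k (4 / 9) := by
  have hk2 : (2 : ℝ) ≤ k := by exact_mod_cast hk
  have hk0 : (0 : ℝ) < k := by linarith
  have h4 : (4 / 9 : ℝ) ^ (1 / (k : ℝ)) * (k + 4 / 5) ≤ k := by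
    have h1 : 1 + (4 / 5 : ℝ) / k ≤ (9 / 4 : ℝ) ^ (1 / (k : ℝ)) := by
      have h2 : (1 + (4 / 5 : ℝ) / k) ^ k ≤ 9 / 4 := by
        have h3 : 1 + (4 / 5 : ℝ) / k ≤ Real.exp (4 / 5 / k) := by
          have := Real.add_one_le_exp ((4 / 5 : ℝ) / k)
          linarith
        have h5 : (1 + (4 / 5 : ℝ) / k) ^ k ≤ Real.exp (4 / 5 / k) ^ k :=
          pow_le_pow_left₀ (by positivity) h3 k
        rw [← Real.exp_nat_mul, mul_div_cancel₀ _ hk0.ne'] at h5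
        refine h5.trans ?_
        -- Fifth powers reduce e^(4/5) ≤ 9/4 to a numerical bound on e⁴.
        have h6 : Real.exp (4 / 5) ^ 5 = Real.exp 1 ^ 4 := by
          rw [← Real.exp_nat_mul, ← Real.exp_nat_mul]; norm_num
        have h7 := Real.exp_one_lt_d9
        refine le_of_pow_le_pow_left₀ (n := 5) (by norm_num) (by norm_num) ?_
        rw [h6]
        calc Real.exp 1 ^ 4 ≤ 2.7182818286 ^ 4 := pow_le_pow_left₀ (Real.exp_pos 1).le h7.le 4
          _ ≤ _ := by norm_num
      have h8 := Real.rpow_le_rpow (by positivity) h2 (by positivity : (0 : ℝ) ≤ 1 / k)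
      rwa [← Real.rpow_natCast, ← Real.rpow_mul (by positivity), mul_one_div_cancel hk0.ne',
        Real.rpow_one] at h8
    have h9 : (4 / 9 : ℝ) ^ (1 / (k : ℝ)) * (9 / 4 : ℝ) ^ (1 / (k : ℝ)) = 1 := by
      rw [← Real.mul_rpow (by norm_num) (by norm_num)]; norm_num
    have h10 : 0 < (4 / 9 : ℝ) ^ (1 / (k : ℝ)) := by positivity
    have h11 : (k : ℝ) + 4 / 5 = k * (1 + 4 / 5 / k) := by field_simp
    rw [h11]
    calc (4 / 9 : ℝ) ^ (1 / (k : ℝ)) * (k * (1 + 4 / 5 / k))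
        = k * ((4 / 9 : ℝ) ^ (1 / (k : ℝ)) * (1 + 4 / 5 / k)) := by ring
      _ ≤ k * ((4 / 9 : ℝ) ^ (1 / (k : ℝ)) * (9 / 4 : ℝ) ^ (1 / (k : ℝ))) := by gcongr
      _ = k := by rw [h9, mul_one]
  have hkey : (4 * (k : ℝ) + 5) * (k * ((2 * k + 1) * (4 / 9) ^ 2 + 1) ^ 2) <
      u24 k 1 (4 / 9) * (k + 4 / 5) := by
    rw [u24_one]
    obtain ⟨n, hn, hkn⟩ : ∃ n : ℝ, 0 ≤ n ∧ (k : ℝ) = 2 + n := ⟨k - 2, by linarith, by ring⟩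
    rw [hkn, ← sub_pos]
    ring_nf
    positivity
  have hq : (0 : ℝ) < (4 * (k : ℝ) + 5) * ((2 * k + 1) * (4 / 9) ^ 2 + 1) ^ 2 := by positivity
  have h12 := mul_le_mul_of_nonneg_left h4 hq.le
  have h13 : 0 < baseFun k (4 / 9) * (k + 4 / 5) := by
    unfold baseFun baseTerm
    nlinarith
  exact pos_of_mul_pos_left h13 (by positivity)

theorem baseFun_one_neg (k : ℕ) : baseFun k 1 < 0 := by
  have hk : (0 : ℝ) ≤ k := by positivity
  rw [baseFun, u24_one, baseTerm, Real.one_rpow]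
  nlinarith [mul_nonneg hk hk]

theorem exists_baseFun_pos (hk : 1 < k) : ∃ x > 1, 0 < baseFun k x := by
  have hk2 : (2 : ℝ) ≤ k := by exact_mod_cast hk
  have hk0 : (0 : ℝ) < k := by linarith
  -- With this y the bound for the subtracted part at x = y² is exactly y¹⁰, below the leading term
  -- (2k+1)³ y¹⁰. The square absorbs the exponent 1/k ≤ 1/2.
  set y : ℝ := (4 * k + 5) * (2 * k + 2) ^ 2 with hy
  have hy1 : 1 < y := by
    rw [hy]; nlinarith [sq_nonneg (2 * (k : ℝ) + 2)]
  have hy0 : 0 < y := by linarith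
  refine ⟨y ^ 2, one_lt_pow₀ hy1 two_ne_zero, ?_⟩
  have h1 : (y ^ 2) ^ (1 / (k : ℝ)) ≤ y := by
    have : (y ^ 2) ^ (1 / (k : ℝ)) ≤ (y ^ 2) ^ (1 / 2 : ℝ) := by
      refine Real.rpow_le_rpow_of_exponent_le (one_le_pow₀ hy1.le) ?_
      exact one_div_le_one_div_of_le two_pos hk2
    refine this.trans_eq ?_
    rw [← Real.sqrt_eq_rpow, Real.sqrt_sq hy0.le]
  have h2 : baseTerm k (y ^ 2) ≤ y * ((2 * k + 2) * y ^ 4) ^ 2 := by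
    unfold baseTerm
    have : (2 * (k : ℝ) + 1) * (y ^ 2) ^ 2 + 1 ≤ (2 * k + 2) * y ^ 4 := by
      have : 1 ≤ y ^ 4 := one_le_pow₀ hy1.le
      nlinarith
    gcongr
  have h3 : (2 * (k : ℝ) + 1) ^ 3 * y ^ 10 < u24 k 1 (y ^ 2) := by
    rw [u24_one]
    have hz : 1 ≤ y ^ 2 := one_le_pow₀ hy1.le
    have ha : (0 : ℝ) ≤ (2 * k + 1) * (8 * k + 3) * (y ^ 2) ^ 4 := by positivity
    have hb : (0 : ℝ) ≤ (2 * k + 1) * (4 * k ^ 2 - 2 * k + 4) * (y ^ 2) ^ 3 := by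
      have : (0 : ℝ) ≤ 4 * k ^ 2 - 2 * k + 4 := by nlinarith
      positivity
    have hc : (4 * (k : ℝ) ^ 2 - 4 * k - 3) * y ^ 2 ≤ (24 * k ^ 2 + 18 * k + 4) * (y ^ 2) ^ 2 := by
      have h5 : y ^ 2 ≤ (y ^ 2) ^ 2 := by nlinarith
      have h6 : (4 * (k : ℝ) ^ 2 - 4 * k - 3) ≤ 24 * k ^ 2 + 18 * k + 4 := by nlinarith
      exact mul_le_mul h6 h5 (by positivity) (by positivity)
    have he : (y ^ 2) ^ 5 = y ^ 10 := by ring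
    rw [he]
    linarith
  have h4 : (4 * (k : ℝ) + 5) * (y * ((2 * k + 2) * y ^ 4) ^ 2) = y ^ 10 := by
    have : (4 * (k : ℝ) + 5) * (y * ((2 * k + 2) * y ^ 4) ^ 2) =
      ((4 * (k : ℝ) + 5) * (2 * k + 2) ^ 2) * y ^ 9 := by ring
    rw [this, ← hy]; ring
  have h5 : y ^ 10 ≤ (2 * (k : ℝ) + 1) ^ 3 * y ^ 10 := by
    have : (1 : ℝ) ≤ (2 * (k : ℝ) + 1) ^ 3 := one_le_pow₀ (by linarith)
    nlinarith [pow_pos hy0 10]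
  have h6 := mul_le_mul_of_nonneg_left h2 (by positivity : (0 : ℝ) ≤ 4 * k + 5)
  unfold baseFun
  linarith

theorem alternates_baseFun (hk : 1 < k) : Alternates (baseFun k) 4 := by
  have hk2 : (2 : ℝ) ≤ k := by exact_mod_cast hk
  obtain ⟨x₀, h0, h01, hs0⟩ := baseFun_near_zero hk
  obtain ⟨x₄, h4, hs4⟩ := exists_baseFun_pos hk
  have hs1 := baseFun_eighth_neg hk
  have hs2 := baseFun_four_ninths_pos hk
  have hs3 := baseFun_one_neg k
  have h12 : 1 / (8 * (k : ℝ)) < 4 / 9 := by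
    rw [div_lt_div_iff₀ (by positivity) (by norm_num)]; linarith
  refine ⟨fun i => match i with
    | 0 => x₀ | 1 => 1 / (8 * k) | 2 => 4 / 9 | 3 => 1 | _ => x₄, h0, ?_, ?_⟩
  · intro i hi
    interval_cases i
    · exact h01
    · exact h12
    · norm_num
    · exact h4
  · intro i hi
    interval_cases i
    · simpa using hs0
    · simpa using hs1
    · simpa using hs2
    · simpa [pow_succ] using hs3
    · simpa [pow_succ] using hs4

end LowerBound

/-! ### Growth at infinity and the five further sign changes -/

section LowerBound

variable {k : ℕ}

theorem baseTerm_isLittleO_step (j : ℕ) : (fun x => baseTerm k x * x ^ j) =o[atTop]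
    fun x => baseTerm k x * x ^ (j + 1) := by
  refine isLittleO_of_mul_le tendsto_id ?_
  filter_upwards [eventually_gt_atTop 0] with x hx
  have := baseTerm_pos (k := k) hx
  rw [abs_of_pos (by positivity), id, pow_succ, mul_assoc]

theorem tendsto_rpow_inv (hk : 1 < k) {a : ℝ} (ha : 0 < a) :
    Tendsto (fun x : ℝ => x ^ (a / (k : ℝ))) atTop atTop :=
  tendsto_rpow_atTop (by positivity)

/-- The degree 5 of the polynomial is below the growth exponent 5 + 1/k. -/
theorem baseFun_isLittleO (hk : 1 < k) : baseFun k =o[atTop] fun x => baseTerm k x * x ^ 1 := by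
  have h1 : u24 k 1 =O[atTop] fun x => x ^ 5 := by
    obtain ⟨Q, hQ, hQx⟩ := exists_polynomial_u24 k 1
    have := Polynomial.isBigO_atTop_of_degree_le Q (Polynomial.X ^ 5) (by
      rw [Polynomial.degree_X_pow]
      exact Polynomial.degree_le_of_natDegree_le hQ)
    simpa [hQx] using this
  have h2 : (fun x : ℝ => x ^ 5) =o[atTop] fun x => baseTerm k x * x ^ 1 := by
    refine isLittleO_of_mul_le (tendsto_rpow_inv hk one_pos) ?_
    filter_upwards [eventually_gt_atTop 0] with x hx
    have hr := Real.rpow_pos_of_pos hx (1 / (k : ℝ))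
    rw [abs_of_pos (by positivity)]
    have h3 : x ^ 2 ≤ (2 * (k : ℝ) + 1) * x ^ 2 + 1 := by
      have : 0 ≤ 2 * (k : ℝ) * x ^ 2 := by positivity
      linarith
    have h4 : (x ^ 2) ^ 2 ≤ ((2 * (k : ℝ) + 1) * x ^ 2 + 1) ^ 2 :=
      pow_le_pow_left₀ (by positivity) h3 2
    calc x ^ 5 * x ^ (1 / (k : ℝ)) = x ^ (1 / (k : ℝ)) * (x ^ 2) ^ 2 * x ^ 1 := by ring
      _ ≤ x ^ (1 / (k : ℝ)) * ((2 * (k : ℝ) + 1) * x ^ 2 + 1) ^ 2 * x ^ 1 := by gcongr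
  have h3 := (baseTerm_isLittleO_step (k := k) 0).const_mul_left (4 * (k : ℝ) + 5)
  simp only [pow_zero, mul_one] at h3
  exact (h1.trans_isLittleO h2).sub h3

theorem u18_pos {x : ℝ} (hx : 0 < x) : 0 < u18 k x := by
  have := Real.rpow_pos_of_pos hx (1 / (k : ℝ))
  unfold u18
  positivity

theorem u21_pos {x : ℝ} (hx : 0 < x) : 0 < u21 k x := by
  have := Real.rpow_pos_of_pos hx (3 / (2 * (k : ℝ)) + 1)
  unfold u21
  positivity

theorem u23_pos {x : ℝ} (hx : 0 < x) : 0 < u23 k x := by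
  have := Real.rpow_pos_of_pos hx (3 / (2 * (k : ℝ)))
  unfold u23
  positivity

/-- The growth exponents are 7 + 1/k and 7 + 3/(2k); the quotient grows at least like x^(1/(2k)). -/
theorem baseTerm_isLittleO_u21 (hk : 1 < k) :
    (fun x => baseTerm k x * x ^ 3) =o[atTop] u21 k := by
  refine isLittleO_of_mul_le (tendsto_rpow_inv hk (a := 1 / 2) (by norm_num)) ?_
  filter_upwards [eventually_gt_atTop 0] with x hx
  have hb := baseTerm_pos (k := k) hx
  rw [abs_of_pos (by positivity)]
  have hr := Real.rpow_pos_of_pos hx (1 / (k : ℝ))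
  have hr2 := Real.rpow_pos_of_pos hx (1 / 2 / (k : ℝ))
  have e : x ^ (3 / (2 * (k : ℝ)) + 1) = x ^ (1 / (k : ℝ)) * x ^ (1 / 2 / (k : ℝ)) * x := by
    rw [Real.rpow_add_one hx.ne', ← Real.rpow_add hx]
    congr 2
    ring
  have h3 : x ^ 2 ≤ (2 * (k : ℝ) + 1) * x ^ 2 + 1 := by
    have : 0 ≤ 2 * (k : ℝ) * x ^ 2 := by positivity
    linarith
  unfold baseTerm u21
  rw [e]
  calc x ^ (1 / (k : ℝ)) * ((2 * (k : ℝ) + 1) * x ^ 2 + 1) ^ 2 * x ^ 3 * x ^ (1 / 2 / (k : ℝ))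
      = x ^ (1 / (k : ℝ)) * x ^ (1 / 2 / (k : ℝ)) * x *
        (((2 * (k : ℝ) + 1) * x ^ 2 + 1) ^ 2 * x ^ 2) := by ring
    _ ≤ x ^ (1 / (k : ℝ)) * x ^ (1 / 2 / (k : ℝ)) * x *
        (((2 * (k : ℝ) + 1) * x ^ 2 + 1) ^ 2 * ((2 * (k : ℝ) + 1) * x ^ 2 + 1)) := by gcongr
    _ = _ := by ring

theorem u21_isLittleO_u23 : u21 k =o[atTop] u23 k := by
  refine isLittleO_of_mul_le tendsto_id ?_
  filter_upwards [eventually_gt_atTop 0] with x hx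
  rw [abs_of_pos (u21_pos hx), id]
  have hr := Real.rpow_pos_of_pos hx (3 / (2 * (k : ℝ)))
  unfold u21 u23
  rw [Real.rpow_add_one hx.ne']
  have : 0 ≤ x ^ (3 / (2 * (k : ℝ))) * ((2 * (k : ℝ) + 1) * x ^ 2 + 1) ^ 3 := by positivity
  nlinarith

/-- The ladder of growth is `baseTerm` times x, x², x³, then `u21`, then `u23`; with the four sign
changes of `baseFun` this makes nine. -/
theorem exists_nine_simple_zeros (hk : 1 < k) :
    ∃ f ∈ familySpan (family7 k 1), 9 ≤ {x : ℝ | 0 < x ∧ IsSimpleZero f x}.encard := by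
  have hBpos : ∀ j : ℕ, ∀ x > 0, 0 < baseTerm k x * x ^ j := fun j x hx =>
    mul_pos (baseTerm_pos hx) (pow_pos hx j)
  have o₁ := baseFun_isLittleO hk
  obtain ⟨ε₁, a₁⟩ := (alternates_baseFun hk).exists_add o₁ (hBpos 1)
  have o₂ := (o₁.trans (baseTerm_isLittleO_step 1)).add
    ((baseTerm_isLittleO_step (k := k) 1).const_mul_left ε₁)
  obtain ⟨ε₂, a₂⟩ := a₁.exists_add o₂ (hBpos 2)
  have o₃ := (o₂.trans (baseTerm_isLittleO_step 2)).add
    ((baseTerm_isLittleO_step (k := k) 2).const_mul_left ε₂)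
  obtain ⟨ε₃, a₃⟩ := a₂.exists_add o₃ (hBpos 3)
  have o₄ := (o₃.trans (baseTerm_isLittleO_u21 hk)).add
    ((baseTerm_isLittleO_u21 hk).const_mul_left ε₃)
  obtain ⟨ε₄, a₄⟩ := a₃.exists_add o₄ fun x hx => u21_pos hx
  have o₅ := (o₄.trans u21_isLittleO_u23).add (u21_isLittleO_u23.const_mul_left ε₄)
  obtain ⟨ε₅, a₅⟩ := a₄.exists_add o₅ fun x hx => u23_pos hx
  have hrpow : ∀ (a : ℝ) (x : ℝ), 0 < x → DifferentiableAt ℝ (fun y : ℝ => y ^ a) x :=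
    fun a x hx => (Real.hasDerivAt_rpow_const (Or.inl hx.ne')).differentiableAt
  have d18 : ∀ x > 0, DifferentiableAt ℝ (u18 k) x := fun x hx => by
    have := hrpow (1 / (k : ℝ)) x hx
    unfold u18; fun_prop
  have d21 : ∀ x > 0, DifferentiableAt ℝ (u21 k) x := fun x hx => by
    have := hrpow (3 / (2 * (k : ℝ)) + 1) x hx
    unfold u21; fun_prop
  have d23 : ∀ x > 0, DifferentiableAt ℝ (u23 k) x := fun x hx => by
    have := hrpow (3 / (2 * (k : ℝ))) x hx
    unfold u23; fun_prop
  have d24 : ∀ x, DifferentiableAt ℝ (u24 k 1) x := fun x => by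
    unfold u24; fun_prop
  have dB : ∀ x > 0, DifferentiableAt ℝ (baseTerm k) x := fun x hx => by
    have := hrpow (1 / (k : ℝ)) x hx
    unfold baseTerm; fun_prop
  obtain ⟨η, hη⟩ := a₅.exists_simple (h := u18 k) (fun x hx => by
    have := d21 x hx
    have := d23 x hx
    have := d24 x
    have := dB x hx
    unfold baseFun
    fun_prop) d18 fun x hx => u18_pos hx
  -- `baseTerm` is `u18` + (2k+1) `u19`; its multiples by x, x², x³ are `u22` + (2k+1) `u20`, −`u19`
  -- and −`u20`.
  set c : Fin 7 → ℝ := ![η - (4 * k + 5), -(4 * k + 5) * (2 * k + 1) - ε₂,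
    (2 * k + 1) * ε₁ - ε₃, ε₄, ε₁, ε₅, 1] with hc
  refine ⟨∑ i, c i • family7 k 1 i,
    (Submodule.mem_span_range_iff_exists_fun ℝ).mpr ⟨c, rfl⟩, hη.trans (encard_le_encard ?_)⟩
  rintro x ⟨hx, hx0⟩
  have he : ∀ y > 0, (∑ i, c i • family7 k 1 i) y = baseFun k y + ε₁ * (baseTerm k y * y ^ 1) +
      ε₂ * (baseTerm k y * y ^ 2) + ε₃ * (baseTerm k y * y ^ 3) + ε₄ * u21 k y + ε₅ * u23 k y +
      η * u18 k y := by
    intro y hy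
    have e1 : y ^ (1 / (k : ℝ) + 1) = y ^ (1 / (k : ℝ)) * y := Real.rpow_add_one hy.ne' _
    have e3 : y ^ (1 / (k : ℝ) + 3) = y ^ (1 / (k : ℝ)) * y ^ 3 := by
      rw [Real.rpow_add hy]; norm_cast
    simp [Fin.sum_univ_succ, family7, Fin.succ, Finset.sum_apply, hc, -one_div]
    simp only [u18, u19, u20, u22, baseFun, baseTerm, e1, e3]
    ring
  have hev : (∑ i, c i • family7 k 1 i) =ᶠ[𝓝 x] fun y => baseFun k y +
      ε₁ * (baseTerm k y * y ^ 1) + ε₂ * (baseTerm k y * y ^ 2) + ε₃ * (baseTerm k y * y ^ 3) +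
      ε₄ * u21 k y + ε₅ * u23 k y + η * u18 k y := by
    filter_upwards [lt_mem_nhds hx] with y hy
    exact he y hy
  refine ⟨hx, ?_, ?_⟩
  · rw [hev.eq_of_nhds]; exact hx0.1
  · rw [hev.deriv_eq]; exact hx0.2

end LowerBound

end ZeroBounds

theorem proposition5 (k : ℕ) (hk : 1 < k) :
    (∀ lam a b : ℝ, 0 < a → a < b → maxZeros (family7 k lam) a b ≤ 14) ∧
      ∃ f ∈ familySpan (family7 k 1), 9 ≤ {x : ℝ | 0 < x ∧ IsSimpleZero f x}.encard :=
  ⟨fun lam _ _ ha _ => maxZeros_family7_le hk lam ha, exists_nine_simple_zeros hk⟩
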